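/- Lemma (Higher homologies over $\mathbb Z_2$). Let $T$ be a (Hausdorff) CW-complex and let $k\ge 0$ be an integer. For each $n$ let $T_n$ be the set of $n$-cells of $T$ and let $C_n=\bigoplus_{T_n}\mathbb Z_2$ be the group of cellular $n$-chains over $\mathbb Z_2$. The cellular boundary map $\partial\colon C_{n+1}\to C_n$ is $\partial\gamma=\sum_{\beta\in T_n}[\gamma:\beta]\,\beta$, where $[\gamma:\beta]\in\mathbb Z_2$ is the degree modulo $2$ of the composite of the attaching map $S^n\to T^{(n)}$ of $\gamma$ with the collapse $T^{(n)}\to T^{(n)}/(T^{(n)}\setminus\beta)\cong S^n$. Let $H_k(T,\mathbb Z_2)$ be the homology of this complex: $k$-cycles modulo $k$-boundaries. Place one qubit $\mathbb C^2$ on every $k$-cell, so that the state space is $\mathcal H=\bigotimes_{\beta\in T_k}\mathbb C^2$ (the algebraic tensor product, if $T_k$ is infinite). For every $(k-1)$-cell $\alpha$ (there is none if $k=0$) let $V_\alpha$ be the operator on $\mathcal H$ that acts as $\sigma_z$ on each qubit $\beta\in T_k$ with $[\beta:\alpha]\neq 0$ and as the identity on all other qubits. For every $(k+1)$-cell $\gamma$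 let $P_\gamma$ be the operator that acts as $\sigma_x$ on each qubit $\beta\in T_k$ with $[\gamma:\beta]\neq 0$ and as the identity on all other qubits. Then: 1. all the operators $V_\alpha$ and $P_\gamma$ commute pairwise; 2. if $T$ has finitely many $k$-cells, then the common $+1$-eigenspace of all the $V_\alpha$ and $P_\gamma$ is isomorphic, as a complex vector space, to the group algebra $\mathbb C[H_k(T,\mathbb Z_2)]$. -/

import Mathlib

open CategoryTheory CategoryTheory.Limits Topology
open scoped TensorProduct

universe u

noncomputable section

namespace HomologyCode

/-! ### Singular homology with coefficients in `ℤ/2` -/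

/-- The singular chain complex with coefficients in `ℤ/2`, as a functor on topological spaces. -/
abbrev singularChains : TopCat.{u} ⥤ ChainComplex (ModuleCat.{u} (ZMod 2)) ℕ :=
  (AlgebraicTopology.singularChainComplexFunctor (ModuleCat.{u} (ZMod 2))).obj
    (ModuleCat.of (ZMod 2) (ULift.{u} (ZMod 2)))

/-- The map induced by `f` on the `n`-th singular homology with coefficients in `ℤ/2`. -/
abbrev singularHomologyMap {A Y : TopCat.{u}} (f : A ⟶ Y) (n : ℕ) :
    (singularChains.obj A).homology n ⟶ (singularChains.obj Y).homology n :=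
  HomologicalComplex.homologyMap (singularChains.map f) n

/-- The relative singular chain complex `S(Y) / S(A)` of a map `A ⟶ Y` (an inclusion below). -/
abbrev relativeChains {A Y : TopCat.{u}} (i : A ⟶ Y) :
    ChainComplex (ModuleCat.{u} (ZMod 2)) ℕ :=
  cokernel (singularChains.map i)

/-- The map `H_n(Y; ℤ/2) ⟶ H_n(Y, A; ℤ/2)`. -/
abbrev toRelativeHomology {A Y : TopCat.{u}} (i : A ⟶ Y) (n : ℕ) :
    (singularChains.obj Y).homology n ⟶ (relativeChains i).homology n :=
  HomologicalComplex.homologyMap (cokernel.π (singularChains.map i)) n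

/-! ### The domain of the characteristic maps -/

/-- The closed unit ball of `Fin m → ℝ` with the maximum norm, which is the domain of the
characteristic maps of `m`-cells in Mathlib. -/
abbrev disk (m : ℕ) : TopCat.{u} :=
  TopCat.of (ULift.{u} (Metric.closedBall (0 : Fin m → ℝ) 1))

/-- The boundary sphere of `disk m`, a topological sphere of dimension `m - 1`. -/
abbrev diskBoundary (m : ℕ) : TopCat.{u} :=
  TopCat.of (ULift.{u} (Metric.sphere (0 : Fin m → ℝ) 1))

/-- The inclusion of the boundary sphere in the disk. -/
def diskBoundaryIncl (m : ℕ) : diskBoundary.{u} m ⟶ disk.{u} m :=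
  TopCat.ofHom
    { toFun := fun x => ⟨⟨x.down.1, Metric.sphere_subset_closedBall x.down.2⟩⟩
      continuous_toFun := by fun_prop }

/-- The reduced homology `H̃_n(∂D^m; ℤ/2)`, as the kernel of `H_n(∂D^m) ⟶ H_n(D^m)`. -/
abbrev reducedSphereHomology (m n : ℕ) : ModuleCat.{u} (ZMod 2) :=
  kernel (singularHomologyMap (diskBoundaryIncl.{u} m) n)

/-! ### The cellular chain complex of a CW complex with coefficients in `ℤ/2` -/

variable {X : Type u} [TopologicalSpace X] [T2Space X] (C : Set X) [CWComplex C]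

/-- The space `⋃_{j < m} X^j`, i.e. the `(m - 1)`-skeleton. -/
abbrev skel (m : ℕ) : TopCat.{u} :=
  TopCat.of ((RelCWComplex.skeletonLT C (m : ℕ∞) : Set X))

variable {C}

/-- The attaching map of an `m`-cell, from the boundary sphere of the disk to the
`(m - 1)`-skeleton. -/
def attachingMap {m : ℕ} (γ : RelCWComplex.cell C m) : diskBoundary.{u} m ⟶ skel C m :=
  TopCat.ofHom
    { toFun := fun x => ⟨RelCWComplex.map m γ x.down.1,
        CWComplex.cellFrontier_subset_skeletonLT m γ ⟨x.down.1, x.down.2, rfl⟩⟩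
      continuous_toFun := by
        refine Continuous.subtype_mk ?_ _
        exact (RelCWComplex.continuousOn m γ).comp_continuous
          (continuous_subtype_val.comp continuous_uliftDown)
          (fun x => Metric.sphere_subset_closedBall x.down.2) }

/-- The complement of the open cell `β` in the `(m - 1)`-skeleton. -/
abbrev skelMinus (m : ℕ) {n : ℕ} (β : RelCWComplex.cell C n) : TopCat.{u} :=
  TopCat.of ((RelCWComplex.skeletonLT C (m : ℕ∞) : Set X) \ RelCWComplex.openCell n β : Set X)

/-- The inclusion of the complement of the open cell `β` in the `(m - 1)`-skeleton. -/
def skelMinusIncl (m : ℕ) {n : ℕ} (β : RelCWComplex.cell C n) : skelMinus m β ⟶ skel C m :=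
  TopCat.ofHom ⟨Set.inclusion Set.sdiff_subset, continuous_inclusion Set.sdiff_subset⟩

/-- For an `(n + 1)`-cell `γ` and an `n`-cell `β`, the map
`H̃_n(S^n) ⟶ H_n(X^n) ⟶ H_n(X^n, X^n ∖ β) = H̃_n(X^n / (X^n ∖ β))` with coefficients in `ℤ/2`
induced by the attaching map of `γ`. Both ends are copies of `ℤ/2`, and the map is
multiplication by the degree of `S^n ⟶ X^n ⟶ X^n / (X^n ∖ β) ≅ S^n`. -/
def degreeMap {m n : ℕ} (γ : RelCWComplex.cell C m) (β : RelCWComplex.cell C n) :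
    reducedSphereHomology.{u} m n ⟶ (relativeChains (skelMinusIncl m β)).homology n :=
  kernel.ι (singularHomologyMap (diskBoundaryIncl.{u} m) n) ≫
    singularHomologyMap (attachingMap γ) n ≫ toRelativeHomology (skelMinusIncl m β) n

open Classical in
/-- The cellular incidence number modulo 2 of an `m`-cell `γ` and an `n`-cell `β`. If `m = n + 1`
it is the degree modulo 2 of `S^n ⟶ X^n ⟶ X^n / (X^n ∖ β) ≅ S^n`, that is, `1` if this map is
nonzero on `H̃_n(-; ℤ/2)` and `0` otherwise. If `m ≠ n + 1` it is `0`. -/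
def incidence {m n : ℕ} (γ : RelCWComplex.cell C m) (β : RelCWComplex.cell C n) : ZMod 2 :=
  if m = n + 1 ∧ degreeMap γ β ≠ 0 then 1 else 0

/-- An attaching map which misses the open cell `β` has degree zero there. -/
theorem degreeMap_eq_zero {m n : ℕ} (γ : RelCWComplex.cell C m) (β : RelCWComplex.cell C n)
    (h : Disjoint (RelCWComplex.cellFrontier m γ) (RelCWComplex.openCell n β)) :
    degreeMap γ β = 0 := by
  let g : diskBoundary.{u} m ⟶ skelMinus m β := TopCat.ofHom
    { toFun := fun x => ⟨RelCWComplex.map m γ x.down.1,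
        CWComplex.cellFrontier_subset_skeletonLT m γ ⟨x.down.1, x.down.2, rfl⟩,
        Set.disjoint_left.1 h ⟨x.down.1, x.down.2, rfl⟩⟩
      continuous_toFun := by
        refine Continuous.subtype_mk ?_ _
        exact (RelCWComplex.continuousOn m γ).comp_continuous
          (continuous_subtype_val.comp continuous_uliftDown)
          (fun x => Metric.sphere_subset_closedBall x.down.2) }
  have hg : attachingMap γ = g ≫ skelMinusIncl m β := rfl
  have h0 : singularHomologyMap (attachingMap γ) n ≫
      toRelativeHomology (skelMinusIncl m β) n = 0 := by
    rw [← HomologicalComplex.homologyMap_comp, hg, Functor.map_comp, Category.assoc,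
      cokernel.condition, comp_zero, HomologicalComplex.homologyMap_zero]
  rw [degreeMap, h0, comp_zero]

/-- Only finitely many cells have a nonzero incidence number with a given cell. -/
theorem finite_support_incidence {m : ℕ} (n : ℕ) (γ : RelCWComplex.cell C m) :
    (Function.support fun β : RelCWComplex.cell C n => incidence γ β).Finite := by
  obtain ⟨I, hI⟩ := CWComplex.cellFrontier_subset_finite_openCell (C := C) m γ
  refine (I n).finite_toSet.subset fun β hβ => ?_
  by_contra hmem
  refine hβ ?_
  have hd : Disjoint (RelCWComplex.cellFrontier m γ) (RelCWComplex.openCell n β) := by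
    refine Set.disjoint_left.2 fun x hx hxβ => ?_
    obtain ⟨j, -, i, hi, hxi⟩ : ∃ j, ∃ _ : j < m, ∃ i, ∃ _ : i ∈ I j,
        x ∈ RelCWComplex.openCell (C := C) j i := by simpa using hI hx
    by_cases he : (⟨j, i⟩ : Σ l, RelCWComplex.cell C l) = ⟨n, β⟩
    · cases he
      exact hmem hi
    · exact Set.disjoint_left.1 (CWComplex.disjoint_openCell_of_ne he) hxi hxβ
  simp [incidence, degreeMap_eq_zero γ β hd]

variable (C)

/-- The cellular `k`-chains `⨁_{k-cells} ℤ/2`. -/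
abbrev Chains (k : ℕ) : Type u := RelCWComplex.cell C k →₀ ZMod 2

/-- The cellular boundary map from `m`-chains to `n`-chains, which sends an `m`-cell `γ` to the sum
of the `n`-cells `β` weighted by the incidence numbers. It vanishes unless `m = n + 1`. -/
def boundary (m n : ℕ) : Chains C m →ₗ[ZMod 2] Chains C n :=
  Finsupp.linearCombination (ZMod 2) fun γ : RelCWComplex.cell C m =>
    Finsupp.ofSupportFinite (fun β : RelCWComplex.cell C n => incidence γ β)
      (finite_support_incidence n γ)

/-- The cellular `k`-cycles. For `k = 0` every chain is a cycle. -/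
def cycles (k : ℕ) : Submodule (ZMod 2) (Chains C k) :=
  ⨅ n : ℕ, LinearMap.ker (boundary C k n)

/-- The cellular `k`-boundaries. -/
def boundaries (k : ℕ) : Submodule (ZMod 2) (Chains C k) :=
  LinearMap.range (boundary C (k + 1) k)

/-- The cellular homology group `H_k(T; ℤ/2)`: cycles modulo boundaries. -/
abbrev Homology (k : ℕ) : Type u :=
  (cycles C k).toAddSubgroup ⧸
    (boundaries C k).toAddSubgroup.addSubgroupOf (cycles C k).toAddSubgroup

/-! ### The stabilizer code -/

/-- The state space with one qubit `ℂ²` for each `k`-cell. -/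
abbrev Qubits (k : ℕ) : Type u := ⨂[ℂ] _ : RelCWComplex.cell C k, (Fin 2 → ℂ)

/-- The Pauli matrix `σ_x`, acting on one qubit. -/
def sigmaX : (Fin 2 → ℂ) →ₗ[ℂ] (Fin 2 → ℂ) := Matrix.toLin' !![0, 1; 1, 0]

/-- The Pauli matrix `σ_z`, acting on one qubit. -/
def sigmaZ : (Fin 2 → ℂ) →ₗ[ℂ] (Fin 2 → ℂ) := Matrix.toLin' !![1, 0; 0, -1]

open Classical in
/-- The operator which acts as `A` on the qubits of the `k`-cells in `S`, and as the identity on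
all other qubits. -/
def actOn (k : ℕ) (A : (Fin 2 → ℂ) →ₗ[ℂ] (Fin 2 → ℂ)) (S : Set (RelCWComplex.cell C k)) :
    Module.End ℂ (Qubits C k) :=
  PiTensorProduct.map fun i => if i ∈ S then A else LinearMap.id

variable {C}

/-- The `k`-cells on the coboundary of a cell `α` of dimension `k - 1`. -/
def coboundaryCells (k : ℕ) {m : ℕ} (α : RelCWComplex.cell C m) : Set (RelCWComplex.cell C k) :=
  {β | incidence β α ≠ 0}

/-- The `k`-cells on the boundary of a cell `γ` of dimension `k + 1`. -/
def boundaryCells (k : ℕ) {m : ℕ} (γ : RelCWComplex.cell C m) : Set (RelCWComplex.cell C k) :=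
  {β | incidence γ β ≠ 0}

/-- The stabilizer `V_α`, for a cell `α` of dimension `k - 1`. -/
def opV (k : ℕ) {m : ℕ} (α : RelCWComplex.cell C m) : Module.End ℂ (Qubits C k) :=
  actOn C k sigmaZ (coboundaryCells k α)

/-- The stabilizer `P_γ`, for a `(k + 1)`-cell `γ`. -/
def opP (k : ℕ) (γ : RelCWComplex.cell C (k + 1)) : Module.End ℂ (Qubits C k) :=
  actOn C k sigmaX (boundaryCells k γ)

variable (C)

/-- All stabilizers: `V_α` for every `(k - 1)`-cell `α` (there is none if `k = 0`), and `P_γ` for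
every `(k + 1)`-cell `γ`. -/
def stabilizers (k : ℕ) : Set (Module.End ℂ (Qubits C k)) :=
  {A | (∃ (m : ℕ) (_ : m + 1 = k) (α : RelCWComplex.cell C m), A = opV k α) ∨
    ∃ γ : RelCWComplex.cell C (k + 1), A = opP k γ}

/-- The code space: the common `+1`-eigenspace of all stabilizers. -/
def codeSpace (k : ℕ) : Submodule ℂ (Qubits C k) :=
  ⨅ A ∈ stabilizers C k, Module.End.eigenspace A 1

end HomologyCode

end

/-! In the computational basis a state is a complex function on the chain group `C_k`. There `V_α`
multiplies the value at `c` by the sign of the coefficient of `α` in `∂c`, and `P_γ` translates the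
function by `∂γ`. A state is therefore fixed by all stabilizers exactly when its function is
supported on cycles and invariant under boundaries, that is, when it is a function on homology
(`mem_codeSpace_iff`).

On one qubit `σ_z` and `σ_x` anticommute, so `V_α` and `P_γ` commute once the coboundary of `α` and
the boundary of `γ` share an even number of cells. This, and the fact that boundaries are cycles, is
`∂∂ = 0` for the cellular complex modulo 2 (`even_card_degreeMap_ne_zero`). Most of the work goes
there, since incidence numbers are defined through singular homology.

For `∂∂ = 0`, take a nontrivial reduced cycle on the sphere of the `(l+2)`-cell `γ` and push it into
the `(l+1)`-skeleton. By excision (`CellAttach.exists_sum_push`, `CellAttach.mem_relBoundaries_iff`)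
it is, modulo the `l`-skeleton, homologous to a sum of images of relative cycles `f β` of the balls,
with `f β` nontrivial exactly when `[γ:β] ≠ 0`. Taking boundaries, the images of the `∂(f β)` under
the attaching maps of the `β` add up to a boundary in the `l`-skeleton. The relative homology at `α`
has at most one nonzero class, so the number of `β` with `[γ:β] ≠ 0` and `[β:α] ≠ 0` is even.

Only this bound on the local homology is needed; that it is exactly `ℤ/2` plays no role. The bound
comes from an induction of Mayer–Vietoris type for `ℝ^m` modulo the punctured space
(`atMostOneClass_punctured`) and is transported by excision, which rests on barycentric subdivision
(`exists_small`).

The chains are explicit, modulo 2 and augmented. Their index counts vertices, so it is the dimension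
plus one; accordingly `relCycles n` is paired with `relBoundaries (n + 1)`. -/

noncomputable section

namespace ModTwo

/-! ### Formal affine chains

A formal `n`-tuple in `K` stands for an affine simplex with `n` vertices. The empty tuple is
allowed, so that the complexes are augmented. -/

/-- Formal sums modulo 2 of `n`-tuples of points of `K`. -/
abbrev FormalChain (n : ℕ) (K : Type*) := (Fin n → K) →₀ ZMod 2

namespace FormalChain

variable {K L K' L' : Type*} {n : ℕ}

/-- The boundary of a formal chain: the sum of the tuples in which one entry is omitted. -/
def bd : FormalChain (n + 1) K →ₗ[ZMod 2] FormalChain n K :=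
  ∑ i : Fin (n + 1), Finsupp.lmapDomain (ZMod 2) (ZMod 2) fun v => v ∘ i.succAbove

/-- The cone with a given apex. -/
def cone (b : K) : FormalChain n K →ₗ[ZMod 2] FormalChain (n + 1) K :=
  Finsupp.lmapDomain (ZMod 2) (ZMod 2) fun v => Fin.cons b v

/-- The image of a formal chain under a map of points. -/
def push (f : K → L) : FormalChain n K →ₗ[ZMod 2] FormalChain n L :=
  Finsupp.lmapDomain (ZMod 2) (ZMod 2) fun v => f ∘ v

theorem bd_single (v : Fin (n + 1) → K) (a : ZMod 2) :
    bd (Finsupp.single v a) = ∑ i : Fin (n + 1), Finsupp.single (v ∘ i.succAbove) a := by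
  simp [bd, LinearMap.sum_apply, Finsupp.mapDomain_single]

@[simp]
theorem cone_single (b : K) (v : Fin n → K) (a : ZMod 2) :
    cone b (Finsupp.single v a) = Finsupp.single (Fin.cons b v) a := by
  simp [cone, Finsupp.mapDomain_single]

@[simp]
theorem push_single (f : K → L) (v : Fin n → K) (a : ZMod 2) :
    push f (Finsupp.single v a) = Finsupp.single (f ∘ v) a := by
  simp [push, Finsupp.mapDomain_single]

theorem bd_push (f : K → L) (c : FormalChain (n + 1) K) : bd (push f c) = push f (bd c) := by
  induction c using Finsupp.induction_linear with
  | zero => simp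
  | add c d hc hd => simp only [map_add, hc, hd]
  | single v a => simp only [push_single, bd_single, map_sum]; rfl

theorem push_cone (f : K → L) (b : K) (c : FormalChain n K) :
    push f (cone b c) = cone (f b) (push f c) := by
  induction c using Finsupp.induction_linear with
  | zero => simp
  | add c d hc hd => simp only [map_add, hc, hd]
  | single v a => simp only [push_single, cone_single, Fin.comp_cons]

/-- The cone over the empty tuple is the apex alone, so in the lowest degree the cone formula loses
its second term. -/
theorem bd_cone_zero (b : K) (c : FormalChain 0 K) : bd (cone b c) = c := by
  induction c using Finsupp.induction_linear with
  | zero => simp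
  | add c d hc hd => simp only [map_add, hc, hd]
  | single v a =>
    simp only [cone_single, bd_single, Fin.sum_univ_succ, Finset.univ_eq_empty, Finset.sum_empty,
      add_zero]
    congr 1

/-- Omitting the apex returns `c`, and omitting any other entry commutes with coning. The prism and
the subdivision homotopy both come from this formula. -/
theorem bd_cone (b : K) (c : FormalChain (n + 1) K) : bd (cone b c) = c + cone b (bd c) := by
  induction c using Finsupp.induction_linear with
  | zero => simp
  | add c d hc hd => simp only [map_add, hc, hd]; abel
  | single v a =>
    simp only [cone_single, bd_single, Fin.sum_univ_succ (n := n + 1), map_sum]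
    congr 1
    refine Finset.sum_congr rfl fun i _ => ?_
    congr 1
    ext j
    refine Fin.cases ?_ (fun j => ?_) j <;> simp

/-- Every nonempty tuple is the cone over its tail, so the cone formula gives an induction on the
length. -/
theorem bd_bd : ∀ {n : ℕ} (c : FormalChain (n + 2) K), bd (bd c) = 0 := by
  intro n
  induction n with
  | zero =>
    intro c
    induction c using Finsupp.induction_linear with
    | zero => simp
    | add c d hc hd => simp only [map_add, hc, hd, add_zero]
    | single v a =>
      rw [← Fin.cons_self_tail v, ← cone_single, bd_cone, map_add, bd_cone_zero,
        ZModModule.add_self]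
  | succ n ih =>
    intro c
    induction c using Finsupp.induction_linear with
    | zero => simp
    | add c d hc hd => simp only [map_add, hc, hd, add_zero]
    | single v a =>
      rw [← Fin.cons_self_tail v, ← cone_single, bd_cone, map_add, bd_cone, ih, map_zero, add_zero,
        ZModModule.add_self]

/-- The operator `v ↦ cone (apex v) (D v + h (∂ v))`, which is a chain homotopy from `D` to `0` when
`D` is a chain map. -/
def coneHomotopy (apex : ∀ n, (Fin (n + 1) → K) → L)
    (D : ∀ n, FormalChain n K →ₗ[ZMod 2] FormalChain n L) :
    ∀ n, FormalChain n K →ₗ[ZMod 2] FormalChain (n + 1) L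
  | 0 => 0
  | n + 1 => Finsupp.lsum (ZMod 2) fun v => LinearMap.toSpanSingleton (ZMod 2) _
      (cone (apex n v) (D (n + 1) (Finsupp.single v 1) +
        coneHomotopy apex D n (bd (Finsupp.single v 1))))

theorem coneHomotopy_single (apex : ∀ n, (Fin (n + 1) → K) → L)
    (D : ∀ n, FormalChain n K →ₗ[ZMod 2] FormalChain n L) (n : ℕ) (v : Fin (n + 1) → K) :
    coneHomotopy apex D (n + 1) (Finsupp.single v 1) =
      cone (apex n v) (D (n + 1) (Finsupp.single v 1) +
        coneHomotopy apex D n (bd (Finsupp.single v 1))) := by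
  simp [coneHomotopy]

/-- Linear maps of chains modulo 2 agree if they agree on the basis. -/
theorem _root_.ModTwo.linearMap_ext {α M : Type*} [AddCommGroup M] [Module (ZMod 2) M]
    {f g : (α →₀ ZMod 2) →ₗ[ZMod 2] M}
    (h : ∀ a, f (Finsupp.single a 1) = g (Finsupp.single a 1)) (c : α →₀ ZMod 2) : f c = g c := by
  have : f = g := Finsupp.lhom_ext' fun a => LinearMap.ext_ring (h a)
  rw [this]

/-- Write `h` for the operator. The cone formula gives `∂hv = Dv + h∂v + cone (∂(Dv + h∂v))`, and
the last term vanishes by the induction hypothesis and `∂∂ = 0`. The hypothesis `hD0` starts the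
induction. -/
theorem bd_coneHomotopy (apex : ∀ n, (Fin (n + 1) → K) → L)
    (D : ∀ n, FormalChain n K →ₗ[ZMod 2] FormalChain n L)
    (hD : ∀ n c, bd (D (n + 1) c) = D n (bd c)) (hD0 : D 0 = 0) (n : ℕ)
    (c : FormalChain (n + 1) K) :
    bd (coneHomotopy apex D (n + 1) c) + coneHomotopy apex D n (bd c) = D (n + 1) c := by
  suffices h : bd (coneHomotopy apex D (n + 1) c) =
      D (n + 1) c + coneHomotopy apex D n (bd c) by
    rw [h, add_assoc, ZModModule.add_self, add_zero]
  induction n with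
  | zero =>
    refine linearMap_ext (f := bd ∘ₗ coneHomotopy apex D 1)
      (g := D 1 + coneHomotopy apex D 0 ∘ₗ bd) (fun v => ?_) c
    simp only [LinearMap.comp_apply, LinearMap.add_apply]
    rw [coneHomotopy_single, bd_cone, map_add, hD, hD0]
    simp [coneHomotopy]
  | succ n ih =>
    refine linearMap_ext (f := bd ∘ₗ coneHomotopy apex D (n + 2))
      (g := D (n + 2) + coneHomotopy apex D (n + 1) ∘ₗ bd) (fun v => ?_) c
    simp only [LinearMap.comp_apply, LinearMap.add_apply]
    rw [coneHomotopy_single, bd_cone, map_add, hD, ih, bd_bd, map_zero, add_zero,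
      ZModModule.add_self, map_zero, add_zero]

/-- The recursion uses only the apices and `D`, so it is natural whenever these are. Naturality is
what lets formal operators extend to singular chains. -/
theorem push_coneHomotopy {apex : ∀ n, (Fin (n + 1) → K) → L}
    {D : ∀ n, FormalChain n K →ₗ[ZMod 2] FormalChain n L}
    {apex' : ∀ n, (Fin (n + 1) → K') → L'}
    {D' : ∀ n, FormalChain n K' →ₗ[ZMod 2] FormalChain n L'} (f : K → K') (g : L → L')
    (ha : ∀ n v, g (apex n v) = apex' n (f ∘ v)) (hD : ∀ n c, push g (D n c) = D' n (push f c))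
    (n : ℕ) (c : FormalChain n K) :
    push g (coneHomotopy apex D n c) = coneHomotopy apex' D' n (push f c) := by
  induction n with
  | zero => simp [coneHomotopy]
  | succ n ih =>
    refine linearMap_ext (f := push g ∘ₗ coneHomotopy apex D (n + 1))
      (g := coneHomotopy apex' D' (n + 1) ∘ₗ push f) (fun v => ?_) c
    simp only [LinearMap.comp_apply, push_single]
    rw [coneHomotopy_single, coneHomotopy_single, push_cone, ha, map_add, hD, ih, push_single,
      ← bd_push, push_single]

end FormalChain

/-! ### Convex combinations -/

/-- Topological spaces with continuous convex combinations of finitely many points. -/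
class HasCombo (K : Type*) [TopologicalSpace K] where
  /-- The convex combination of the points `v` with given weights. -/
  combo {n : ℕ} (v : Fin n → K) : C(stdSimplex ℝ (Fin n), K)
  combo_map {m n : ℕ} (f : Fin m → Fin n) (v : Fin n → K) (t : stdSimplex ℝ (Fin m)) :
    combo v (stdSimplex.map f t) = combo (v ∘ f) t

export HasCombo (combo combo_map)

instance (N : ℕ) : HasCombo (stdSimplex ℝ (Fin N)) where
  combo v :=
    { toFun := fun t => ⟨∑ i, t i • (v i).1, (convex_stdSimplex ℝ (Fin N)).sum_mem
        (fun i _ => t.2.1 i) t.2.2 (fun i _ => (v i).2)⟩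
      continuous_toFun := by
        refine Continuous.subtype_mk (continuous_finsetSum _ fun i _ => ?_) _
        exact ((continuous_apply i).comp continuous_subtype_val).smul continuous_const }
  combo_map f v t := by
    refine Subtype.ext ?_
    simp only [ContinuousMap.coe_mk, Function.comp_apply]
    have h : ∀ i, stdSimplex.map f t i = ∑ j with f j = i, t j := fun i => by
      rw [stdSimplex.map_coe, FunOnFinite.linearMap_apply_apply]
    simp only [h, Finset.sum_smul]
    rw [← Finset.sum_fiberwise_of_maps_to (g := f) (fun _ _ => Finset.mem_univ _)]
    refine Finset.sum_congr rfl fun i _ => Finset.sum_congr rfl fun j hj => ?_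
    rw [(Finset.mem_filter.1 hj).2]

theorem combo_coe {n N : ℕ} (v : Fin n → stdSimplex ℝ (Fin N)) (t : stdSimplex ℝ (Fin n)) :
    (combo v t).1 = ∑ i, t i • (v i).1 := rfl

instance : HasCombo unitInterval where
  combo v :=
    { toFun := fun t => ⟨∑ i, t i • (v i : ℝ), (convex_Icc (0 : ℝ) 1).sum_mem
        (fun i _ => t.2.1 i) t.2.2 (fun i _ => (v i).2)⟩
      continuous_toFun := by
        refine Continuous.subtype_mk (continuous_finsetSum _ fun i _ => ?_) _
        exact ((continuous_apply i).comp continuous_subtype_val).smul continuous_const }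
  combo_map f v t := by
    refine Subtype.ext ?_
    simp only [ContinuousMap.coe_mk, Function.comp_apply]
    have h : ∀ i, stdSimplex.map f t i = ∑ j with f j = i, t j := fun i => by
      rw [stdSimplex.map_coe, FunOnFinite.linearMap_apply_apply]
    simp only [h, Finset.sum_smul]
    rw [← Finset.sum_fiberwise_of_maps_to (g := f) (fun _ _ => Finset.mem_univ _)]
    refine Finset.sum_congr rfl fun i _ => Finset.sum_congr rfl fun j hj => ?_
    rw [(Finset.mem_filter.1 hj).2]

instance {K L : Type*} [TopologicalSpace K] [TopologicalSpace L] [HasCombo K] [HasCombo L] :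
    HasCombo (K × L) where
  combo v := (combo (Prod.fst ∘ v)).prodMk (combo (Prod.snd ∘ v))
  combo_map f v t := by simp [combo_map, Function.comp_assoc]

theorem combo_const_unitInterval {n : ℕ} (s : unitInterval) (t : stdSimplex ℝ (Fin n)) :
    combo (fun _ : Fin n => s) t = s := by
  refine Subtype.ext ?_
  change ∑ i, t i • (s : ℝ) = s
  rw [← Finset.sum_smul, stdSimplex.sum_eq_one, one_smul]

theorem combo_vertex {n : ℕ} (t : stdSimplex ℝ (Fin n)) :
    combo (stdSimplex.vertex (S := ℝ) (X := Fin n)) t = t := by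
  refine Subtype.ext ?_
  rw [combo_coe]
  ext j
  simp [Finset.sum_apply, Pi.single_apply]
  rfl

theorem combo_apply_vertex {n N : ℕ} (v : Fin n → stdSimplex ℝ (Fin N)) (i : Fin n) :
    combo v (stdSimplex.vertex i) = v i := by
  refine Subtype.ext ?_
  rw [combo_coe]
  simp [Pi.single_apply]

theorem combo_assoc {m n N : ℕ} (v : Fin n → stdSimplex ℝ (Fin N))
    (w : Fin m → stdSimplex ℝ (Fin n)) (t : stdSimplex ℝ (Fin m)) :
    combo v (combo w t) = combo (combo v ∘ w) t := by
  refine Subtype.ext ?_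
  have h : ∀ i, combo w t i = ∑ j, t j * w j i := fun i => by
    change (combo w t).1 i = _
    rw [combo_coe, Finset.sum_apply]
    rfl
  simp only [combo_coe, h, Function.comp_apply, Finset.smul_sum, Finset.sum_smul, smul_smul]
  exact Finset.sum_comm

end ModTwo
end

noncomputable section

namespace ModTwo

/-! ### Singular chains modulo 2 -/

/-- Singular chains modulo 2 on simplices with `n` vertices. For `n = 0` there is exactly one
simplex, so that these groups form the augmented singular chain complex. -/
abbrev Chain (n : ℕ) (X : Type*) [TopologicalSpace X] := C(stdSimplex ℝ (Fin n), X) →₀ ZMod 2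

/-- The inclusion of a face of the standard simplex. -/
def face {n : ℕ} (i : Fin (n + 1)) : C(stdSimplex ℝ (Fin n), stdSimplex ℝ (Fin (n + 1))) :=
  ⟨stdSimplex.map i.succAbove, stdSimplex.continuous_map _⟩

variable {X Y Z K L : Type*} [TopologicalSpace X] [TopologicalSpace Y] [TopologicalSpace Z]
  [TopologicalSpace K] [TopologicalSpace L] [HasCombo K] [HasCombo L] {m n : ℕ}

/-- The boundary map. -/
def bd : Chain (n + 1) X →ₗ[ZMod 2] Chain n X :=
  ∑ i : Fin (n + 1), Finsupp.lmapDomain (ZMod 2) (ZMod 2) fun σ => σ.comp (face i)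

/-- The map of chains induced by a continuous map. -/
def push (f : C(X, Y)) : Chain n X →ₗ[ZMod 2] Chain n Y :=
  Finsupp.lmapDomain (ZMod 2) (ZMod 2) fun σ => f.comp σ

theorem bd_single (σ : C(stdSimplex ℝ (Fin (n + 1)), X)) (a : ZMod 2) :
    bd (Finsupp.single σ a) = ∑ i : Fin (n + 1), Finsupp.single (σ.comp (face i)) a := by
  simp [bd, LinearMap.sum_apply, Finsupp.mapDomain_single]

@[simp]
theorem push_single (f : C(X, Y)) (σ : C(stdSimplex ℝ (Fin n), X)) (a : ZMod 2) :
    push f (Finsupp.single σ a) = Finsupp.single (f.comp σ) a := by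
  simp [push, Finsupp.mapDomain_single]

theorem bd_push (f : C(X, Y)) (c : Chain (n + 1) X) : bd (push f c) = push f (bd c) := by
  refine linearMap_ext (f := bd ∘ₗ push f) (g := push f ∘ₗ bd) (fun σ => ?_) c
  simp only [LinearMap.comp_apply, push_single, bd_single, map_sum]
  rfl

theorem push_push (g : C(Y, Z)) (f : C(X, Y)) (c : Chain n X) :
    push g (push f c) = push (g.comp f) c := by
  refine linearMap_ext (f := push g ∘ₗ push f) (g := push (g.comp f)) (fun σ => ?_) c
  simp only [LinearMap.comp_apply, push_single]
  rfl

@[simp]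
theorem push_id (c : Chain n X) : push (ContinuousMap.id X) c = c := by
  refine linearMap_ext (f := push (ContinuousMap.id X)) (g := LinearMap.id) (fun σ => ?_) c
  simp only [push_single]
  rfl

/-- The chains on the simplices which are contained in `A`. -/
abbrev sub (n : ℕ) (A : Set X) : Submodule (ZMod 2) (Chain n X) :=
  Finsupp.supported (ZMod 2) (ZMod 2) {σ | ∀ t, σ t ∈ A}

theorem map_mem_supported {α M : Type*} [AddCommGroup M] [Module (ZMod 2) M] {s : Set α}
    {N : Submodule (ZMod 2) M} (f : (α →₀ ZMod 2) →ₗ[ZMod 2] M)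
    (h : ∀ a ∈ s, f (Finsupp.single a 1) ∈ N) {c : α →₀ ZMod 2}
    (hc : c ∈ Finsupp.supported (ZMod 2) (ZMod 2) s) : f c ∈ N := by
  have : Finsupp.supported (ZMod 2) (ZMod 2) s ≤ N.comap f := by
    rw [Finsupp.supported_eq_span_single, Submodule.span_le]
    rintro _ ⟨a, ha, rfl⟩
    exact h a ha
  exact this hc

theorem linearMap_ext_on {α M : Type*} [AddCommGroup M] [Module (ZMod 2) M] {s : Set α}
    {f g : (α →₀ ZMod 2) →ₗ[ZMod 2] M}
    (h : ∀ a ∈ s, f (Finsupp.single a 1) = g (Finsupp.single a 1)) {c : α →₀ ZMod 2}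
    (hc : c ∈ Finsupp.supported (ZMod 2) (ZMod 2) s) : f c = g c := by
  have := map_mem_supported (N := ⊥) (f - g) (fun a ha => by simp [h a ha]) hc
  simpa [sub_eq_zero] using this

theorem single_mem_supported {α : Type*} {s : Set α} {a : α} (h : a ∈ s) :
    Finsupp.single a (1 : ZMod 2) ∈ Finsupp.supported (ZMod 2) (ZMod 2) s :=
  Finsupp.single_mem_supported _ _ h

theorem bd_mem_sub {A : Set X} {c : Chain (n + 1) X} (hc : c ∈ sub (n + 1) A) :
    bd c ∈ sub n A := by
  refine map_mem_supported bd (fun σ hσ => ?_) hc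
  rw [bd_single]
  exact Submodule.sum_mem _ fun i _ => single_mem_supported fun t => hσ _

theorem push_mem_sub {A : Set X} {B : Set Y} (f : C(X, Y)) (h : ∀ x ∈ A, f x ∈ B) {c : Chain n X}
    (hc : c ∈ sub n A) : push f c ∈ sub n B := by
  refine map_mem_supported (push f) (fun σ hσ => ?_) hc
  rw [push_single]
  exact single_mem_supported fun t => h _ (hσ t)

theorem sub_mono {A B : Set X} (h : A ⊆ B) : sub n A ≤ sub n B :=
  Finsupp.supported_mono fun _ hσ t => h (hσ t)

theorem mem_sub_inter {A B : Set X} {c : Chain n X} (hA : c ∈ sub n A) (hB : c ∈ sub n B) :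
    c ∈ sub n (A ∩ B) := by
  rw [Finsupp.mem_supported] at *
  exact fun σ hσ t => ⟨hA hσ t, hB hσ t⟩

theorem mem_sub_univ (c : Chain n X) : c ∈ sub n (Set.univ : Set X) := by
  rw [Finsupp.mem_supported]
  exact fun σ _ t => trivial

theorem push_congr {A : Set X} (f g : C(X, Y)) (h : ∀ x ∈ A, f x = g x) {c : Chain n X}
    (hc : c ∈ sub n A) : push f c = push g c := by
  refine linearMap_ext_on (fun σ hσ => ?_) hc
  rw [push_single, push_single]
  congr 1
  ext t
  exact h _ (hσ t)

/-- The realization of formal affine chains. -/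
def realize : FormalChain n K →ₗ[ZMod 2] Chain n K :=
  Finsupp.lmapDomain (ZMod 2) (ZMod 2) fun v => combo v

@[simp]
theorem realize_single (v : Fin n → K) (a : ZMod 2) :
    realize (Finsupp.single v a) = Finsupp.single (combo v) a := by
  simp [realize, Finsupp.mapDomain_single]

theorem bd_realize (c : FormalChain (n + 1) K) : bd (realize c) = realize (FormalChain.bd c) := by
  refine linearMap_ext (f := bd ∘ₗ realize) (g := realize ∘ₗ FormalChain.bd) (fun v => ?_) c
  simp only [LinearMap.comp_apply, realize_single, bd_single, FormalChain.bd_single, map_sum]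
  refine Finset.sum_congr rfl fun i _ => ?_
  congr 1
  ext t
  exact combo_map _ _ _

/-- A continuous map is affine if it preserves convex combinations. -/
def IsAffine (f : C(K, L)) : Prop :=
  ∀ (n : ℕ) (v : Fin n → K) (t : stdSimplex ℝ (Fin n)), f (combo v t) = combo (f ∘ v) t

theorem push_realize {f : C(K, L)} (hf : IsAffine f) (c : FormalChain n K) :
    push f (realize c) = realize (FormalChain.push f c) := by
  refine linearMap_ext (f := push f ∘ₗ realize) (g := realize ∘ₗ FormalChain.push f)
    (fun v => ?_) c
  simp only [LinearMap.comp_apply, realize_single, push_single, FormalChain.push_single]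
  congr 1
  ext t
  exact hf _ _ _

theorem isAffine_combo {N : ℕ} (v : Fin n → stdSimplex ℝ (Fin N)) : IsAffine (combo v) :=
  fun _ w t => combo_assoc v w t

theorem face_eq_combo (i : Fin (n + 1)) :
    face i = combo ((stdSimplex.vertex (S := ℝ)) ∘ i.succAbove) := by
  ext1 t
  rw [← combo_map, combo_vertex]
  rfl

theorem isAffine_face (i : Fin (n + 1)) : IsAffine (face i) := by
  rw [face_eq_combo]
  exact isAffine_combo _

theorem face_vertex (i : Fin (n + 1)) (j : Fin n) :
    face i (stdSimplex.vertex j) = stdSimplex.vertex (S := ℝ) (i.succAbove j) :=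
  stdSimplex.map_vertex _ _

/-- The formal chain of the vertices of the standard simplex. -/
def vertices (n : ℕ) : FormalChain n (stdSimplex ℝ (Fin n)) :=
  Finsupp.single (fun i => stdSimplex.vertex i) 1

theorem realize_vertices : realize (vertices n) = Finsupp.single (ContinuousMap.id _) 1 := by
  rw [vertices, realize_single]
  congr 1
  ext1 t
  exact combo_vertex t

theorem bd_vertices : FormalChain.bd (vertices (n + 1)) =
    ∑ i : Fin (n + 1), FormalChain.push (face i) (vertices n) := by
  rw [vertices, FormalChain.bd_single]
  refine Finset.sum_congr rfl fun i _ => ?_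
  rw [vertices, FormalChain.push_single]
  congr 1
  ext1 j
  exact (face_vertex i j).symm

/-- The operator on chains which replaces each simplex `σ` by the image of `c` under `F σ`. -/
def extend {D : Type*} [TopologicalSpace D] (F : C(stdSimplex ℝ (Fin n), X) → C(D, Y))
    (c : Chain m D) : Chain n X →ₗ[ZMod 2] Chain m Y :=
  Finsupp.lsum (ZMod 2) fun σ => LinearMap.toSpanSingleton (ZMod 2) _ (push (F σ) c)

section extend

variable {D D' : Type*} [TopologicalSpace D] [TopologicalSpace D']

theorem extend_single (F : C(stdSimplex ℝ (Fin n), X) → C(D, Y)) (c : Chain m D)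
    (σ : C(stdSimplex ℝ (Fin n), X)) : extend F c (Finsupp.single σ 1) = push (F σ) c := by
  simp [extend]

theorem bd_extend (F : C(stdSimplex ℝ (Fin n), X) → C(D, Y)) (c : Chain (m + 1) D)
    (z : Chain n X) : bd (extend F c z) = extend F (bd c) z := by
  refine linearMap_ext (f := bd ∘ₗ extend F c) (g := extend F (bd c)) (fun σ => ?_) z
  simp only [LinearMap.comp_apply, extend_single, bd_push]

/-- When `F` is compatible with faces, the boundary can be taken in the model space. Identities
between natural operators then need to be checked on one universal chain only. -/
theorem extend_bd (F : C(stdSimplex ℝ (Fin n), X) → C(D, Y))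
    (F' : C(stdSimplex ℝ (Fin (n + 1)), X) → C(D', Y)) (G : Fin (n + 1) → C(D, D'))
    (hG : ∀ σ i, F (σ.comp (face i)) = (F' σ).comp (G i)) (c : Chain m D) (z : Chain (n + 1) X) :
    extend F c (bd z) = extend F' (∑ i, push (G i) c) z := by
  refine linearMap_ext (f := extend F c ∘ₗ bd) (g := extend F' (∑ i, push (G i) c))
    (fun σ => ?_) z
  simp only [LinearMap.comp_apply, extend_single, bd_single, map_sum]
  exact Finset.sum_congr rfl fun i _ => by rw [hG, push_push]

theorem extend_add (F : C(stdSimplex ℝ (Fin n), X) → C(D, Y)) (c d : Chain m D) (z : Chain n X) :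
    extend F (c + d) z = extend F c z + extend F d z := by
  refine linearMap_ext (f := extend F (c + d)) (g := extend F c + extend F d) (fun σ => ?_) z
  simp only [LinearMap.add_apply, extend_single, map_add]

theorem extend_mem_supported (F : C(stdSimplex ℝ (Fin n), X) → C(D, Y)) (c : Chain m D)
    {P : Set C(stdSimplex ℝ (Fin n), X)} {Q : Set C(stdSimplex ℝ (Fin m), Y)}
    (h : ∀ σ ∈ P, ∀ τ, (F σ).comp τ ∈ Q) {z : Chain n X}
    (hz : z ∈ Finsupp.supported (ZMod 2) (ZMod 2) P) :
    extend F c z ∈ Finsupp.supported (ZMod 2) (ZMod 2) Q := by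
  refine map_mem_supported _ (fun σ hσ => ?_) hz
  rw [extend_single]
  refine map_mem_supported (s := Set.univ) _ (fun τ _ => ?_) (by simp)
  rw [push_single]
  exact single_mem_supported (h σ hσ τ)

end extend

theorem extend_id (z : Chain n X) :
    extend (fun σ => σ) (Finsupp.single (ContinuousMap.id _) 1) z = z := by
  refine linearMap_ext (f := extend _ _) (g := LinearMap.id) (fun σ => ?_) z
  rw [extend_single, push_single]
  rfl

/-- Each singular simplex is the image of the identity simplex, which is realized by the formal
tuple of vertices; the formal identity carries over. -/
theorem bd_bd (z : Chain (n + 2) X) : bd (bd z) = 0 := by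
  conv_lhs => rw [← extend_id z, ← realize_vertices]
  rw [bd_extend, bd_extend, bd_realize, bd_realize, FormalChain.bd_bd, map_zero]
  refine linearMap_ext (f := extend _ _) (g := 0) (fun σ => ?_) z
  simp [extend_single]

/-! ### Homotopy invariance -/

/-- The formal prism operator. -/
def prism (N n : ℕ) : FormalChain n (stdSimplex ℝ (Fin N)) →ₗ[ZMod 2]
    FormalChain (n + 1) (stdSimplex ℝ (Fin N) × unitInterval) :=
  FormalChain.coneHomotopy (fun _ v => (v 0, 0))
    (fun _ => FormalChain.push (fun x => (x, 1)) + FormalChain.push fun x => (x, 0)) n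

theorem push_formal_push {A B C : Type*} (g : B → C) (f : A → B) (c : FormalChain n A) :
    FormalChain.push g (FormalChain.push f c) = FormalChain.push (g ∘ f) c := by
  refine linearMap_ext (f := FormalChain.push g ∘ₗ FormalChain.push f)
    (g := FormalChain.push (g ∘ f)) (fun σ => ?_) c
  simp only [LinearMap.comp_apply, FormalChain.push_single]
  rfl

theorem push_prism {N M : ℕ} (f : C(stdSimplex ℝ (Fin N), stdSimplex ℝ (Fin M)))
    (c : FormalChain n (stdSimplex ℝ (Fin N))) :
    FormalChain.push (Prod.map f id) (prism N n c) = prism M n (FormalChain.push f c) :=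
  FormalChain.push_coneHomotopy f (Prod.map f id) (fun _ _ => rfl)
    (fun _ _ => by simp only [LinearMap.add_apply, map_add, push_formal_push]; rfl) n c

theorem bd_prism {N : ℕ} (c : FormalChain (n + 1) (stdSimplex ℝ (Fin N))) :
    FormalChain.bd (prism N (n + 1) c) + prism N n (FormalChain.bd c) =
      FormalChain.push (fun x => (x, 1)) c + FormalChain.push (fun x => (x, 0)) c := by
  refine FormalChain.bd_coneHomotopy _ _ (fun n c => ?_) ?_ n c
  · simp only [LinearMap.add_apply, map_add, FormalChain.bd_push]
  -- Both ends of the prism agree on the empty tuple, so their sum is zero there.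
  · refine LinearMap.ext fun c => linearMap_ext (fun v => ?_) c
    simp only [LinearMap.add_apply, FormalChain.push_single, LinearMap.zero_apply]
    rw [Subsingleton.elim ((fun x => (x, (1 : unitInterval))) ∘ v) ((fun x => (x, 0)) ∘ v),
      ZModModule.add_self]

theorem isAffine_prodMap_id {N M : ℕ} {f : C(stdSimplex ℝ (Fin N), stdSimplex ℝ (Fin M))}
    (hf : IsAffine f) : IsAffine (f.prodMap (ContinuousMap.id unitInterval)) :=
  fun n v t => Prod.ext (hf n (Prod.fst ∘ v) t) rfl

/-- The chain homotopy induced by a homotopy. -/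
def homotopyOp (H : C(X × unitInterval, Y)) (n : ℕ) : Chain n X →ₗ[ZMod 2] Chain (n + 1) Y :=
  extend (fun σ => H.comp (σ.prodMap (ContinuousMap.id unitInterval)))
    (realize (prism n n (vertices n)))

/-- Everything reduces to the prism over the universal simplex; `bd_vertices` and the naturality of
the prism account for its sides. -/
theorem bd_homotopyOp (H : C(X × unitInterval, Y)) (z : Chain (n + 1) X) :
    bd (homotopyOp H (n + 1) z) + homotopyOp H n (bd z) =
      push (H.comp ((ContinuousMap.id X).prodMk (ContinuousMap.const X 1))) z +
      push (H.comp ((ContinuousMap.id X).prodMk (ContinuousMap.const X 0))) z := by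
  rw [homotopyOp, homotopyOp, bd_extend, extend_bd
    (F' := fun σ => H.comp (σ.prodMap (ContinuousMap.id unitInterval)))
    (G := fun i => (face i).prodMap (ContinuousMap.id unitInterval)) (hG := fun _ _ => rfl),
    ← extend_add, bd_realize]
  simp only [push_realize (isAffine_prodMap_id (isAffine_face _))]
  have h : ∀ i : Fin (n + 1), FormalChain.push ((face i).prodMap (ContinuousMap.id unitInterval))
      (prism n n (vertices n)) = prism _ n (FormalChain.push (face i) (vertices n)) :=
    fun i => push_prism _ _
  simp only [h]
  rw [← map_sum, ← map_sum, ← bd_vertices, ← map_add, bd_prism, vertices, FormalChain.push_single,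
    FormalChain.push_single, map_add, realize_single, realize_single, extend_add]
  have h (s : unitInterval) : (combo (K := stdSimplex ℝ (Fin (n + 1)) × unitInterval) ((fun x => (x, s)) ∘ fun i : Fin (n + 1) =>
      stdSimplex.vertex (S := ℝ) i)) =
      (ContinuousMap.id (stdSimplex ℝ (Fin (n + 1)))).prodMk (ContinuousMap.const _ s) := by
    ext1 t
    exact Prod.ext (combo_vertex t) (combo_const_unitInterval s t)
  rw [h, h]
  have h' (s : unitInterval) : extend (fun σ => H.comp (σ.prodMap (ContinuousMap.id unitInterval)))
      (Finsupp.single ((ContinuousMap.id (stdSimplex ℝ (Fin (n + 1)))).prodMk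
        (ContinuousMap.const _ s)) 1) z =
      push (H.comp ((ContinuousMap.id X).prodMk (ContinuousMap.const X s))) z := by
    refine linearMap_ext (f := extend _ _) (g := push _) (fun σ => ?_) z
    rw [extend_single, push_single, push_single]
    rfl
  rw [h', h']

theorem homotopyOp_mem_sub (H : C(X × unitInterval, Y)) {A : Set X} {B : Set Y}
    (h : ∀ x ∈ A, ∀ s, H (x, s) ∈ B) {z : Chain n X} (hz : z ∈ sub n A) :
    homotopyOp H n z ∈ sub (n + 1) B := by
  refine extend_mem_supported _ _ (fun σ hσ τ => ?_) hz
  exact fun t => h _ (hσ _) _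

/-- Every cycle becomes a boundary under a constant map. -/
theorem exists_bd_eq_push_const (p : Y) (z : Chain (n + 1) X) (hz : bd z = 0) :
    ∃ q ∈ sub (n + 2) {p}, bd q = push (ContinuousMap.const X p) z := by
  set ε : ZMod 2 := z.sum fun _ a => a with hε
  have hbd (k : ℕ) (a : ZMod 2) : bd (Finsupp.single
      (ContinuousMap.const (stdSimplex ℝ (Fin (k + 1))) p) a) =
      ((k + 1 : ℕ) : ZMod 2) • Finsupp.single (ContinuousMap.const (stdSimplex ℝ (Fin k)) p) a := by
    rw [bd_single, Nat.cast_smul_eq_nsmul]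
    simp only [ContinuousMap.const_comp, Finset.sum_const, Finset.card_univ, Fintype.card_fin]
  have hpush : push (ContinuousMap.const X p) z = Finsupp.single (ContinuousMap.const _ p) ε := by
    have : push (ContinuousMap.const X p) z = z.sum fun σ a => Finsupp.single
        ((ContinuousMap.const X p).comp σ) a := rfl
    rw [this, hε, Finsupp.sum, Finsupp.sum, Finsupp.single_finsetSum]
    rfl
  rw [hpush]
  have h0 : ((n + 1 : ℕ) : ZMod 2) * ε = 0 := by
    have := congrArg (push (ContinuousMap.const X p)) hz
    rw [← bd_push, hpush, hbd, map_zero, Finsupp.smul_single, Finsupp.single_eq_zero] at this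
    exact this
  -- The constant simplex with `k + 1` vertices has boundary `k + 1` times a constant simplex. If `n
  -- + 1` is odd, the cycle condition forces `ε = 0`; otherwise `n + 2` is odd and the constant
  -- simplex with one more vertex fills the cycle.
  rcases Nat.even_or_odd n with hn | hn
  · refine ⟨0, Submodule.zero_mem _, ?_⟩
    have : ((n + 1 : ℕ) : ZMod 2) = 1 := ZMod.natCast_eq_one_iff_odd.2 hn.add_one
    rw [this, one_mul] at h0
    simp [h0]
  · refine ⟨Finsupp.single (ContinuousMap.const _ p) ε,
      Finsupp.single_mem_supported _ _ fun _ => rfl, ?_⟩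
    rw [hbd, ZMod.natCast_eq_one_iff_odd.2, one_smul]
    exact (Odd.add_one hn).add_one

/-- A cycle in a contractible subset is a boundary in this subset. -/
theorem exists_bd_eq_of_contraction (H : C(X × unitInterval, X)) {A : Set X} {p : X}
    (h0 : ∀ x, H (x, 0) = x) (h1 : ∀ x, H (x, 1) = p) (hp : p ∈ A)
    (hA : ∀ x ∈ A, ∀ s, H (x, s) ∈ A) {z : Chain (n + 1) X} (hz : z ∈ sub (n + 1) A)
    (hbd : bd z = 0) : ∃ q ∈ sub (n + 2) A, bd q = z := by
  obtain ⟨q, hq, hqz⟩ := exists_bd_eq_push_const p z hbd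
  -- The homotopy joins `z` to its constant image, and `q` fills that image.
  refine ⟨homotopyOp H (n + 1) z + q, Submodule.add_mem _ (homotopyOp_mem_sub H hA hz)
    (sub_mono (by simpa using hp) hq), ?_⟩
  have h := bd_homotopyOp H z
  have e0 : H.comp ((ContinuousMap.id X).prodMk (ContinuousMap.const X 0)) =
      ContinuousMap.id X := by
    ext x; exact h0 x
  have e1 : H.comp ((ContinuousMap.id X).prodMk (ContinuousMap.const X 1)) =
      ContinuousMap.const X p := by
    ext x; exact h1 x
  rw [hbd, map_zero, add_zero, e0, e1, push_id] at h
  rw [map_add, h, hqz, add_right_comm, ZModModule.add_self, zero_add]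

end ModTwo
end

noncomputable section

namespace ModTwo

/-! ### Barycentric subdivision -/

variable {X Y K L : Type*} [TopologicalSpace X] [TopologicalSpace Y]
  [TopologicalSpace K] [TopologicalSpace L] [HasCombo K] [HasCombo L] {m n : ℕ}

/-- The barycenter of a tuple of points. -/
def bary (n : ℕ) (v : Fin (n + 1) → K) : K := combo v stdSimplex.barycenter

/-- The barycentric subdivision of formal chains. -/
def formalSd : ∀ n, FormalChain n K →ₗ[ZMod 2] FormalChain n K
  | 0 => LinearMap.id
  | n + 1 => Finsupp.lsum (ZMod 2) fun v => LinearMap.toSpanSingleton (ZMod 2) _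
      (FormalChain.cone (bary n v) (formalSd n (FormalChain.bd (Finsupp.single v 1))))

theorem formalSd_single (v : Fin (n + 1) → K) :
    formalSd (n + 1) (Finsupp.single v 1) =
      FormalChain.cone (bary n v) (formalSd n (FormalChain.bd (Finsupp.single v 1))) := by
  simp [formalSd]

theorem formalSd_zero (c : FormalChain 0 K) : formalSd 0 c = c := rfl

attribute [irreducible] formalSd

theorem bd_formalSd (c : FormalChain (n + 1) K) :
    FormalChain.bd (formalSd (n + 1) c) = formalSd n (FormalChain.bd c) := by
  induction n with
  | zero =>
    refine linearMap_ext (f := FormalChain.bd (K := K) ∘ₗ formalSd (K := K) (0 + 1))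
      (g := formalSd (K := K) 0 ∘ₗ FormalChain.bd) (fun v => ?_) c
    rw [LinearMap.comp_apply, formalSd_single, FormalChain.bd_cone_zero, LinearMap.comp_apply]
  | succ n ih =>
    refine linearMap_ext (f := FormalChain.bd (K := K) ∘ₗ formalSd (K := K) (n + 2))
      (g := formalSd (K := K) (n + 1) ∘ₗ FormalChain.bd) (fun v => ?_) c
    rw [LinearMap.comp_apply, formalSd_single, FormalChain.bd_cone, ih, FormalChain.bd_bd,
      map_zero, map_zero, add_zero, LinearMap.comp_apply]

theorem map_bary {f : C(K, L)} (hf : IsAffine f) (v : Fin (n + 1) → K) :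
    f (bary n v) = bary n (f ∘ v) := hf _ _ _

theorem push_formalSd {f : C(K, L)} (hf : IsAffine f) (c : FormalChain n K) :
    FormalChain.push f (formalSd n c) = formalSd n (FormalChain.push f c) := by
  induction n with
  | zero => rw [formalSd_zero, formalSd_zero]
  | succ n ih =>
    refine linearMap_ext (f := FormalChain.push f ∘ₗ formalSd (K := K) (n + 1))
      (g := formalSd (K := L) (n + 1) ∘ₗ FormalChain.push f) (fun v => ?_) c
    simp only [LinearMap.comp_apply, formalSd_single, FormalChain.push_cone, ih,
      FormalChain.push_single, map_bary hf, ← FormalChain.bd_push]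

/-- The formal chain homotopy from the subdivision to the identity. -/
def formalSdHomotopy (n : ℕ) : FormalChain n K →ₗ[ZMod 2] FormalChain (n + 1) K :=
  FormalChain.coneHomotopy bary (fun n => LinearMap.id + formalSd n) n

theorem bd_formalSdHomotopy (c : FormalChain (n + 1) K) :
    FormalChain.bd (formalSdHomotopy (n + 1) c) + formalSdHomotopy n (FormalChain.bd c) =
      c + formalSd (n + 1) c := by
  refine FormalChain.bd_coneHomotopy _ _ (fun n c => ?_) ?_ n c
  · simp only [LinearMap.add_apply, map_add, LinearMap.id_apply, bd_formalSd]
  · refine LinearMap.ext fun c => ?_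
    rw [LinearMap.add_apply, formalSd_zero]
    exact ZModModule.add_self _

theorem push_formalSdHomotopy {f : C(K, L)} (hf : IsAffine f) (c : FormalChain n K) :
    FormalChain.push f (formalSdHomotopy n c) = formalSdHomotopy n (FormalChain.push f c) := by
  refine FormalChain.push_coneHomotopy f f (fun n v => map_bary hf v) (fun n c => ?_) n c
  simp only [LinearMap.add_apply, map_add, LinearMap.id_apply, push_formalSd hf]

/-- The barycentric subdivision of singular chains. -/
def sd (n : ℕ) : Chain n X →ₗ[ZMod 2] Chain n X :=
  extend (fun σ => σ) (realize (formalSd n (vertices n)))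

/-- The chain homotopy from the subdivision of singular chains to the identity. -/
def sdHomotopy (n : ℕ) : Chain n X →ₗ[ZMod 2] Chain (n + 1) X :=
  extend (fun σ => σ) (realize (formalSdHomotopy n (vertices n)))

theorem bd_sd (z : Chain (n + 1) X) : bd (sd (n + 1) z) = sd n (bd z) := by
  rw [sd, sd, bd_extend, extend_bd (F' := fun σ => σ) (G := face) (hG := fun _ _ => rfl),
    bd_realize, bd_formalSd, bd_vertices]
  simp only [push_realize (isAffine_face _), push_formalSd (isAffine_face _), map_sum]

theorem bd_sdHomotopy (z : Chain (n + 1) X) :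
    bd (sdHomotopy (n + 1) z) + sdHomotopy n (bd z) = z + sd (n + 1) z := by
  rw [sdHomotopy, sdHomotopy, bd_extend,
    extend_bd (F' := fun σ => σ) (G := face) (hG := fun _ _ => rfl), ← extend_add, bd_realize]
  simp only [push_realize (isAffine_face _), push_formalSdHomotopy (isAffine_face _)]
  rw [← map_sum, ← map_sum, ← bd_vertices, ← map_add, bd_formalSdHomotopy, map_add, extend_add,
    realize_vertices, extend_id, sd]

/-- The chains on the simplices which are contained in some member of a family of sets. -/
abbrev small {ι : Type*} (n : ℕ) (U : ι → Set X) : Submodule (ZMod 2) (Chain n X) :=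
  Finsupp.supported (ZMod 2) (ZMod 2) {σ | ∃ i, ∀ t, σ t ∈ U i}

theorem sd_mem_sub {A : Set X} {z : Chain n X} (hz : z ∈ sub n A) : sd n z ∈ sub n A := by
  refine extend_mem_supported _ _ (fun σ hσ τ => ?_) hz
  exact fun t => hσ _

theorem sdHomotopy_mem_sub {A : Set X} {z : Chain n X} (hz : z ∈ sub n A) :
    sdHomotopy n z ∈ sub (n + 1) A := by
  refine extend_mem_supported _ _ (fun σ hσ τ => ?_) hz
  exact fun t => hσ _

theorem sdHomotopy_mem_small {ι : Type*} {U : ι → Set X} {z : Chain n X} (hz : z ∈ small n U) :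
    sdHomotopy n z ∈ small (n + 1) U := by
  refine extend_mem_supported _ _ (fun σ hσ τ => ?_) hz
  obtain ⟨i, hi⟩ := hσ
  exact ⟨i, fun t => hi _⟩

theorem sd_mem_small {ι : Type*} {U : ι → Set X} {z : Chain n X} (hz : z ∈ small n U) :
    sd n z ∈ small n U := by
  refine extend_mem_supported _ _ (fun σ hσ τ => ?_) hz
  obtain ⟨i, hi⟩ := hσ
  exact ⟨i, fun t => hi _⟩

/-! ### Mesh estimates -/

theorem dist_combo_le {N : ℕ} {v : Fin n → stdSimplex ℝ (Fin N)} {x : stdSimplex ℝ (Fin N)}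
    {d : ℝ} (h : ∀ i, dist (v i) x ≤ d) (t : stdSimplex ℝ (Fin n)) : dist (combo v t) x ≤ d := by
  have := (convex_closedBall (x : Fin N → ℝ) d).sum_mem (t := Finset.univ) (w := t)
    (z := fun i => (v i).1) (fun i _ => t.2.1 i) t.2.2 (fun i _ => h i)
  exact this

/-- The difference is the mean of the `n + 1` differences `v j - v i`, one of which vanishes. -/
theorem dist_bary_le {N : ℕ} {v : Fin (n + 1) → stdSimplex ℝ (Fin N)} {d : ℝ}
    (h : ∀ i j, dist (v i) (v j) ≤ d) (i : Fin (n + 1)) :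
    dist (bary n v) (v i) ≤ n / (n + 1) * d := by
  have hn : (0 : ℝ) < n + 1 := by positivity
  have e : (bary n v).1 - (v i).1 = ∑ j, ((n + 1 : ℝ))⁻¹ • ((v j).1 - (v i).1) := by
    rw [bary, combo_coe]
    simp only [smul_sub, Finset.sum_sub_distrib,
      Finset.sum_const, Finset.card_univ, Fintype.card_fin]
    congr 1
    · refine Finset.sum_congr rfl fun j _ => ?_
      have : (stdSimplex.barycenter : stdSimplex ℝ (Fin (n + 1))) j = ((n + 1 : ℕ) : ℝ)⁻¹ := by
        refine (stdSimplex.barycenter_apply (𝕜 := ℝ) j).trans ?_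
        rw [Fintype.card_fin]
      rw [this]
      push_cast
      rfl
    · rw [← Nat.cast_smul_eq_nsmul ℝ, smul_smul]
      push_cast
      rw [mul_inv_cancel₀ hn.ne', one_smul]
  have : dist (bary n v) (v i) = ‖(bary n v).1 - (v i).1‖ := by
    rw [← dist_eq_norm]; rfl
  rw [this, e]
  refine (norm_sum_le _ _).trans ?_
  rw [← Finset.add_sum_erase _ _ (Finset.mem_univ i), sub_self, smul_zero, norm_zero, zero_add]
  refine (Finset.sum_le_card_nsmul _ _ ((n + 1 : ℝ)⁻¹ * d) fun j _ => ?_).trans ?_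
  · rw [norm_smul, Real.norm_of_nonneg (by positivity)]
    refine mul_le_mul_of_nonneg_left ?_ (by positivity)
    rw [← dist_eq_norm]
    exact h j i
  · rw [Finset.card_erase_of_mem (Finset.mem_univ i), Finset.card_univ, Fintype.card_fin,
      nsmul_eq_mul]
    apply le_of_eq
    simp
    ring

/-- The tuples with entries in the convex hull of `v` and with mesh at most `d`. -/
def fineTuples {N k : ℕ} (m : ℕ) (v : Fin k → stdSimplex ℝ (Fin N)) (d : ℝ) :
    Set (Fin m → stdSimplex ℝ (Fin N)) :=
  {w | (∀ i, ∃ t, w i = combo v t) ∧ ∀ i j, dist (w i) (w j) ≤ d}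

/-- New tuples are a barycenter followed by a tuple from a subdivided face. Since the latter stays
in the convex hull of `v`, its distance to the barycenter is bounded by the distances of the points
`v i`. The recursion meets faces of every dimension, so `θ` has to dominate all the factors. -/
theorem formalSd_single_mem {N : ℕ} {θ d : ℝ} (hd : 0 ≤ d) (hθ : ∀ k < n, (k : ℝ) / (k + 1) ≤ θ)
    (hθ0 : 0 ≤ θ) {v : Fin n → stdSimplex ℝ (Fin N)} (hv : ∀ i j, dist (v i) (v j) ≤ d) :
    formalSd n (Finsupp.single v 1) ∈
      Finsupp.supported (ZMod 2) (ZMod 2) (fineTuples n v (θ * d)) := by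
  induction n with
  | zero =>
    rw [formalSd_zero]
    exact single_mem_supported ⟨fun i => i.elim0, fun i => i.elim0⟩
  | succ n ih =>
    have key : formalSd n (FormalChain.bd (Finsupp.single v 1)) ∈
        Finsupp.supported (ZMod 2) (ZMod 2) (fineTuples n v (θ * d)) := by
      rw [FormalChain.bd_single, map_sum]
      refine Submodule.sum_mem _ fun i _ => ?_
      refine Finsupp.supported_mono ?_ (ih (fun k hk => hθ k (hk.trans n.lt_succ_self))
        (v := v ∘ i.succAbove) fun _ _ => hv _ _)
      rintro w ⟨h1, h2⟩
      refine ⟨fun j => ?_, h2⟩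
      obtain ⟨t, ht⟩ := h1 j
      exact ⟨_, ht.trans (combo_map _ _ _).symm⟩
    rw [formalSd_single]
    refine map_mem_supported _ (fun w hw => ?_) key
    rw [FormalChain.cone_single]
    obtain ⟨h1, h2⟩ := hw
    have hb (j : Fin n) : dist (bary n v) (w j) ≤ θ * d := by
      obtain ⟨t, ht⟩ := h1 j
      rw [ht, dist_comm]
      refine dist_combo_le (fun i => ?_) t
      rw [dist_comm]
      exact (dist_bary_le hv i).trans (mul_le_mul_of_nonneg_right (hθ n n.lt_succ_self) hd)
    refine single_mem_supported ⟨fun i => ?_, fun i j => ?_⟩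
    · refine Fin.cases ?_ (fun i => ?_) i
      · exact ⟨_, rfl⟩
      · simpa using h1 i
    · refine Fin.cases ?_ (fun i => ?_) i <;> refine Fin.cases ?_ (fun j => ?_) j
      · simpa using mul_nonneg hθ0 hd
      · simpa using hb j
      · simpa [dist_comm] using hb i
      · simpa using h2 i j

theorem formalSd_iterate_mem {N : ℕ} (v : Fin n → stdSimplex ℝ (Fin N)) (r : ℕ) :
    (formalSd n)^[r] (Finsupp.single v 1) ∈ Finsupp.supported (ZMod 2) (ZMod 2)
      {w : Fin n → stdSimplex ℝ (Fin N) | ∀ i j, dist (w i) (w j) ≤ ((n : ℝ) / (n + 1)) ^ r} := by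
  have hθ : ∀ k < n, (k : ℝ) / (k + 1) ≤ (n : ℝ) / (n + 1) := fun k hk => by
    have : (k : ℝ) ≤ n := by exact_mod_cast hk.le
    rw [div_le_div_iff₀ (by positivity) (by positivity)]
    nlinarith
  induction r with
  | zero =>
    -- The standard simplex has diameter at most one, the zeroth power of the factor.
    refine single_mem_supported fun i j => ?_
    rw [pow_zero]
    exact (Metric.dist_le_diam_of_mem (bounded_stdSimplex (Fin N)) (v i).2 (v j).2).trans
      diam_stdSimplex_le
  | succ r ih =>
    rw [Function.iterate_succ_apply']
    refine map_mem_supported _ (fun w hw => ?_) ih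
    refine Finsupp.supported_mono ?_
      (formalSd_single_mem (by positivity) hθ (by positivity) hw)
    rintro w' ⟨-, h⟩ i j
    rw [pow_succ']
    exact h i j

theorem sd_push_realize {N : ℕ} (σ : C(stdSimplex ℝ (Fin N), X))
    (c : FormalChain n (stdSimplex ℝ (Fin N))) :
    sd n (push σ (realize c)) = push σ (realize (formalSd n c)) := by
  refine linearMap_ext (f := sd n ∘ₗ push σ ∘ₗ realize) (g := push σ ∘ₗ realize ∘ₗ formalSd n)
    (fun v => ?_) c
  simp only [LinearMap.comp_apply, realize_single, push_single]
  rw [sd, extend_single, ← push_push, push_realize (isAffine_combo v),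
    push_formalSd (isAffine_combo v), vertices, FormalChain.push_single]
  have : combo v ∘ (fun i => stdSimplex.vertex i) = v := funext fun i => combo_apply_vertex v i
  rw [this]

/-- Moves iterated subdivision into the standard simplex, where the mesh can be measured. -/
theorem sd_iterate_single (σ : C(stdSimplex ℝ (Fin n), X)) (r : ℕ) :
    (sd n)^[r] (Finsupp.single σ 1) = push σ (realize ((formalSd n)^[r] (vertices n))) := by
  induction r with
  | zero =>
    rw [Function.iterate_zero_apply, Function.iterate_zero_apply, realize_vertices, push_single]
    rfl
  | succ r ih => rw [Function.iterate_succ_apply', ih, sd_push_realize, Function.iterate_succ_apply']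

theorem sd_iterate_mem_small {ι : Type*} {U : ι → Set X} {z : Chain n X} (hz : z ∈ small n U)
    (r : ℕ) : (sd n)^[r] z ∈ small n U := by
  induction r with
  | zero => exact hz
  | succ r ih =>
    rw [Function.iterate_succ_apply']
    exact sd_mem_small ih

theorem exists_sd_single_mem_small {ι : Type*} [Nonempty ι] {U : ι → Set X}
    (hU : ∀ i, IsOpen (U i)) {σ : C(stdSimplex ℝ (Fin n), X)} (hσ : ∀ t, σ t ∈ ⋃ i, U i) :
    ∃ r, (sd n)^[r] (Finsupp.single σ 1) ∈ small n U := by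
  obtain ⟨δ, hδ, h⟩ := lebesgue_number_lemma_of_metric (isCompact_univ (X := stdSimplex ℝ (Fin n)))
    (c := fun i => σ ⁻¹' U i) (fun i => (hU i).preimage σ.continuous) (fun t _ => by
      simpa using hσ t)
  obtain ⟨r, hr⟩ := exists_pow_lt_of_lt_one hδ
    (show (n : ℝ) / (n + 1) < 1 by rw [div_lt_one (by positivity)]; linarith)
  refine ⟨r, ?_⟩
  rw [sd_iterate_single]
  refine map_mem_supported (push σ ∘ₗ realize) (fun w hw => ?_) (formalSd_iterate_mem _ r)
  rw [LinearMap.comp_apply, realize_single, push_single]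
  refine single_mem_supported ?_
  rcases n with _ | n
  -- A simplex without vertices has empty domain, so any index will do.
  · exact ⟨Classical.arbitrary ι, fun t => by simpa using t.2.2⟩
  · obtain ⟨i, hi⟩ := h (w 0) trivial
    refine ⟨i, fun t => hi ?_⟩
    exact (dist_combo_le (fun j => hw j 0) t).trans_lt hr

theorem sd_iterate_add (z w : Chain n X) (r : ℕ) :
    (sd n)^[r] (z + w) = (sd n)^[r] z + (sd n)^[r] w := by
  rw [← Module.End.coe_pow, map_add]

theorem exists_sd_mem_small {ι : Type*} [Nonempty ι] {U : ι → Set X} (hU : ∀ i, IsOpen (U i))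
    {z : Chain n X} (hz : z ∈ sub n (⋃ i, U i)) : ∃ r, (sd n)^[r] z ∈ small n U := by
  replace hz := (Finsupp.supported_eq_span_single (ZMod 2) _).le hz
  induction hz using Submodule.span_induction with
  | mem x hx =>
    obtain ⟨σ, hσ, rfl⟩ := hx
    exact exists_sd_single_mem_small hU hσ
  | zero => exact ⟨0, Submodule.zero_mem _⟩
  | add x y _ _ hx hy =>
    obtain ⟨r, hr⟩ := hx
    obtain ⟨s, hs⟩ := hy
    refine ⟨s + r, ?_⟩
    rw [sd_iterate_add]
    refine Submodule.add_mem _ ?_ ?_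
    · rw [Function.iterate_add_apply]
      exact sd_iterate_mem_small hr s
    · rw [add_comm, Function.iterate_add_apply]
      exact sd_iterate_mem_small hs r
  | smul a x _ hx =>
    obtain ⟨r, hr⟩ := hx
    refine ⟨r, ?_⟩
    rw [← Module.End.coe_pow] at hr ⊢
    rw [map_smul]
    exact Submodule.smul_mem _ _ hr

/-- Small simplices: up to chain homotopy, chains which are covered by open sets `U i` are sums of
simplices each of which is contained in one of these sets. -/
theorem exists_small {ι : Type*} [Nonempty ι] {U : ι → Set X} (hU : ∀ i, IsOpen (U i))
    {z : Chain (n + 1) X} (hz : z ∈ sub (n + 1) (⋃ i, U i)) :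
    ∃ (S : Chain (n + 1) X →ₗ[ZMod 2] Chain (n + 2) X) (T : Chain n X →ₗ[ZMod 2] Chain (n + 1) X),
      z + bd (S z) + T (bd z) ∈ small (n + 1) U ∧
      (∀ A : Set X, ∀ w ∈ sub (n + 1) A, S w ∈ sub (n + 2) A) ∧
      (∀ A : Set X, ∀ w ∈ sub n A, T w ∈ sub (n + 1) A) ∧
      ∀ w ∈ small n U, T w ∈ small (n + 1) U := by
  obtain ⟨r, hr⟩ := exists_sd_mem_small hU hz
  suffices h : ∀ r, ∃ (S : Chain (n + 1) X →ₗ[ZMod 2] Chain (n + 2) X)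
      (T : Chain n X →ₗ[ZMod 2] Chain (n + 1) X),
      (∀ z, z + bd (S z) + T (bd z) = (sd (n + 1))^[r] z) ∧
      (∀ A : Set X, ∀ w ∈ sub (n + 1) A, S w ∈ sub (n + 2) A) ∧
      (∀ A : Set X, ∀ w ∈ sub n A, T w ∈ sub (n + 1) A) ∧
      ∀ w ∈ small n U, T w ∈ small (n + 1) U by
    obtain ⟨S, T, h1, h2, h3, h4⟩ := h r
    exact ⟨S, T, h1 z ▸ hr, h2, h3, h4⟩
  clear hr r
  intro r
  induction r with
  | zero =>
    refine ⟨0, 0, fun z => by simp, fun _ _ _ => Submodule.zero_mem _,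
      fun _ _ _ => Submodule.zero_mem _, fun _ _ => Submodule.zero_mem _⟩
  | succ r ih =>
    obtain ⟨S, T, h1, h2, h3, h4⟩ := ih
    -- Telescoping: the homotopy from the identity to `sd`, followed by the one for `r` steps
    -- applied after `sd`.
    refine ⟨sdHomotopy (n + 1) + S ∘ₗ sd (n + 1), sdHomotopy n + T ∘ₗ sd n, fun z => ?_,
      fun A w hw => ?_, fun A w hw => ?_, fun w hw => ?_⟩
    rotate_left
    · rw [LinearMap.add_apply, LinearMap.comp_apply]
      exact Submodule.add_mem _ (sdHomotopy_mem_sub hw) (h2 _ _ (sd_mem_sub hw))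
    · rw [LinearMap.add_apply, LinearMap.comp_apply]
      exact Submodule.add_mem _ (sdHomotopy_mem_sub hw) (h3 _ _ (sd_mem_sub hw))
    · rw [LinearMap.add_apply, LinearMap.comp_apply]
      exact Submodule.add_mem _ (sdHomotopy_mem_small hw) (h4 _ (sd_mem_small hw))
    rw [Function.iterate_succ_apply, ← h1]
    simp only [LinearMap.add_apply, LinearMap.comp_apply, map_add, bd_sd]
    have h := bd_sdHomotopy z
    have h' : z + bd (sdHomotopy (n + 1) z) + sdHomotopy n (bd z) = sd (n + 1) z := by
      rw [add_assoc, h, ← add_assoc, ZModModule.add_self, zero_add]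
    rw [← h']
    abel

end ModTwo
end

noncomputable section

namespace ModTwo

variable {X Y : Type*} [TopologicalSpace X] [TopologicalSpace Y] {m n : ℕ}

/-! ### Relative cycles and boundaries -/

/-- The relative cycles of the pair `(X, A)`. -/
def relCycles (n : ℕ) (A : Set X) : Submodule (ZMod 2) (Chain (n + 1) X) := (sub n A).comap bd

/-- The relative boundaries of the pair `(X, A)`, including the chains in `A`. -/
def relBoundaries (n : ℕ) (A : Set X) : Submodule (ZMod 2) (Chain n X) :=
  LinearMap.range (bd (n := n)) ⊔ sub n A

theorem mem_relBoundaries {A : Set X} {z : Chain n X} :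
    z ∈ relBoundaries n A ↔ ∃ w, ∃ v ∈ sub n A, bd w + v = z := by
  simp only [relBoundaries, Submodule.mem_sup, LinearMap.mem_range]
  constructor
  · rintro ⟨_, ⟨w, rfl⟩, v, hv, rfl⟩
    exact ⟨w, v, hv, rfl⟩
  · rintro ⟨w, v, hv, rfl⟩
    exact ⟨_, ⟨w, rfl⟩, v, hv, rfl⟩

theorem bd_mem_relBoundaries {A : Set X} (w : Chain (n + 1) X) : bd w ∈ relBoundaries n A :=
  Submodule.mem_sup_left ⟨w, rfl⟩

theorem sub_le_relBoundaries {A : Set X} : sub n A ≤ relBoundaries n A := le_sup_right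

theorem relBoundaries_mono {A B : Set X} (h : A ⊆ B) : relBoundaries n A ≤ relBoundaries n B :=
  sup_le_sup_left (sub_mono h) _

theorem relCycles_mono {A B : Set X} (h : A ⊆ B) : relCycles n A ≤ relCycles n B :=
  Submodule.comap_mono (sub_mono h)

theorem push_mem_relBoundaries {A : Set X} {B : Set Y} (f : C(X, Y)) (h : ∀ x ∈ A, f x ∈ B)
    {z : Chain n X} (hz : z ∈ relBoundaries n A) : push f z ∈ relBoundaries n B := by
  obtain ⟨w, v, hv, rfl⟩ := mem_relBoundaries.1 hz
  rw [map_add, ← bd_push]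
  exact Submodule.add_mem _ (bd_mem_relBoundaries _) (sub_le_relBoundaries (push_mem_sub f h hv))

/-- The quotient of `Z` by `B` has at most one nonzero element. -/
def AtMostOneClass {M : Type*} [AddCommGroup M] [Module (ZMod 2) M] (Z B : Submodule (ZMod 2) M) :
    Prop :=
  ∀ a ∈ Z, ∀ b ∈ Z, a ∈ B ∨ b ∈ B ∨ a + b ∈ B

theorem small_le_iSup {ι : Type*} (U : ι → Set X) : small n U ≤ ⨆ i, sub n (U i) := by
  rw [← Finsupp.supported_iUnion]
  exact Finsupp.supported_mono fun σ ⟨i, hi⟩ => Set.mem_iUnion.2 ⟨i, hi⟩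

/-- Simplices may cancel when they are pushed forward. Injectivity on `A` excludes this, so supports
can be read off from the image. -/
theorem mem_sub_preimage {A : Set X} {B : Set Y} {f : C(X, Y)} (hf : Set.InjOn f A)
    {c : Chain n X} (hc : c ∈ sub n A) (h : push f c ∈ sub n B) : c ∈ sub n (f ⁻¹' B) := by
  rw [Finsupp.mem_supported] at *
  intro σ hσ t
  refine h (a := f.comp σ) ?_ t
  rw [Finset.mem_coe, Finsupp.mem_support_iff] at *
  have := Finsupp.mapDomain_apply' {σ : C(stdSimplex ℝ (Fin n), X) | ∀ t, σ t ∈ A} c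
    (f := fun σ => f.comp σ) hc
    (fun σ hσ τ hτ e => ContinuousMap.ext fun t => hf (hσ t) (hτ t) (DFunLike.congr_fun e t))
    (hc (Finset.mem_coe.2 (Finsupp.mem_support_iff.2 hσ)))
  exact (this.trans_ne hσ)

theorem push_injOn {A : Set X} {f : C(X, Y)} (hf : Set.InjOn f A) {c : Chain n X}
    (hc : c ∈ sub n A) (h : push f c = 0) : c = 0 := by
  ext σ
  by_contra hσ
  have hσ' : σ ∈ c.support := Finsupp.mem_support_iff.2 hσ
  have := Finsupp.mapDomain_apply' {σ : C(stdSimplex ℝ (Fin n), X) | ∀ t, σ t ∈ A} c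
    (f := fun σ => f.comp σ) hc
    (fun σ hσ τ hτ e => ContinuousMap.ext fun t => hf (hσ t) (hτ t) (DFunLike.congr_fun e t))
    (hc hσ')
  refine hσ (this.symm.trans ?_)
  exact DFunLike.congr_fun h _

/-- The inclusion of a subset. -/
abbrev incl (A : Set X) : C(A, X) := ⟨Subtype.val, continuous_subtype_val⟩

theorem push_incl_injective (A : Set X) {c : Chain n A} (h : push (incl A) c = 0) : c = 0 :=
  push_injOn Subtype.val_injective.injOn (mem_sub_univ c) h

theorem push_incl_mem (A : Set X) (c : Chain n A) : push (incl A) c ∈ sub n A :=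
  push_mem_sub _ (fun x _ => x.2) (mem_sub_univ c)

theorem exists_push_eq {A : Set X} (f : C(Y, X))
    (hf : ∀ σ : C(stdSimplex ℝ (Fin n), X), (∀ t, σ t ∈ A) →
      ∃ τ : C(stdSimplex ℝ (Fin n), Y), f.comp τ = σ) {c : Chain n X}
    (hc : c ∈ sub n A) : ∃ c' : Chain n Y, push f c' = c := by
  refine map_mem_supported (N := LinearMap.range (push f)) LinearMap.id (fun σ hσ => ?_) hc
  obtain ⟨τ, rfl⟩ := hf σ hσ
  exact ⟨Finsupp.single τ 1, push_single _ _ _⟩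

theorem exists_push_incl_eq {A : Set X} {c : Chain n X} (hc : c ∈ sub n A) :
    ∃ c' : Chain n A, push (incl A) c' = c :=
  exists_push_eq _ (fun σ hσ => ⟨⟨fun t => ⟨σ t, hσ t⟩, σ.continuous.subtype_mk _⟩, rfl⟩) hc

/-! ### The homology of punctured Euclidean space -/

section Euclidean

variable {E : Type*} [NormedAddCommGroup E] [NormedSpace ℝ E]

/-- A cycle in a star-shaped set is a boundary in this set. -/
theorem exists_bd_eq_of_star {A : Set E} {p : E} (hp : p ∈ A)
    (hA : ∀ x ∈ A, ∀ s : ℝ, 0 ≤ s → s ≤ 1 → (1 - s) • x + s • p ∈ A) {z : Chain (n + 1) E}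
    (hz : z ∈ sub (n + 1) A) (hbd : bd z = 0) : ∃ q ∈ sub (n + 2) A, bd q = z :=
  exists_bd_eq_of_contraction
    ⟨fun x : E × unitInterval => (1 - (x.2 : ℝ)) • x.1 + (x.2 : ℝ) • p, by fun_prop⟩
    (by simp) (by simp) hp (fun x hx s => hA x hx s s.2.1 s.2.2) hz hbd

theorem exists_bd_eq {z : Chain (n + 1) E} (hbd : bd z = 0) : ∃ q : Chain (n + 2) E, bd q = z := by
  obtain ⟨q, -, h⟩ := exists_bd_eq_of_star (A := Set.univ) (p := (0 : E)) trivial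
    (fun _ _ _ _ _ => trivial) (mem_sub_univ z) hbd
  exact ⟨q, h⟩

/-- As `E` is contractible, `z + q` is a boundary: a relative class vanishes once its boundary
bounds inside `A`. -/
theorem mem_relBoundaries_of_bd_eq {A : Set E} {z q : Chain (n + 1) E} (hq : q ∈ sub (n + 1) A)
    (h : bd z = bd q) : z ∈ relBoundaries (n + 1) A := by
  obtain ⟨r, hr⟩ := exists_bd_eq (z := z + q) (by rw [map_add, h, ZModModule.add_self])
  refine mem_relBoundaries.2 ⟨r, q, hq, ?_⟩
  rw [hr, add_assoc, ZModModule.add_self, add_zero]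

end Euclidean

/-! ### A Mayer–Vietoris step for the punctured space -/

/-- The complement of the closed half axis on which the first coordinate has the sign opposite to
`s`. -/
def slit (m : ℕ) (s : ℝ) : Set (Fin (m + 1) → ℝ) := {x | 0 < s * x 0 ∨ Fin.tail x ≠ 0}

theorem isOpen_slit (s : ℝ) : IsOpen (slit m s) := by
  refine IsOpen.union (isOpen_lt continuous_const (continuous_const.mul (continuous_apply 0))) ?_
  exact (isClosed_singleton (x := (0 : Fin m → ℝ))).isOpen_compl.preimage
    (by unfold Fin.tail; fun_prop)

theorem slit_subset (s : ℝ) : slit m s ⊆ {0}ᶜ := by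
  rintro x hx rfl
  rcases hx with h | h
  · simp at h
  · exact h rfl

/-- The set is star-shaped about the point `s` of the first axis, which lies opposite to the removed
half axis. -/
theorem slit_star {s : ℝ} (hs : s ≠ 0) {z : Chain (n + 1) (Fin (m + 1) → ℝ)}
    (hz : z ∈ sub (n + 1) (slit m s)) (hbd : bd z = 0) : ∃ q ∈ sub (n + 2) (slit m s), bd q = z := by
  have hs2 : 0 < s * s := mul_self_pos.2 hs
  refine exists_bd_eq_of_star (p := Pi.single 0 s) (Or.inl (by simpa using hs2))
    (fun x hx r hr0 hr1 => ?_) hz hbd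
  rcases hx with h | h
  · refine Or.inl ?_
    have : s * ((1 - r) • x + r • Pi.single 0 s : Fin (m + 1) → ℝ) 0 =
        (1 - r) * (s * x 0) + r * (s * s) := by
      simp; ring
    rw [this]
    rcases hr0.eq_or_lt with rfl | hr
    · simpa using h
    · nlinarith [mul_pos hr hs2, mul_nonneg (sub_nonneg.2 hr1) h.le]
  · rcases hr1.eq_or_lt with rfl | hr
    · refine Or.inl ?_
      simpa using hs2
    · refine Or.inr fun h0 => h ?_
      ext i
      have := congrFun h0 i
      simp only [Fin.tail, Pi.add_apply, Pi.smul_apply, Pi.single_apply, Fin.succ_ne_zero, if_false,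
        smul_eq_mul, mul_zero, add_zero, Pi.zero_apply] at this ⊢
      exact (mul_eq_zero.1 this).resolve_left (sub_pos.2 hr).ne'

/-- The projection which forgets the first coordinate. -/
def tailMap (m : ℕ) : C(Fin (m + 1) → ℝ, Fin m → ℝ) := ⟨Fin.tail, by unfold Fin.tail; fun_prop⟩

/-- The inclusion of the hyperplane on which the first coordinate vanishes. -/
def consMap (m : ℕ) : C(Fin m → ℝ, Fin (m + 1) → ℝ) :=
  ⟨fun x => Fin.cons 0 x, Continuous.finCons continuous_const continuous_id⟩

/-- The homotopy which contracts the first coordinate. -/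
def flatten (m : ℕ) : C((Fin (m + 1) → ℝ) × unitInterval, Fin (m + 1) → ℝ) :=
  ⟨fun x => Fin.cons ((1 - (x.2 : ℝ)) * x.1 0) (Fin.tail x.1),
    Continuous.finCons (by fun_prop) (by unfold Fin.tail; fun_prop)⟩

theorem slit_inter : slit m 1 ∩ slit m (-1) = {x | Fin.tail x ≠ 0} := by
  ext x
  simp only [slit, Set.mem_inter_iff, Set.mem_ofPred_eq]
  constructor
  · rintro ⟨h | h, h' | h'⟩
    · linarith
    all_goals assumption
  · exact fun h => ⟨Or.inr h, Or.inr h⟩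

theorem slit_union : ⋃ b : Bool, slit m (cond b 1 (-1)) = {0}ᶜ := by
  refine subset_antisymm (Set.iUnion_subset fun b => slit_subset _) fun x hx => ?_
  by_cases h : Fin.tail x = 0
  · rcases lt_trichotomy (x 0) 0 with h0 | h0 | h0
    · exact Set.mem_iUnion.2 ⟨false, Or.inl (by simpa using h0)⟩
    · refine absurd ?_ hx
      rw [Set.mem_singleton_iff, ← Fin.cons_self_tail x, h, h0]
      ext i
      refine Fin.cases rfl (fun _ => rfl) i
    · exact Set.mem_iUnion.2 ⟨true, Or.inl (by simpa using h0)⟩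
  · exact Set.mem_iUnion.2 ⟨true, Or.inr h⟩

/-- `IsSplit g a` says that `a` is the part in the upper half of a subdivision of `∂ g`. -/
def IsSplit (g : Chain (m + 2) (Fin (m + 1) → ℝ)) (a : Chain (m + 1) (Fin (m + 1) → ℝ)) : Prop :=
  a ∈ sub (m + 1) (slit m 1) ∧ ∃ b ∈ sub (m + 1) (slit m (-1)),
    ∃ q ∈ sub (m + 2) ({0}ᶜ : Set (Fin (m + 1) → ℝ)), bd g + bd q = a + b

theorem IsSplit.add {g g' : Chain (m + 2) (Fin (m + 1) → ℝ)}
    {a a' : Chain (m + 1) (Fin (m + 1) → ℝ)} (h : IsSplit g a) (h' : IsSplit g' a') :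
    IsSplit (g + g') (a + a') := by
  obtain ⟨ha, b, hb, q, hq, e⟩ := h
  obtain ⟨ha', b', hb', q', hq', e'⟩ := h'
  refine ⟨Submodule.add_mem _ ha ha', b + b', Submodule.add_mem _ hb hb', q + q',
    Submodule.add_mem _ hq hq', ?_⟩
  rw [map_add, map_add, add_add_add_comm, e, e', add_add_add_comm]

/-- The two slit sets form an open cover of the punctured space, to which `∂g` can be subordinated
by subdivision. -/
theorem exists_isSplit {g : Chain (m + 2) (Fin (m + 1) → ℝ)} (hg : g ∈ relCycles (m + 1) {0}ᶜ) :
    ∃ a, IsSplit g a := by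
  have hg' : bd g ∈ sub (m + 1) (⋃ b : Bool, slit m (cond b 1 (-1))) := by
    rw [slit_union]; exact hg
  obtain ⟨S, T, h, hS, -, -⟩ := exists_small (fun b : Bool => isOpen_slit _) hg'
  rw [bd_bd, map_zero, add_zero] at h
  have h' := small_le_iSup _ h
  rw [iSup_bool_eq, Submodule.mem_sup] at h'
  obtain ⟨a, ha, b, hb, e⟩ := h'
  exact ⟨a, ha, b, hb, S (bd g), hS _ _ hg, e.symm⟩

/-- As `∂∂ = 0`, the two parts have the same boundary, which hence lies in both slit sets. Passing
to it is the connecting map. -/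
theorem IsSplit.bd_eq {g : Chain (m + 2) (Fin (m + 1) → ℝ)} {a : Chain (m + 1) (Fin (m + 1) → ℝ)}
    (h : IsSplit g a) : bd a ∈ sub m {x : Fin (m + 1) → ℝ | Fin.tail x ≠ 0} := by
  obtain ⟨ha, b, hb, q, hq, e⟩ := h
  have e' := congrArg bd e
  rw [map_add, bd_bd, bd_bd, add_zero, map_add, eq_comm, ← ZModModule.sub_eq_add, sub_eq_zero] at e'
  rw [← slit_inter]
  exact mem_sub_inter (bd_mem_sub ha) (e' ▸ bd_mem_sub hb)

theorem IsSplit.mem_relCycles {g : Chain (m + 2) (Fin (m + 1) → ℝ)}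
    {a : Chain (m + 1) (Fin (m + 1) → ℝ)} (h : IsSplit g a) :
    push (tailMap m) a ∈ relCycles m {0}ᶜ := by
  rw [relCycles, Submodule.mem_comap, bd_push]
  exact push_mem_sub _ (fun x hx => hx) h.bd_eq

/-- Injectivity of the connecting map. If the projection of `a` is trivial, then `∂a` equals `∂y`
for some `y` in the intersection of the slit sets. Now `a + y` and `b + y` are cycles in star-shaped
sets, so `a + b`, and with it `∂g`, bounds away from the origin. -/
theorem IsSplit.mem_relBoundaries {g : Chain (m + 2) (Fin (m + 1) → ℝ)}
    {a : Chain (m + 1) (Fin (m + 1) → ℝ)} (h : IsSplit g a)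
    (ha : push (tailMap m) a ∈ relBoundaries (m + 1) {0}ᶜ) : g ∈ relBoundaries (m + 2) {0}ᶜ := by
  obtain ⟨w, v, hv, e⟩ := ModTwo.mem_relBoundaries.1 ha
  have hbd := h.bd_eq
  obtain ⟨ha, b, hb, q, hq, e'⟩ := h
  set P := homotopyOp (flatten m) with hP
  have hH := congrArg bd (bd_homotopyOp (flatten m) a)
  have e0 : (flatten m).comp ((ContinuousMap.id _).prodMk (ContinuousMap.const _ 0)) =
      ContinuousMap.id _ := by
    ext1 x
    simp [flatten]
  have e1 : (flatten m).comp ((ContinuousMap.id _).prodMk (ContinuousMap.const _ 1)) =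
      (consMap m).comp (tailMap m) := by
    ext1 x
    simp [flatten, consMap, tailMap]
  rw [e0, e1, push_id, map_add, bd_bd, zero_add, ← push_push, map_add, bd_push, bd_push] at hH
  have hv' : push (tailMap m) (bd a) = bd v := by
    rw [← bd_push, ← e, map_add, bd_bd, zero_add]
  rw [hv', ← bd_push] at hH
  obtain ⟨y, hy, hya⟩ : ∃ y ∈ sub (m + 1) (slit m 1 ∩ slit m (-1)), bd y = bd a := by
    -- In the hyperplane, `v` bounds the flattened `∂a`; the homotopy joins this to `∂a` itself.
    -- Flattening keeps the tail, so both chains avoid the first axis.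
    refine ⟨push (consMap m) v + homotopyOp (flatten m) m (bd a), ?_, ?_⟩
    · rw [slit_inter]
      refine Submodule.add_mem _ (push_mem_sub _ (fun x hx => ?_) hv)
        (homotopyOp_mem_sub _ (fun x hx s => ?_) hbd)
      · simpa [consMap] using hx
      · simpa [flatten] using hx
    · rw [map_add, hH, ← add_assoc, ZModModule.add_self, zero_add]
  have hab : bd a = bd b := by
    have e' := congrArg bd e'
    rw [map_add, bd_bd, bd_bd, add_zero, map_add, eq_comm, ← ZModModule.sub_eq_add,
      sub_eq_zero] at e'
    exact e'
  obtain ⟨a', ha', ea⟩ := slit_star (s := 1) one_ne_zero (z := a + y)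
    (Submodule.add_mem _ ha (sub_mono Set.inter_subset_left hy))
    (by rw [map_add, hya, ZModModule.add_self])
  obtain ⟨b', hb', eb⟩ := slit_star (s := -1) (by norm_num) (z := b + y)
    (Submodule.add_mem _ hb (sub_mono Set.inter_subset_right hy))
    (by rw [map_add, hya, hab, ZModModule.add_self])
  refine mem_relBoundaries_of_bd_eq (q := a' + b' + q) (Submodule.add_mem _ (Submodule.add_mem _
    (sub_mono (slit_subset _) ha') (sub_mono (slit_subset _) hb')) hq) ?_
  rw [map_add, map_add, ea, eb, add_add_add_comm, ZModModule.add_self, add_zero, ← e', add_assoc (bd g),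
    ZModModule.add_self]
  exact (add_zero _).symm

/-- The relative homology of `(ℝ^m, ℝ^m ∖ 0)` in degree `m` has at most one nonzero element. -/
theorem atMostOneClass_punctured (m : ℕ) : AtMostOneClass
    (relCycles m ({0}ᶜ : Set (Fin m → ℝ))) (relBoundaries (m + 1) {0}ᶜ) := by
  induction m with
  | zero =>
    intro g _ g' _
    -- `ℝ^0` is a point and carries a single simplex, hence a single nonzero chain.
    have hu (c : Chain 1 (Fin 0 → ℝ)) : c = 0 ∨ c = Finsupp.single (ContinuousMap.const _ 0) 1 := by
      have (σ : C(stdSimplex ℝ (Fin 1), Fin 0 → ℝ)) : σ = ContinuousMap.const _ 0 :=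
        ContinuousMap.ext fun _ => Subsingleton.elim _ _
      have hc : ∀ a : ZMod 2, a = 0 ∨ a = 1 := by decide
      rcases hc (c (ContinuousMap.const _ 0)) with h | h
      · left; ext σ; rw [this σ, h]; rfl
      · right; ext σ; rw [this σ, h, Finsupp.single_eq_same]
    rcases hu g with rfl | rfl
    · exact Or.inl (Submodule.zero_mem _)
    · rcases hu g' with rfl | rfl
      · exact Or.inr (Or.inl (Submodule.zero_mem _))
      · refine Or.inr (Or.inr ?_)
        rw [ZModModule.add_self]
        exact Submodule.zero_mem _
  | succ m ih =>
    intro g hg g' hg'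
    obtain ⟨a, ha⟩ := exists_isSplit hg
    obtain ⟨a', ha'⟩ := exists_isSplit hg'
    rcases ih _ ha.mem_relCycles _ ha'.mem_relCycles with h | h | h
    · exact Or.inl (ha.mem_relBoundaries h)
    · exact Or.inr (Or.inl (ha'.mem_relBoundaries h))
    · rw [← map_add] at h
      exact Or.inr (Or.inr ((ha.add ha').mem_relBoundaries h))

/-! ### From the punctured space to the complement of the ball -/

section Outside

variable {E : Type*} [NormedAddCommGroup E] [NormedSpace ℝ E]

/-- The complement of the open unit ball. -/
abbrev outside (E : Type*) [NormedAddCommGroup E] : Set E := {x | 1 ≤ ‖x‖}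

omit [NormedSpace ℝ E] in
theorem outside_subset : outside E ⊆ {0}ᶜ := by
  rintro x hx rfl
  simp only [Set.mem_ofPred_eq, norm_zero] at hx
  linarith

/-- The radial map `f` pushes `v` out of the open ball. It fixes all points of norm at least one, so
it does not change `∂v = ∂g`. -/
theorem mem_relBoundaries_outside {g : Chain (n + 1) E} (hg : g ∈ relCycles n (outside E))
    (h : g ∈ relBoundaries (n + 1) {0}ᶜ) : g ∈ relBoundaries (n + 1) (outside E) := by
  obtain ⟨w, v, hv, rfl⟩ := mem_relBoundaries.1 h
  rw [relCycles, Submodule.mem_comap, map_add, bd_bd, zero_add] at hg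
  obtain ⟨v', rfl⟩ := exists_push_incl_eq hv
  let f : C(({0}ᶜ : Set E), E) := ⟨fun x => (min ‖(x : E)‖ 1)⁻¹ • (x : E), by
    refine Continuous.smul (Continuous.inv₀ (by fun_prop) fun x => ?_) continuous_subtype_val
    exact (lt_min (norm_pos_iff.2 x.2) one_pos).ne'⟩
  have hf : ∀ x, f x ∈ outside E := fun x => by
    have hx : 0 < ‖(x : E)‖ := norm_pos_iff.2 x.2
    change 1 ≤ ‖(min ‖(x : E)‖ 1)⁻¹ • (x : E)‖
    rw [norm_smul, norm_inv, Real.norm_of_nonneg (le_min hx.le zero_le_one),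
      inv_mul_eq_div, one_le_div (lt_min hx one_pos)]
    exact min_le_left _ _
  refine mem_relBoundaries_of_bd_eq (q := push f v')
    (push_mem_sub (A := Set.univ) f (fun x _ => hf x) (mem_sub_univ _)) ?_
  rw [map_add, bd_bd, zero_add, bd_push, bd_push]
  rw [bd_push] at hg
  refine push_congr _ _ (fun x hx => ?_)
    (mem_sub_preimage Subtype.val_injective.injOn (mem_sub_univ _) hg)
  change (x : E) = (min ‖(x : E)‖ 1)⁻¹ • (x : E)
  rw [min_eq_right hx, inv_one, one_smul]

/-- The relative homology in degree `m` of `ℝ^m` modulo the complement of the open unit ball has at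
most one nonzero element. -/
theorem atMostOneClass_outside (m : ℕ) : AtMostOneClass
    (relCycles m (outside (Fin m → ℝ))) (relBoundaries (m + 1) (outside (Fin m → ℝ))) := by
  intro g hg g' hg'
  have hle := relCycles_mono (n := m) (outside_subset (E := Fin m → ℝ))
  rcases atMostOneClass_punctured m g (hle hg) g' (hle hg') with h | h | h
  · exact Or.inl (mem_relBoundaries_outside hg h)
  · exact Or.inr (Or.inl (mem_relBoundaries_outside hg' h))
  · exact Or.inr (Or.inr (mem_relBoundaries_outside (Submodule.add_mem _ hg hg') h))

end Outside

end ModTwo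
end

noncomputable section

namespace ModTwo

/-! ### Attaching cells -/

section Relative

variable {X Y : Type*} [TopologicalSpace X] [TopologicalSpace Y] {n : ℕ}

theorem add_mem_relBoundaries_of_homotopy (H : C(X × unitInterval, Y)) {A : Set X} {B : Set Y}
    (h : ∀ x ∈ A, ∀ s, H (x, s) ∈ B) {z : Chain (n + 1) X} (hz : z ∈ relCycles n A) :
    push (H.comp ((ContinuousMap.id X).prodMk (ContinuousMap.const X 1))) z +
      push (H.comp ((ContinuousMap.id X).prodMk (ContinuousMap.const X 0))) z ∈
        relBoundaries (n + 1) B := by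
  rw [← bd_homotopyOp]
  exact Submodule.add_mem _ (bd_mem_relBoundaries _)
    (sub_le_relBoundaries (homotopyOp_mem_sub H h hz))

theorem add_mem_cancel {M : Type*} [AddCommGroup M] [Module (ZMod 2) M] {B : Submodule (ZMod 2) M}
    {a b : M} (h : a + b ∈ B) (hb : b ∈ B) : a ∈ B := by
  have := Submodule.add_mem _ h hb
  rwa [add_assoc, ZModModule.add_self, add_zero] at this

theorem add_mem_cancel_left {M : Type*} [AddCommGroup M] [Module (ZMod 2) M]
    {B : Submodule (ZMod 2) M} {a b : M} (h : a + b ∈ B) (ha : a ∈ B) : b ∈ B :=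
  add_mem_cancel (add_comm a b ▸ h) ha

theorem bd_mem_relCycles {A : Set X} (w : Chain (n + 2) X) : bd w ∈ relCycles n A := by
  rw [relCycles, Submodule.mem_comap, bd_bd]
  exact Submodule.zero_mem _

theorem sub_le_relCycles {A : Set X} : sub (n + 1) A ≤ relCycles n A := fun _ h => bd_mem_sub h

theorem relBoundaries_le_relCycles {A : Set X} : relBoundaries (n + 1) A ≤ relCycles n A := by
  intro z hz
  obtain ⟨w, v, hv, rfl⟩ := mem_relBoundaries.1 hz
  exact Submodule.add_mem _ (bd_mem_relCycles w) (sub_le_relCycles hv)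

theorem sub_le_small {ι : Type*} (U : ι → Set X) (i : ι) : sub n (U i) ≤ small n U :=
  Finsupp.supported_mono fun _ h => ⟨i, h⟩

/-- Every relative cycle is homologous to a sum of chains in the members of an open cover. -/
theorem exists_small_relCycle {ι : Type*} [Nonempty ι] {U : ι → Set X} (hU : ∀ i, IsOpen (U i))
    (hcov : ⋃ i, U i = Set.univ) {A : Set X} {z : Chain (n + 1) X} (hz : z ∈ relCycles n A) :
    ∃ z' ∈ small (n + 1) U, z' + z ∈ relBoundaries (n + 1) A := by
  obtain ⟨S, T, h, -, hT, -⟩ := exists_small hU (z := z) (hcov ▸ mem_sub_univ z)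
  refine ⟨_, h, ?_⟩
  rw [add_right_comm, add_right_comm z, ZModModule.add_self, zero_add]
  exact Submodule.add_mem _ (bd_mem_relBoundaries _) (sub_le_relBoundaries (hT _ _ hz))

/-- A small boundary is the boundary of a small chain. -/
theorem exists_small_bd_eq {ι : Type*} [Nonempty ι] {U : ι → Set X} (hU : ∀ i, IsOpen (U i))
    (hcov : ⋃ i, U i = Set.univ) {w : Chain (n + 1) X} (hw : bd w ∈ small n U) :
    ∃ w' ∈ small (n + 1) U, bd w' = bd w := by
  obtain ⟨S, T, h, -, -, hT⟩ := exists_small hU (z := w) (hcov ▸ mem_sub_univ w)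
  refine ⟨_, Submodule.add_mem _ h (hT _ hw), ?_⟩
  rw [add_assoc, ZModModule.add_self, add_zero, map_add, bd_bd, add_zero]

end Relative

/-- The open unit ball. -/
abbrev inside (E : Type*) [NormedAddCommGroup E] : Set E := {x | ‖x‖ < 1}

/-- A space `Y` with a closed subspace `A` such that `Y` arises from `A` by attaching cells with
characteristic maps `Φ i`. The characteristic maps, which matter on the closed unit ball only, are
extended to the whole vector space so that they are constant on rays outside of the unit ball. -/
structure CellAttach (E : Type*) [NormedAddCommGroup E] [NormedSpace ℝ E] (Y : Type*)
    [TopologicalSpace Y] (ι : Type*) where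
  /-- The subspace to which the cells are attached. -/
  A : Set Y
  /-- The characteristic maps. -/
  Φ : ι → C(E, Y)
  mem : ∀ i x, 1 ≤ ‖x‖ → Φ i x ∈ A
  notMem : ∀ i x, ‖x‖ < 1 → Φ i x ∉ A
  inj : ∀ i j x y, ‖x‖ < 1 → ‖y‖ < 1 → Φ i x = Φ j y → i = j ∧ x = y
  cover : ∀ y ∉ A, ∃ i x, ‖x‖ < 1 ∧ Φ i x = y
  radial : ∀ i x (t : ℝ), 1 ≤ ‖x‖ → 1 ≤ t → Φ i (t • x) = Φ i x
  /-- The inverses of the characteristic maps on the open cells. -/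
  inv : ι → Y → E
  continuousOn_inv : ∀ i, ContinuousOn (inv i) (Φ i '' inside E)
  inv_apply : ∀ i x, ‖x‖ < 1 → inv i (Φ i x) = x
  isClosed : IsClosed A
  weak : ∀ F : Set Y, IsClosed (F ∩ A) → (∀ i, IsClosed (Φ i ⁻¹' F)) → IsClosed F

namespace CellAttach

variable {E : Type*} [NormedAddCommGroup E] [NormedSpace ℝ E] {Y Z : Type*} [TopologicalSpace Y]
  [TopologicalSpace Z] {ι : Type*} {n : ℕ}

section

variable (S : CellAttach E Y ι)

/-- The open cells. -/
def cell (i : ι) : Set Y := S.Φ i '' inside E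

theorem apply_mem_cell_iff {i j : ι} {x : E} : S.Φ i x ∈ S.cell j ↔ i = j ∧ ‖x‖ < 1 := by
  constructor
  · rintro ⟨y, hy, e⟩
    have hx : ‖x‖ < 1 := by
      by_contra h
      exact S.notMem j y hy (e ▸ S.mem i x (not_lt.1 h))
    exact ⟨(S.inj _ _ _ _ hy hx e).1.symm, hx⟩
  · rintro ⟨rfl, hx⟩
    exact ⟨x, hx, rfl⟩

theorem cell_disjoint_base {i : ι} {y : Y} (hy : y ∈ S.cell i) : y ∉ S.A := by
  obtain ⟨x, hx, rfl⟩ := hy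
  exact S.notMem i x hx

theorem isOpen_cell (i : ι) : IsOpen (S.cell i) := by
  rw [← isClosed_compl_iff]
  refine S.weak _ ?_ fun j => ?_
  · convert S.isClosed using 1
    exact Set.inter_eq_right.2 fun y hy h => S.cell_disjoint_base h hy
  · by_cases h : j = i
    · convert isClosed_le (continuous_const (y := (1 : ℝ))) (continuous_norm (E := E)) using 1
      ext x
      simp [S.apply_mem_cell_iff, h]
    · convert isClosed_univ using 1
      ext x
      simp [S.apply_mem_cell_iff, h]

/-- Maps on `Y` can be glued from maps on the cells. -/
theorem exists_glue (a : C(Y, Z)) (g : ι → C(E, Z)) (h : ∀ i x, 1 ≤ ‖x‖ → g i x = a (S.Φ i x)) :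
    ∃ f : C(Y, Z), (∀ y ∈ S.A, f y = a y) ∧ ∀ i x, f (S.Φ i x) = g i x := by
  classical
  let f : Y → Z := fun y => if hy : y ∈ S.A then a y else
    g (S.cover y hy).choose (S.cover y hy).choose_spec.choose
  have hA : ∀ y ∈ S.A, f y = a y := fun y hy => dif_pos hy
  have hΦ : ∀ i x, f (S.Φ i x) = g i x := by
    intro i x
    by_cases hx : 1 ≤ ‖x‖
    · rw [hA _ (S.mem i x hx), h i x hx]
    · have hx' := S.notMem i x (not_le.1 hx)
      have hs := (S.cover _ hx').choose_spec.choose_spec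
      obtain ⟨h1, h2⟩ := S.inj _ _ _ _ hs.1 (not_le.1 hx) hs.2
      refine (dif_neg hx').trans ?_
      rw [h2]
      exact congrArg (fun j => g j x) h1
  refine ⟨⟨f, continuous_iff_isClosed.2 fun F hF => S.weak _ ?_ fun i => ?_⟩, hA, hΦ⟩
  · convert (hF.preimage a.continuous).inter S.isClosed using 1
    ext y
    simp only [Set.mem_inter_iff, Set.mem_preimage, and_congr_left_iff]
    intro hy
    rw [hA y hy]
  · convert hF.preimage (g i).continuous using 1
    ext x
    simp only [Set.mem_preimage, hΦ]

/-- An open neighbourhood of `A` which meets the cells in the complements of smaller balls. -/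
theorem exists_collar : ∃ V : Set Y, IsOpen V ∧ S.A ⊆ V ∧ ∀ i x, S.Φ i x ∈ V ↔ 1 / 2 < ‖x‖ := by
  obtain ⟨u, huA, hu⟩ := S.exists_glue (Z := ℝ) (ContinuousMap.const _ 1)
    (fun _ => ⟨fun x => min ‖x‖ 1, by fun_prop⟩) (fun i x hx => min_eq_right hx)
  refine ⟨u ⁻¹' Set.Ioi (1 / 2), isOpen_Ioi.preimage u.continuous, fun y hy => ?_, fun i x => ?_⟩
  · rw [Set.mem_preimage, huA y hy]
    norm_num
  · rw [Set.mem_preimage, hu, Set.mem_Ioi]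
    change 1 / 2 < min ‖x‖ 1 ↔ _
    rw [lt_min_iff, and_iff_left (by norm_num)]

/-- The radial expansion of the cells. -/
theorem exists_expansion : ∃ H : C(Y × unitInterval, Y), (∀ y ∈ S.A, ∀ s, H (y, s) = y) ∧
    ∀ i x (s : unitInterval), H (S.Φ i x, s) = S.Φ i ((1 + (s : ℝ)) • x) := by
  -- Gluing maps into the path space, and uncurrying afterwards, requires the weak topology only on
  -- `Y` and not on its product with the interval.
  obtain ⟨h, hA, hΦ⟩ := S.exists_glue (Z := C(unitInterval, Y)) ContinuousMap.const'
    (fun i => ContinuousMap.curry ⟨fun x : E × unitInterval => S.Φ i ((1 + (x.2 : ℝ)) • x.1),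
      by fun_prop⟩)
    (fun i x hx => ContinuousMap.ext fun s => S.radial i x _ hx (by linarith [s.2.1]))
  refine ⟨h.uncurry, fun y hy s => ?_, fun i x s => ?_⟩
  · change h y s = y
    rw [hA y hy]
    rfl
  · change h (S.Φ i x) s = _
    rw [hΦ]
    rfl

theorem injOn (i : ι) : Set.InjOn (S.Φ i) (inside E) :=
  fun _ hx _ hy e => (S.inj _ _ _ _ hx hy e).2

/-- An open cell is homeomorphic to the open ball through `inv`, so its simplices lift. -/
theorem exists_lift {i : ι} {c : Chain n Y} (hc : c ∈ sub n (S.cell i)) :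
    ∃ c' ∈ sub n (inside E), push (S.Φ i) c' = c := by
  refine map_mem_supported (N := (sub n (inside E)).map (push (S.Φ i))) LinearMap.id
    (fun σ hσ => ?_) hc
  refine ⟨Finsupp.single ⟨fun t => S.inv i (σ t),
    (S.continuousOn_inv i).comp_continuous σ.continuous hσ⟩ 1, single_mem_supported fun t => ?_, ?_⟩
  · obtain ⟨x, hx, e⟩ := hσ t
    change ‖S.inv i (σ t)‖ < 1
    rw [← e, S.inv_apply i x hx]
    exact hx
  · rw [push_single]
    congr 1
    ext t
    obtain ⟨x, hx, e⟩ := hσ t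
    change S.Φ i (S.inv i (σ t)) = σ t
    rw [← e, S.inv_apply i x hx]

/-- The structure in which only one of the cells is attached. -/
def single (i : ι) : CellAttach E Y Unit where
  A := (S.cell i)ᶜ
  Φ _ := S.Φ i
  mem _ x hx h := by
    rw [S.apply_mem_cell_iff] at h
    exact absurd h.2 (not_lt.2 hx)
  notMem _ x hx h := h ⟨x, hx, rfl⟩
  inj _ _ x y hx hy e := ⟨rfl, S.injOn i hx hy e⟩
  cover y hy := by
    obtain ⟨x, hx, e⟩ := not_not.1 hy
    exact ⟨(), x, hx, e⟩
  radial _ := S.radial i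
  inv _ := S.inv i
  continuousOn_inv _ := S.continuousOn_inv i
  inv_apply _ := S.inv_apply i
  isClosed := (S.isOpen_cell i).isClosed_compl
  weak F hF hΦ := by
    refine S.weak F ?_ fun j => ?_
    · convert hF.inter S.isClosed using 1
      ext y
      simp only [Set.mem_inter_iff, Set.mem_compl_iff]
      exact ⟨fun h => ⟨⟨h.1, fun h' => S.cell_disjoint_base h' h.2⟩, h.2⟩, fun h => ⟨h.1.1, h.2⟩⟩
    · by_cases h : j = i
      · exact h ▸ hΦ ()
      · convert hF.preimage (S.Φ j).continuous using 1
        ext x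
        simp [S.apply_mem_cell_iff, h]

end

/-- The scaling map by a factor of two. -/
def double (E : Type*) [NormedAddCommGroup E] [NormedSpace ℝ E] : C(E, E) :=
  ⟨fun x => (2 : ℝ) • x, by fun_prop⟩

theorem double_mem {x : E} (hx : 1 / 2 < ‖x‖) : double E x ∈ outside E := by
  change 1 ≤ ‖(2 : ℝ) • x‖
  rw [norm_smul, Real.norm_two]
  linarith

theorem push_double_add_mem {z : Chain (n + 1) E} (hz : z ∈ relCycles n (outside E)) :
    push (double E) z + z ∈ relBoundaries (n + 1) (outside E) := by
  let H : C(E × unitInterval, E) := ⟨fun x => (1 + (x.2 : ℝ)) • x.1, by fun_prop⟩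
  have e0 : H.comp ((ContinuousMap.id _).prodMk (ContinuousMap.const _ 0)) =
      ContinuousMap.id _ := by
    ext1 x
    simp [H]
  have e1 : H.comp ((ContinuousMap.id _).prodMk (ContinuousMap.const _ 1)) = double E := by
    ext1 x
    simp [H, double, one_add_one_eq_two]
  have := add_mem_relBoundaries_of_homotopy H (B := outside E) (fun x hx s => ?_) hz
  · rwa [e0, e1, push_id] at this
  · change 1 ≤ ‖(1 + (s : ℝ)) • x‖
    rw [norm_smul, Real.norm_of_nonneg (by linarith [s.2.1])]
    have hx' : 1 ≤ ‖x‖ := hx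
    nlinarith [s.2.1, norm_nonneg x]

/-- Doubling is homotopic to the identity as a map of pairs and moves the collar out of the open
unit ball. -/
theorem mem_relBoundaries_of_mem_sub {z : Chain (n + 1) E} (hz : z ∈ relCycles n (outside E))
    (h : z ∈ sub (n + 1) {x : E | 1 / 2 < ‖x‖}) : z ∈ relBoundaries (n + 1) (outside E) := by
  exact add_mem_cancel_left (push_double_add_mem hz) (sub_le_relBoundaries (push_mem_sub _ (fun x hx => double_mem hx) h))

/-- Excision, injectivity: a characteristic map is injective on relative homology. -/
theorem mem_relBoundaries_of_push (S : CellAttach E Y Unit) {g : Chain (n + 1) E}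
    (hg : g ∈ relCycles n (outside E)) (h : push (S.Φ ()) g ∈ relBoundaries (n + 1) S.A) :
    g ∈ relBoundaries (n + 1) (outside E) := by
  obtain ⟨V, hV, hAV, hΦV⟩ := S.exists_collar
  set φ := S.Φ () with hφ
  have hUo : ∀ b : Bool, IsOpen (cond b (inside E) {x : E | 1 / 2 < ‖x‖}) := by
    rintro (_ | _)
    · exact isOpen_lt continuous_const continuous_norm
    · exact isOpen_lt continuous_norm continuous_const
  have hUc : ⋃ b : Bool, cond b (inside E) {x : E | 1 / 2 < ‖x‖} = Set.univ := by
    refine Set.eq_univ_of_forall fun x => ?_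
    rcases lt_or_ge ‖x‖ 1 with hx | hx
    · exact Set.mem_iUnion.2 ⟨true, hx⟩
    · exact Set.mem_iUnion.2 ⟨false, show 1 / 2 < ‖x‖ by linarith⟩
  obtain ⟨g', hg', hgg⟩ := exists_small_relCycle hUo hUc hg
  have hφm : ∀ x ∈ outside E, φ x ∈ S.A := fun x hx => S.mem () x hx
  suffices hsuff : g' ∈ relBoundaries (n + 1) (outside E) from
    add_mem_cancel_left hgg hsuff
  have hgc : g' ∈ relCycles n (outside E) :=
    add_mem_cancel (relBoundaries_le_relCycles hgg) hg
  have h' : push φ g' ∈ relBoundaries (n + 1) S.A := by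
    have := push_mem_relBoundaries φ hφm hgg
    rw [map_add] at this
    exact add_mem_cancel this h
  have hs := small_le_iSup _ hg'
  rw [iSup_bool_eq, Submodule.mem_sup] at hs
  obtain ⟨gU, hgU, gV, hgV, rfl⟩ := hs
  obtain ⟨w, v, hv, e⟩ := mem_relBoundaries.1 h'
  have hWo : ∀ b : Bool, IsOpen (cond b (S.cell ()) V) := by
    rintro (_ | _)
    · exact hV
    · exact S.isOpen_cell ()
  have hWc : ⋃ b : Bool, cond b (S.cell ()) V = Set.univ := by
    refine Set.eq_univ_of_forall fun y => ?_
    by_cases hy : y ∈ S.A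
    · exact Set.mem_iUnion.2 ⟨false, hAV hy⟩
    · obtain ⟨_, x, hx, rfl⟩ := S.cover y hy
      exact Set.mem_iUnion.2 ⟨true, x, hx, rfl⟩
  have hφgV : push φ gV ∈ sub (n + 1) V := push_mem_sub φ (fun x hx => (hΦV () x).2 hx) hgV
  have hφgU : push φ gU ∈ sub (n + 1) (S.cell ()) :=
    push_mem_sub φ (fun x hx => show φ x ∈ S.cell () from ⟨x, hx, rfl⟩) hgU
  have hvV : v ∈ sub (n + 1) V := sub_mono hAV hv
  have ew : bd w = push φ gU + (push φ gV + v) := by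
    rw [← add_assoc, ← map_add, ← e, add_assoc (bd w), ZModModule.add_self]
    exact (add_zero _).symm
  -- The boundary of `w` is already small, so `w` can be exchanged for a sum of a chain in the cell
  -- and a chain in `V`.
  obtain ⟨w', hw', ew'⟩ := exists_small_bd_eq hWo hWc (w := w) (by
    rw [ew]
    exact Submodule.add_mem _ (sub_le_small (fun b : Bool => cond b (S.cell ()) V) true hφgU)
      (sub_le_small (fun b : Bool => cond b (S.cell ()) V) false (Submodule.add_mem _ hφgV hvV)))
  have hs' := small_le_iSup _ hw'
  rw [iSup_bool_eq, Submodule.mem_sup] at hs'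
  obtain ⟨xU, hxU, xV, hxV, rfl⟩ := hs'
  obtain ⟨x, hx, rfl⟩ := S.exists_lift hxU
  rw [ew, map_add] at ew'
  -- Up to chains in `V`, the images of `gU` and of `∂x` cancel. Injectivity on the open ball brings
  -- this back to `E`.
  have key : push φ (gU + bd x) ∈ sub (n + 1) V := by
    have : push φ (gU + bd x) = push φ gV + v + bd xV := by
      rw [map_add, ← bd_push, ← sub_eq_zero, ZModModule.sub_eq_add,
        show push φ gU + bd (push φ x) + (push φ gV + v + bd xV) =
          (push φ gU + (push φ gV + v)) + (bd (push φ x) + bd xV) by abel, ew',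
        ZModModule.add_self]
    rw [this]
    exact Submodule.add_mem _ (Submodule.add_mem _ hφgV hvV) (bd_mem_sub hxV)
  have key' : gU + bd x ∈ sub (n + 1) {x : E | 1 / 2 < ‖x‖} := by
    refine Finsupp.supported_mono ?_ (mem_sub_preimage (S.injOn ())
      (Submodule.add_mem _ hgU (bd_mem_sub hx)) key)
    exact fun σ hσ t => (hΦV () _).1 (hσ t)
  have hfin : gU + gV + bd x ∈ relBoundaries (n + 1) (outside E) := by
    refine mem_relBoundaries_of_mem_sub (Submodule.add_mem _ hgc (bd_mem_relCycles x)) ?_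
    rw [add_right_comm]
    exact Submodule.add_mem _ key' hgV
  exact add_mem_cancel hfin (bd_mem_relBoundaries x)

/-- Excision, surjectivity: up to homology, relative cycles are sums of images of relative cycles
under the characteristic maps. -/
theorem exists_sum_push (S : CellAttach E Y ι) {z : Chain (n + 1) Y} (hz : z ∈ relCycles n S.A) :
    ∃ f : ι →₀ Chain (n + 1) E, (∀ i, f i ∈ relCycles n (outside E)) ∧
      z + f.sum (fun i c => push (S.Φ i) c) ∈ relBoundaries (n + 1) S.A := by
  classical
  obtain ⟨V, hV, hAV, hΦV⟩ := S.exists_collar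
  obtain ⟨H, hHA, hHΦ⟩ := S.exists_expansion
  let U : Option ι → Set Y := fun o => o.elim V S.cell
  have hUo : ∀ o, IsOpen (U o) := by
    rintro (_ | i)
    · exact hV
    · exact S.isOpen_cell i
  have hUc : ⋃ o, U o = Set.univ := by
    refine Set.eq_univ_of_forall fun y => ?_
    by_cases hy : y ∈ S.A
    · exact Set.mem_iUnion.2 ⟨none, hAV hy⟩
    · obtain ⟨i, x, hx, rfl⟩ := S.cover y hy
      exact Set.mem_iUnion.2 ⟨some i, x, hx, rfl⟩
  obtain ⟨z', hz', hzz⟩ := exists_small_relCycle hUo hUc hz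
  have hzc : z' ∈ relCycles n S.A := add_mem_cancel (relBoundaries_le_relCycles hzz) hz
  obtain ⟨f, hf, hfz⟩ := (Submodule.mem_iSup_iff_exists_finsupp _ _).1 (small_le_iSup _ hz')
  rw [Finsupp.sum_option_index _ _ (fun _ => rfl) (fun _ _ _ => rfl), Finsupp.sum] at hfz
  set s := f.some.support
  choose y hy hyf using fun i => S.exists_lift (hf (some i))
  have hy0 : ∀ i, y i ≠ 0 → i ∈ s := fun i hi => by
    rw [Finsupp.mem_support_iff, Finsupp.some_apply, ← hyf]
    exact fun h => hi (push_injOn (S.injOn i) (hy i) h)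
  -- Outside `V` the boundaries of the parts in different cells share no simplex and cannot cancel
  -- each other, while the boundary of the whole chain lies in `A ⊆ V`.
  have hbdV : ∀ i, bd (f (some i)) ∈ sub n V := by
    intro i
    rw [Finsupp.mem_supported]
    intro τ hτ t
    by_contra ht
    have hτ' := Finsupp.mem_support_iff.1 (Finset.mem_coe.1 hτ)
    have hout {c : Chain n Y} {B : Set Y} (hc : c ∈ sub n B) (htB : τ t ∉ B) : c τ = 0 := by
      by_contra h0
      exact htB (hc (Finset.mem_coe.2 (Finsupp.mem_support_iff.2 h0)) t)
    have hti : τ t ∈ S.cell i := bd_mem_sub (hf (some i)) hτ t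
    have e := DFunLike.congr_fun (congrArg bd hfz) τ
    rw [map_add, map_sum, Finsupp.add_apply, Finsupp.finsetSum_apply,
      hout (bd_mem_sub (hf none)) ht, zero_add, hout (sub_mono hAV hzc) ht,
      Finset.sum_eq_single i] at e
    · exact hτ' e
    · intro j _ hj
      refine hout (bd_mem_sub (hf (some j))) fun htj => hj ?_
      obtain ⟨x, hx, e⟩ := hti
      rw [← e] at htj
      exact (S.apply_mem_cell_iff.1 htj).1.symm
    · intro hi
      have : f (some i) = 0 := by
        simpa [s, Finsupp.mem_support_iff] using hi
      rw [Finsupp.some_apply, this, map_zero]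
      rfl
  -- The lifts have their boundaries in the collar; doubling turns them into relative cycles.
  let F : ι →₀ Chain (n + 1) E := Finsupp.onFinset s (fun i => push (double E) (y i)) fun i hi =>
    hy0 i fun h => hi (by rw [h, map_zero])
  have hFs : F.sum (fun i c => push (S.Φ i) c) = ∑ i ∈ s, push (S.Φ i) (push (double E) (y i)) :=
    Finsupp.onFinset_sum _ fun _ => map_zero _
  refine ⟨F, fun i => ?_, ?_⟩
  · change bd (push (double E) (y i)) ∈ sub n (outside E)
    rw [bd_push]
    have h1 : push (S.Φ i) (bd (y i)) ∈ sub n V := by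
      rw [← bd_push, hyf]
      exact hbdV i
    refine push_mem_sub _ (fun x hx => double_mem ?_)
      (mem_sub_preimage (S.injOn i) (bd_mem_sub (hy i)) h1)
    exact (hΦV i x).1 hx
  -- At time one the expansion is `double` on each cell and carries `V` into `A`, so it makes the
  -- part `f none` trivial and turns the other parts into `F`.
  · have hhom := add_mem_relBoundaries_of_homotopy H (B := S.A)
      (fun x hx s => by rw [hHA x hx]; exact hx) hzc
    set ρ := H.comp ((ContinuousMap.id _).prodMk (ContinuousMap.const _ 1)) with hρ
    have e0 : H.comp ((ContinuousMap.id _).prodMk (ContinuousMap.const _ 0)) =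
        ContinuousMap.id _ := by
      ext1 y
      change H (y, 0) = y
      by_cases hy : y ∈ S.A
      · exact hHA y hy 0
      · obtain ⟨i, x, hx, rfl⟩ := S.cover y hy
        rw [hHΦ]
        simp
    have hρΦ : ∀ i, ρ.comp (S.Φ i) = (S.Φ i).comp (double E) := by
      intro i
      ext1 x
      change H (S.Φ i x, 1) = S.Φ i ((2 : ℝ) • x)
      rw [hHΦ]
      simp [one_add_one_eq_two]
    have hρV : ∀ y ∈ V, ρ y ∈ S.A := by
      intro y hyV
      by_cases hy : y ∈ S.A
      · change H (y, 1) ∈ S.A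
        rwa [hHA y hy]
      · obtain ⟨i, x, hx, rfl⟩ := S.cover y hy
        have := DFunLike.congr_fun (hρΦ i) x
        change ρ (S.Φ i x) = S.Φ i (double E x) at this
        rw [this]
        exact S.mem _ _ (double_mem ((hΦV i x).1 hyV))
    rw [e0, push_id] at hhom
    have e1 : push ρ z' = push ρ (f none) + F.sum (fun i c => push (S.Φ i) c) := by
      rw [hFs, ← hfz, map_add, map_sum]
      congr 1
      refine Finset.sum_congr rfl fun i _ => ?_
      rw [Finsupp.some_apply, ← hyf, push_push, push_push, hρΦ]
    rw [e1] at hhom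
    have h3 : push ρ (f none) ∈ relBoundaries (n + 1) S.A :=
      sub_le_relBoundaries (push_mem_sub ρ hρV (hf none))
    have := Submodule.add_mem _ (Submodule.add_mem _ hhom hzz) h3
    rw [show push ρ (f none) + F.sum (fun i c => push (S.Φ i) c) + z' + (z' + z) + push ρ (f none) =
      (z + F.sum (fun i c => push (S.Φ i) c)) + (z' + z') + (push ρ (f none) + push ρ (f none))
        by abel, ZModModule.add_self, ZModModule.add_self, add_zero, add_zero] at this
    exact this

/-- The relative homology of a pair obtained by attaching one `m`-cell has at most one nonzero
element in degree `m`. -/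
theorem atMostOneClass {m : ℕ} (S : CellAttach (Fin m → ℝ) Y Unit) :
    AtMostOneClass (relCycles m S.A) (relBoundaries (m + 1) S.A) := by
  have key : ∀ z ∈ relCycles m S.A, ∃ g ∈ relCycles m (outside (Fin m → ℝ)),
      z + push (S.Φ ()) g ∈ relBoundaries (m + 1) S.A := by
    intro z hz
    obtain ⟨f, hf, h⟩ := S.exists_sum_push hz
    refine ⟨f (), hf (), ?_⟩
    rwa [Finsupp.sum_fintype _ _ (fun _ => map_zero _), Finset.univ_unique,
      Finset.sum_singleton] at h
  have hΦ : ∀ x ∈ outside (Fin m → ℝ), S.Φ () x ∈ S.A := fun x hx => S.mem () x hx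
  intro a ha b hb
  obtain ⟨g, hg, h⟩ := key a ha
  obtain ⟨g', hg', h'⟩ := key b hb
  rcases atMostOneClass_outside m g hg g' hg' with h0 | h0 | h0
  · exact Or.inl (add_mem_cancel h (push_mem_relBoundaries _ hΦ h0))
  · exact Or.inr (Or.inl (add_mem_cancel h' (push_mem_relBoundaries _ hΦ h0)))
  · refine Or.inr (Or.inr (add_mem_cancel ?_ (push_mem_relBoundaries _ hΦ h0)))
    rw [map_add, add_add_add_comm]
    exact Submodule.add_mem _ h h'

end CellAttach

end ModTwo
end

noncomputable section

namespace ModTwo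

/-! ### Comparison with the singular chain complex of Mathlib -/

section Comparison

open Simplicial HomologyCode

variable {Y Z : TopCat.{u}} {n : ℕ}

/-- The singular simplex given by a continuous map. -/
def toSimplex (σ : C(stdSimplex ℝ (Fin (n + 1)), Y)) : (TopCat.toSSet.obj Y) _⦋n⦌ :=
  (TopCat.toSSetObjEquiv Y (.op ⦋n⦌)).symm σ

/-- The inclusion of the summand of a singular simplex in the singular chain complex. -/
def simplexι (σ : C(stdSimplex ℝ (Fin (n + 1)), Y)) :
    ModuleCat.of (ZMod 2) (ULift.{u} (ZMod 2)) ⟶ (singularChains.obj Y).X n :=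
  (TopCat.toSSet.obj Y).ιChainComplex (toSimplex σ)

theorem simplexι_d (σ : C(stdSimplex ℝ (Fin (n + 2)), Y)) :
    simplexι σ ≫ (singularChains.obj Y).d (n + 1) n =
      ∑ i : Fin (n + 2), (-1) ^ i.val • simplexι (σ.comp (face i)) :=
  SSet.ιChainComplex_d _ _ (toSimplex σ)

theorem simplexι_map (f : Y ⟶ Z) (σ : C(stdSimplex ℝ (Fin (n + 1)), Y)) :
    simplexι σ ≫ (singularChains.map f).f n = simplexι (f.hom.comp σ) :=
  SSet.ι_chainComplexMap_f _ _ (TopCat.toSSet.map f) _ (toSimplex σ)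

theorem singularChains_hom_ext {M : ModuleCat.{u} (ZMod 2)}
    {f g : (singularChains.obj Y).X n ⟶ M} (h : ∀ σ, simplexι σ ≫ f = simplexι σ ≫ g) : f = g :=
  SSet.chainComplex_hom_ext fun x => by
    have := h (TopCat.toSSetObjEquiv Y (.op ⦋n⦌) x)
    rwa [simplexι, toSimplex, Equiv.symm_apply_apply] at this

theorem exists_desc {M : ModuleCat.{u} (ZMod 2)} (g : C(stdSimplex ℝ (Fin (n + 1)), Y) →
    (ModuleCat.of (ZMod 2) (ULift.{u} (ZMod 2)) ⟶ M)) :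
    ∃ f : (singularChains.obj Y).X n ⟶ M, ∀ σ, simplexι σ ≫ f = g σ :=
  ⟨Cofan.IsColimit.desc ((TopCat.toSSet.obj Y).isColimitChainComplexXCofan _ n)
      fun x => g (TopCat.toSSetObjEquiv Y (.op ⦋n⦌) x), fun σ => by
    refine (Cofan.IsColimit.fac ((TopCat.toSSet.obj Y).isColimitChainComplexXCofan _ n) _ _).trans ?_
    rw [toSimplex, Equiv.apply_symm_apply]⟩

/-- The basis element of the singular chain complex given by a singular simplex. -/
def gen (σ : C(stdSimplex ℝ (Fin (n + 1)), Y)) : (singularChains.obj Y).X n :=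
  (simplexι σ).hom ⟨1⟩

/-- The comparison map from singular chains modulo 2 to the singular chain complex. -/
def compare (Y : TopCat.{u}) (n : ℕ) : Chain (n + 1) Y →ₗ[ZMod 2] (singularChains.obj Y).X n :=
  Finsupp.lsum (ZMod 2) fun σ => LinearMap.toSpanSingleton (ZMod 2) _ (gen σ)

theorem compare_single (σ : C(stdSimplex ℝ (Fin (n + 1)), Y)) :
    compare Y n (Finsupp.single σ 1) = gen σ := by
  simp [compare]

theorem d_compare (c : Chain (n + 2) Y) :
    (singularChains.obj Y).d (n + 1) n (compare Y (n + 1) c) = compare Y n (bd c) := by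
  refine linearMap_ext (f := ((singularChains.obj Y).d (n + 1) n).hom ∘ₗ compare Y (n + 1))
    (g := compare Y n ∘ₗ bd) (fun σ => ?_) c
  rw [LinearMap.comp_apply, LinearMap.comp_apply, compare_single, bd_single, map_sum]
  refine (congrArg (fun f => f.hom (⟨1⟩ : ULift.{u} (ZMod 2))) (simplexι_d σ)).trans ?_
  change (ModuleCat.Hom.hom (∑ i : Fin (n + 2), (-1) ^ i.val • simplexι (σ.comp (face i)) :
    ModuleCat.of (ZMod 2) (ULift.{u} (ZMod 2)) ⟶ (singularChains.obj Y).X n)) _ = _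
  rw [ModuleCat.hom_sum, LinearMap.sum_apply]
  refine Finset.sum_congr rfl fun i _ => ?_
  rw [compare_single]
  rcases Nat.even_or_odd i.val with h | h
  · rw [h.neg_one_pow, one_smul]
    rfl
  · rw [h.neg_one_pow, neg_smul, one_smul, ModuleCat.hom_neg, LinearMap.neg_apply]
    exact ZModModule.neg_eq_self _

theorem map_compare (f : Y ⟶ Z) (c : Chain (n + 1) Y) :
    (singularChains.map f).f n (compare Y n c) = compare Z n (push f.hom c) := by
  refine linearMap_ext (f := ((singularChains.map f).f n).hom ∘ₗ compare Y n)
    (g := compare Z n ∘ₗ push f.hom) (fun σ => ?_) c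
  rw [LinearMap.comp_apply, LinearMap.comp_apply, compare_single, push_single, compare_single]
  exact congrArg (fun f => f.hom (⟨1⟩ : ULift.{u} (ZMod 2))) (simplexι_map f σ)

/-- The group of singular chains is a coproduct of copies of `ℤ/2` over the simplices; its universal
property supplies the inverse. -/
theorem compare_bijective : Function.Bijective (compare Y n) := by
  obtain ⟨F, hF⟩ := exists_desc (Y := Y) (n := n) (M := ModuleCat.of (ZMod 2) (Chain (n + 1) Y))
    fun σ => ModuleCat.ofHom (Finsupp.lsingle σ ∘ₗ ULift.moduleEquiv.toLinearMap)
  refine Function.bijective_iff_has_inverse.2 ⟨F.hom, fun c => ?_, fun x => ?_⟩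
  · refine linearMap_ext (f := F.hom ∘ₗ compare Y n) (g := LinearMap.id) (fun σ => ?_) c
    rw [LinearMap.comp_apply, compare_single]
    exact congrArg (fun f => f.hom (⟨1⟩ : ULift.{u} (ZMod 2))) (hF σ)
  · have : F ≫ ModuleCat.ofHom (compare Y n) = 𝟙 _ := by
      refine singularChains_hom_ext fun σ => ?_
      rw [reassoc_of% (hF σ), Category.comp_id]
      refine ModuleCat.hom_ext (LinearMap.ext fun a => ?_)
      change compare Y n (Finsupp.single σ a.down) = (simplexι σ).hom a
      have e : Finsupp.single σ a.down = a.down • Finsupp.single σ (1 : ZMod 2) := by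
        rw [Finsupp.smul_single, smul_eq_mul, mul_one]
      rw [e, map_smul, compare_single, gen, ← map_smul]
      congr 1
      exact ULift.ext _ _ (mul_one a.down)
    exact congrArg (fun f => f.hom x) this

end Comparison

/-! ### Homology of complexes of modules in terms of elements -/

section Homology

variable {R : Type*} [Ring R] (K : ChainComplex (ModuleCat.{u} R) ℕ) (n : ℕ)

theorem homologyπ_surjective : Function.Surjective (K.homologyπ n) :=
  (ModuleCat.epi_iff_surjective _).1 inferInstance

theorem iCycles_injective : Function.Injective (K.iCycles n) :=
  (ModuleCat.mono_iff_injective _).1 inferInstance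

variable {K n}

theorem exact_apply {S : ShortComplex (ModuleCat.{u} R)} (h : S.Exact) (x : S.X₂) :
    S.g x = 0 ↔ ∃ y, S.f y = x := by
  refine ⟨(ShortComplex.moduleCat_exact_iff _).1 h x, ?_⟩
  rintro ⟨y, rfl⟩
  exact S.moduleCat_zero_apply y

theorem homologyπ_eq_zero_iff (x : K.cycles n) :
    K.homologyπ n x = 0 ↔ ∃ y : K.X (n + 1), K.d (n + 1) n y = K.iCycles n x := by
  have h : (ShortComplex.mk _ _ (K.toCycles_comp_homologyπ (n + 1) n)).Exact :=
    ShortComplex.exact_of_g_is_cokernel _ (K.homologyIsCokernel (n + 1) n (by simp))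
  refine (exact_apply h x).trans (exists_congr fun y => ?_)
  rw [← (iCycles_injective K n).eq_iff]
  change K.iCycles n (K.toCycles (n + 1) n y) = _ ↔ _
  rw [← ConcreteCategory.comp_apply, HomologicalComplex.toCycles_i]

theorem exists_iCycles_eq {j : ℕ} (hj : (ComplexShape.down ℕ).next n = j) {x : K.X n}
    (hx : K.d n j x = 0) : ∃ z, K.iCycles n z = x := by
  have h : (ShortComplex.mk _ _ (K.iCycles_d n j)).Exact :=
    ShortComplex.exact_of_f_is_kernel _ (K.cyclesIsKernel n j hj)
  exact (exact_apply h x).1 hx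

end Homology

/-! ### Degrees in terms of explicit chains -/

section Degree

open HomologyCode

variable {A Y : TopCat.{u}} {n : ℕ}

theorem singularHomologyMap_eq_zero_iff (f : A ⟶ Y) {x : (singularChains.obj A).cycles n}
    {z : Chain (n + 1) A} (hz : (singularChains.obj A).iCycles n x = compare A n z) :
    singularHomologyMap f n ((singularChains.obj A).homologyπ n x) = 0 ↔
      ∃ w, bd w = push f.hom z := by
  rw [← ConcreteCategory.comp_apply, HomologicalComplex.homologyπ_naturality,
    ConcreteCategory.comp_apply, homologyπ_eq_zero_iff, ← ConcreteCategory.comp_apply,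
    HomologicalComplex.cyclesMap_i, ConcreteCategory.comp_apply, hz, map_compare]
  constructor
  · rintro ⟨y, hy⟩
    obtain ⟨w, rfl⟩ := compare_bijective.2 y
    rw [d_compare] at hy
    exact ⟨w, compare_bijective.1 hy⟩
  · rintro ⟨w, hw⟩
    exact ⟨compare _ _ w, by rw [d_compare, hw]⟩

theorem exact_relativeChains (i : A ⟶ Y) (n : ℕ) : (ShortComplex.mk ((singularChains.map i).f n)
    ((cokernel.π (singularChains.map i)).f n) (by
      rw [← HomologicalComplex.comp_f, cokernel.condition, HomologicalComplex.zero_f])).Exact :=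
  ((ShortComplex.exact_of_g_is_cokernel (ShortComplex.mk _ _
    (cokernel.condition (singularChains.map i))) (cokernelIsCokernel _))).map
      (HomologicalComplex.eval _ _ n)

theorem toRelativeHomology_eq_zero_iff (i : A ⟶ Y) {x : (singularChains.obj Y).cycles n}
    {z : Chain (n + 1) Y} (hz : (singularChains.obj Y).iCycles n x = compare Y n z) :
    toRelativeHomology i n ((singularChains.obj Y).homologyπ n x) = 0 ↔
      ∃ w v, bd w + push i.hom v = z := by
  have hsurj (n : ℕ) : Function.Surjective ((cokernel.π (singularChains.map i)).f n) :=
    (ModuleCat.epi_iff_surjective _).1 inferInstance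
  rw [← ConcreteCategory.comp_apply, HomologicalComplex.homologyπ_naturality,
    ConcreteCategory.comp_apply, homologyπ_eq_zero_iff, ← ConcreteCategory.comp_apply,
    HomologicalComplex.cyclesMap_i, ConcreteCategory.comp_apply, hz]
  have key (w : Chain (n + 2) Y) : (relativeChains i).d (n + 1) n
      ((cokernel.π (singularChains.map i)).f (n + 1) (compare Y (n + 1) w)) =
      (cokernel.π (singularChains.map i)).f n (compare Y n z) ↔ ∃ v, bd w + push i.hom v = z := by
    rw [← ConcreteCategory.comp_apply, HomologicalComplex.Hom.comm, ConcreteCategory.comp_apply,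
      d_compare, ← sub_eq_zero, ← map_sub, ← map_sub]
    refine (exact_apply (exact_relativeChains i n) _).trans ?_
    constructor
    · rintro ⟨y, hy⟩
      obtain ⟨v, rfl⟩ := compare_bijective.2 y
      change (singularChains.map i).f n _ = _ at hy
      rw [map_compare] at hy
      refine ⟨v, ?_⟩
      rw [compare_bijective.1 hy, ZModModule.sub_eq_add, ← add_assoc, ZModModule.add_self,
        zero_add]
    · rintro ⟨v, rfl⟩
      refine ⟨compare _ _ v, ?_⟩
      change (singularChains.map i).f n _ = _
      rw [map_compare, ZModModule.sub_eq_add, ← add_assoc, ZModModule.add_self, zero_add]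
  constructor
  · rintro ⟨y, hy⟩
    obtain ⟨y, rfl⟩ := hsurj _ y
    obtain ⟨w, rfl⟩ := compare_bijective.2 y
    exact ⟨w, (key w).1 hy⟩
  · rintro ⟨w, h⟩
    exact ⟨_, (key w).2 h⟩

theorem exists_cycle_eq {z : Chain (n + 1) Y} (hz : bd z = 0) :
    ∃ x, (singularChains.obj Y).iCycles n x = compare Y n z := by
  rcases n with _ | n
  -- In degree zero Mathlib's complex has no outgoing differential, while `bd z = 0` says that the
  -- augmentation vanishes.
  · refine exists_iCycles_eq (j := 0) (by simp) ?_
    rw [HomologicalComplex.shape _ _ _ (by simp)]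
    rfl
  · refine exists_iCycles_eq (j := n) (by simp) ?_
    rw [d_compare, hz, map_zero]

theorem push_val_injective (m : ℕ) {c : Chain n (diskBoundary.{u} m)}
    (h : push (diskBoundaryIncl.{u} m).hom c = 0) : c = 0 :=
  push_injOn (f := (diskBoundaryIncl.{u} m).hom) (A := Set.univ) (fun _ _ _ _ e => ULift.ext _ _ (Subtype.ext
    (congrArg (fun a : disk.{u} m => (a.down : Fin m → ℝ)) e))) (mem_sub_univ c) h

variable {X : Type u} [TopologicalSpace X] [T2Space X] {C : Set X} [CWComplex C]

/-- A degree is nonzero if and only if some reduced cycle on the sphere is mapped to a nonzero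
relative homology class. -/
theorem degreeMap_ne_zero_iff {m n : ℕ} (γ : RelCWComplex.cell C m) (β : RelCWComplex.cell C n) :
    degreeMap γ β ≠ 0 ↔ ∃ z : Chain (n + 1) (diskBoundary.{u} m),
      (∃ w, bd w = push (diskBoundaryIncl.{u} m).hom z) ∧
      ¬ ∃ w v, bd w + push (skelMinusIncl m β).hom v = push (attachingMap γ).hom z := by
  have hatt (x : (singularChains.obj (diskBoundary.{u} m)).cycles n)
      (z : Chain (n + 1) (diskBoundary.{u} m))
      (hz : (singularChains.obj _).iCycles n x = compare _ n z) :
      toRelativeHomology (skelMinusIncl m β) n (singularHomologyMap (attachingMap γ) n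
        ((singularChains.obj _).homologyπ n x)) = 0 ↔
      ∃ w v, bd w + push (skelMinusIncl m β).hom v = push (attachingMap γ).hom z := by
    have e : singularHomologyMap (attachingMap γ) n ((singularChains.obj _).homologyπ n x) =
        (singularChains.obj _).homologyπ n
          (HomologicalComplex.cyclesMap (singularChains.map (attachingMap γ)) n x) := by
      rw [← ConcreteCategory.comp_apply, HomologicalComplex.homologyπ_naturality,
        ConcreteCategory.comp_apply]
    rw [e]
    refine toRelativeHomology_eq_zero_iff _ ?_
    rw [← ConcreteCategory.comp_apply, HomologicalComplex.cyclesMap_i, ConcreteCategory.comp_apply,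
      hz, map_compare]
  have hker : (ShortComplex.mk _ _ (kernel.condition
      (singularHomologyMap (diskBoundaryIncl.{u} m) n))).Exact :=
    ShortComplex.exact_of_f_is_kernel _ (kernelIsKernel _)
  constructor
  · intro h
    by_contra hcon
    push Not at hcon
    refine h (ModuleCat.hom_ext (LinearMap.ext fun a => ?_))
    have ha : singularHomologyMap (diskBoundaryIncl.{u} m) n
        (kernel.ι (singularHomologyMap (diskBoundaryIncl.{u} m) n) a) = 0 :=
      (exact_apply hker _).2 ⟨a, rfl⟩
    obtain ⟨x, hx⟩ := homologyπ_surjective _ _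
      (kernel.ι (singularHomologyMap (diskBoundaryIncl.{u} m) n) a)
    obtain ⟨z, hz⟩ := compare_bijective.2 ((singularChains.obj _).iCycles n x)
    rw [← hx, singularHomologyMap_eq_zero_iff _ hz.symm] at ha
    obtain ⟨w, hw⟩ := ha
    have := (hatt x z hz.symm).2 (hcon z ⟨w, hw⟩)
    rw [hx] at this
    exact this
  · rintro ⟨z, hz, hz'⟩ h
    -- A chain on the sphere which bounds in the disk is a cycle, because the inclusion is injective
    -- on chains.
    obtain ⟨x, hx⟩ := exists_cycle_eq (z := z) (push_val_injective m (by
      obtain ⟨w, hw⟩ := hz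
      rw [← bd_push, ← hw, bd_bd]))
    obtain ⟨a, ha⟩ := (exact_apply hker ((singularChains.obj _).homologyπ n x)).1
      ((singularHomologyMap_eq_zero_iff _ hx).2 hz)
    refine hz' ((hatt x z hx).1 ?_)
    change kernel.ι (singularHomologyMap (diskBoundaryIncl.{u} m) n) a = _ at ha
    rw [← ha]
    exact congrArg (fun f => f.hom a) h

end Degree

end ModTwo
end

noncomputable section

namespace ModTwo

/-! ### The skeleta of a CW complex -/

section Shrink

variable {E : Type*} [NormedAddCommGroup E] [NormedSpace ℝ E]

/-- The radial retraction onto the closed unit ball. -/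
def shrink : C(E, E) where
  toFun x := (max 1 ‖x‖)⁻¹ • x
  continuous_toFun := by
    refine Continuous.smul (Continuous.inv₀ (by fun_prop) fun x => ?_) continuous_id
    exact (lt_max_of_lt_left one_pos).ne'

theorem shrink_of_le {x : E} (h : ‖x‖ ≤ 1) : shrink x = x := by
  change (max 1 ‖x‖)⁻¹ • x = x
  rw [max_eq_left h, inv_one, one_smul]

theorem norm_shrink_of_le {x : E} (h : 1 ≤ ‖x‖) : ‖shrink x‖ = 1 := by
  change ‖(max 1 ‖x‖)⁻¹ • x‖ = 1
  rw [max_eq_right h, norm_smul, norm_inv, norm_norm, inv_mul_cancel₀ (by positivity)]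

theorem norm_shrink_le (x : E) : ‖shrink x‖ ≤ 1 := by
  rcases le_total ‖x‖ 1 with h | h
  · rwa [shrink_of_le h]
  · exact (norm_shrink_of_le h).le

theorem shrink_smul {x : E} {t : ℝ} (h : 1 ≤ ‖x‖) (ht : 1 ≤ t) : shrink (t • x) = shrink x := by
  change (max 1 ‖t • x‖)⁻¹ • t • x = (max 1 ‖x‖)⁻¹ • x
  have ht' : 0 < t := one_pos.trans_le ht
  have e : ‖t • x‖ = t * ‖x‖ := by rw [norm_smul, Real.norm_of_nonneg ht'.le]
  rw [e, max_eq_right h, max_eq_right (one_le_mul_of_one_le_of_one_le ht h), smul_smul, mul_inv,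
    mul_right_comm, inv_mul_cancel₀ ht'.ne', one_mul]

end Shrink

section Skeleton

open HomologyCode

variable {X : Type u} [TopologicalSpace X] [T2Space X] {C : Set X} [CWComplex C]

theorem closedCell_subset_skel {k : ℕ} (β : RelCWComplex.cell C k) :
    RelCWComplex.closedCell k β ⊆ (RelCWComplex.skeletonLT C ((k + 1 : ℕ) : ℕ∞) : Set X) := by
  rw [Nat.cast_succ]
  exact RelCWComplex.closedCell_subset_skeletonLT k β

/-- The characteristic map of a `k`-cell, precomposed with the retraction onto the ball. -/
def charMap {k : ℕ} (β : RelCWComplex.cell C k) : C(Fin k → ℝ, skel C (k + 1)) where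
  toFun x := ⟨RelCWComplex.map k β (shrink x), closedCell_subset_skel β
    ⟨shrink x, mem_closedBall_zero_iff.2 (norm_shrink_le x), rfl⟩⟩
  continuous_toFun := ((RelCWComplex.continuousOn k β).comp_continuous shrink.continuous
    fun x => mem_closedBall_zero_iff.2 (norm_shrink_le x)).subtype_mk _

theorem coe_charMap {k : ℕ} (β : RelCWComplex.cell C k) (x : Fin k → ℝ) :
    (charMap β x : X) = RelCWComplex.map k β (shrink x) := rfl

theorem charMap_mem_openCell {k : ℕ} (β : RelCWComplex.cell C k) {x : Fin k → ℝ} (hx : ‖x‖ < 1) :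
    (charMap β x : X) ∈ RelCWComplex.openCell k β :=
  ⟨x, mem_ball_zero_iff.2 hx, by rw [coe_charMap, shrink_of_le hx.le]⟩

omit [T2Space X] in
theorem openCell_eq_of_mem {m n : ℕ} {α : RelCWComplex.cell C m} {β : RelCWComplex.cell C n} {y : X}
    (h : y ∈ RelCWComplex.openCell m α) (h' : y ∈ RelCWComplex.openCell n β) :
    (⟨m, α⟩ : Σ l, RelCWComplex.cell C l) = ⟨n, β⟩ :=
  RelCWComplex.eq_of_not_disjoint_openCell (Set.not_disjoint_iff.2 ⟨y, h, h'⟩)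

variable (C)

theorem isClosed_skeletonLT (n : ℕ∞) : IsClosed (RelCWComplex.skeletonLT C n : Set X) :=
  RelCWComplex.Subcomplex.closed _

/-- Closedness is tested on closed cells: those of dimension below `k` lie in the smaller skeleton,
the `k`-cells are tested through `charMap`, and higher open cells are disjoint from the skeleton. -/
theorem isClosed_of_charMap {k : ℕ} (F : Set (skel C (k + 1)))
    (h : IsClosed (F ∩ {y | y.1 ∈ RelCWComplex.skeletonLT C (k : ℕ∞)}))
    (hF : ∀ β : RelCWComplex.cell C k, IsClosed (charMap β ⁻¹' F)) : IsClosed F := by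
  have hemb := (isClosed_skeletonLT C ((k + 1 : ℕ) : ℕ∞)).isClosedEmbedding_subtypeVal
  rw [hemb.isClosed_iff_image_isClosed] at h ⊢
  refine CWComplex.isClosed_of_disjoint_openCell_or_isClosed_inter_closedCell (C := C)
    ?_ fun n _ j => ?_
  · rintro _ ⟨y, -, rfl⟩
    exact (RelCWComplex.skeletonLT C _).subset_complex y.2
  · rcases lt_trichotomy n k with hn | rfl | hn
    · right
      convert h.inter (RelCWComplex.isClosed_closedCell (n := n) (i := j)) using 1
      ext x
      constructor
      · rintro ⟨⟨y, hy, rfl⟩, hx⟩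
        refine ⟨⟨y, ⟨hy, ?_⟩, rfl⟩, hx⟩
        exact RelCWComplex.skeletonLT_mono (by exact_mod_cast hn) (closedCell_subset_skel j hx)
      · rintro ⟨⟨y, hy, rfl⟩, hx⟩
        exact ⟨⟨y, hy.1, rfl⟩, hx⟩
    · right
      -- `F` meets the closed cell in the image of this compact set.
      have hc : IsCompact (Metric.closedBall (0 : Fin n → ℝ) 1 ∩ charMap j ⁻¹' F) :=
        (isCompact_closedBall _ _).inter_right (hF j)
      convert (hc.image_of_continuousOn
        ((RelCWComplex.continuousOn n j).mono Set.inter_subset_left)).isClosed using 1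
      ext x
      constructor
      · rintro ⟨⟨y, hy, rfl⟩, x, hx, e⟩
        refine ⟨x, ⟨hx, ?_⟩, e⟩
        have e' : charMap j x = y :=
          Subtype.ext (by rw [coe_charMap, shrink_of_le (mem_closedBall_zero_iff.1 hx), e])
        rwa [Set.mem_preimage, e']
      · rintro ⟨x, ⟨hx, hxF⟩, rfl⟩
        refine ⟨⟨charMap j x, hxF, ?_⟩, x, hx, rfl⟩
        rw [coe_charMap, shrink_of_le (mem_closedBall_zero_iff.1 hx)]
    · left
      refine Set.disjoint_left.2 ?_
      rintro _ ⟨y, -, rfl⟩ hy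
      exact Set.disjoint_left.1 (RelCWComplex.disjoint_skeletonLT_openCell
        (by exact_mod_cast hn)) y.2 hy

/-- The `k`-skeleton arises from the `(k - 1)`-skeleton by attaching the `k`-cells. -/
def cwAttach (k : ℕ) : CellAttach (Fin k → ℝ) (skel C (k + 1)) (RelCWComplex.cell C k) where
  A := {y | y.1 ∈ RelCWComplex.skeletonLT C (k : ℕ∞)}
  Φ := charMap
  mem β x hx := CWComplex.cellFrontier_subset_skeletonLT k β
    ⟨shrink x, mem_sphere_zero_iff_norm.2 (norm_shrink_of_le hx), rfl⟩
  notMem β x hx h := Set.disjoint_left.1 (RelCWComplex.disjoint_skeletonLT_openCell le_rfl) h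
    (charMap_mem_openCell β hx)
  inj β β' x y hx hy e := by
    have h := openCell_eq_of_mem (charMap_mem_openCell β hx)
      (e ▸ charMap_mem_openCell β' hy)
    cases h
    refine ⟨rfl, (RelCWComplex.map k β).injOn ?_ ?_ ?_⟩
    · rw [RelCWComplex.source_eq]
      exact mem_ball_zero_iff.2 hx
    · rw [RelCWComplex.source_eq]
      exact mem_ball_zero_iff.2 hy
    · have := congrArg Subtype.val e
      rwa [coe_charMap, coe_charMap, shrink_of_le hx.le, shrink_of_le hy.le] at this
  cover := by
    intro y hy
    obtain ⟨m, hm, β, x, hx, e⟩ := CWComplex.mem_skeletonLT_iff.1 y.2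
    have hm' : m < k + 1 := by exact_mod_cast hm
    rcases (Nat.lt_succ_iff.1 hm').lt_or_eq with h | rfl
    · exact absurd (CWComplex.mem_skeletonLT_iff.2
        ⟨m, by exact_mod_cast h, β, x, hx, e⟩) hy
    · refine ⟨β, x, mem_ball_zero_iff.1 hx, Subtype.ext ?_⟩
      rw [coe_charMap, shrink_of_le (mem_ball_zero_iff.1 hx).le, e]
  radial β x t hx ht := Subtype.ext (by rw [coe_charMap, coe_charMap, shrink_smul hx ht])
  inv β y := (RelCWComplex.map k β).symm y.1
  continuousOn_inv β := by
    refine (RelCWComplex.continuousOn_symm k β).comp continuous_subtype_val.continuousOn ?_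
    rintro _ ⟨x, hx, rfl⟩
    rw [coe_charMap, shrink_of_le (le_of_lt hx)]
    refine (RelCWComplex.map k β).map_source ?_
    rw [RelCWComplex.source_eq]
    exact mem_ball_zero_iff.2 hx
  inv_apply β x hx := by
    rw [coe_charMap, shrink_of_le hx.le]
    refine (RelCWComplex.map k β).left_inv ?_
    rw [RelCWComplex.source_eq]
    exact mem_ball_zero_iff.2 hx
  isClosed := (isClosed_skeletonLT C _).preimage continuous_subtype_val
  weak := isClosed_of_charMap C

variable {C}

theorem cwAttach_cell {k : ℕ} (β : RelCWComplex.cell C k) :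
    (cwAttach C k).cell β = {y | y.1 ∈ RelCWComplex.openCell k β} := by
  ext y
  constructor
  · rintro ⟨x, hx, rfl⟩
    exact charMap_mem_openCell β hx
  · rintro ⟨x, hx, e⟩
    have hx' := mem_ball_zero_iff.1 hx
    exact ⟨x, hx', Subtype.ext (by rw [← e]; exact congrArg _ (shrink_of_le hx'.le))⟩

/-- The attaching map of an `m`-cell, on the complement of the open unit ball. -/
def attachOutside {m : ℕ} (γ : RelCWComplex.cell C m) : C(outside (Fin m → ℝ), skel C m) where
  toFun x := ⟨RelCWComplex.map m γ (shrink x.1), CWComplex.cellFrontier_subset_skeletonLT m γ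
    ⟨shrink x.1, mem_sphere_zero_iff_norm.2 (norm_shrink_of_le x.2), rfl⟩⟩
  continuous_toFun := ((RelCWComplex.continuousOn m γ).comp_continuous
    (shrink.continuous.comp continuous_subtype_val)
    fun x => mem_closedBall_zero_iff.2 (norm_shrink_le x.1)).subtype_mk _

/-- The inclusion of a skeleton in the next one. -/
def skelStep (C : Set X) [CWComplex C] (k : ℕ) : C(skel C k, skel C (k + 1)) :=
  ⟨Set.inclusion (RelCWComplex.skeletonLT_mono (by exact_mod_cast k.le_succ)),
    continuous_inclusion _⟩

/-- The complement of an open `k`-cell in the `k`-skeleton or a lower one. -/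
abbrev skelCompl (m : ℕ) {n : ℕ} (β : RelCWComplex.cell C n) : Set (skel C m) :=
  {y | y.1 ∉ RelCWComplex.openCell n β}

theorem push_skelMinusIncl_iff {m n : ℕ} (β : RelCWComplex.cell C n)
    (c : Chain (n + 1) (skel C m)) :
    (∃ w v, bd w + push (skelMinusIncl m β).hom v = c) ↔
      c ∈ relBoundaries (n + 1) (skelCompl m β) := by
  rw [mem_relBoundaries]
  refine exists_congr fun w => ⟨?_, ?_⟩
  · rintro ⟨v, hv⟩
    exact ⟨_, push_mem_sub (A := Set.univ) _ (fun x _ => x.2.2) (mem_sub_univ v), hv⟩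
  · rintro ⟨v, hv, e⟩
    obtain ⟨v', rfl⟩ := exists_push_incl_eq hv
    let f : C(skelCompl m β, skelMinus m β) :=
      ⟨fun x => ⟨x.1.1, x.1.2, x.2⟩, by fun_prop⟩
    refine ⟨push f v', ?_⟩
    rw [push_push]
    exact e

/-- The degree of an attaching map can be read off from any chain in the complement of the open
unit ball. -/
theorem degreeMap_ne_zero_iff_outside {m n : ℕ} (γ : RelCWComplex.cell C m)
    (β : RelCWComplex.cell C n) :
    degreeMap γ β ≠ 0 ↔ ∃ s : Chain (n + 1) (outside (Fin m → ℝ)),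
      (∃ g, bd g = push (incl _) s) ∧
      push (attachOutside γ) s ∉ relBoundaries (n + 1) (skelCompl m β) := by
  rw [degreeMap_ne_zero_iff]
  constructor
  · rintro ⟨z, ⟨w, hw⟩, hz⟩
    -- Here the sphere and the disk are included in the exterior and in the whole space; the
    -- converse uses the retraction `shrink`.
    let i : C(diskBoundary.{u} m, outside (Fin m → ℝ)) :=
      ⟨fun x => ⟨x.down.1, (mem_sphere_zero_iff_norm.1 x.down.2).ge⟩,
        (continuous_subtype_val.comp continuous_uliftDown).subtype_mk _⟩
    let j : C(disk.{u} m, Fin m → ℝ) :=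
      ⟨fun x => x.down.1, continuous_subtype_val.comp continuous_uliftDown⟩
    refine ⟨push i z, ⟨push j w, ?_⟩, ?_⟩
    · rw [bd_push, hw, push_push, push_push]
      rfl
    · have e : (attachOutside γ).comp i = (attachingMap γ).hom := by
        ext x
        exact congrArg (RelCWComplex.map m γ)
          (shrink_of_le (mem_sphere_zero_iff_norm.1 x.down.2).le)
      rw [push_push, e]
      exact fun h => hz ((push_skelMinusIncl_iff β _).2 h)
  · rintro ⟨s, ⟨g, hg⟩, hs⟩
    let i : C(outside (Fin m → ℝ), diskBoundary.{u} m) :=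
      ⟨fun x => ⟨⟨shrink x.1, mem_sphere_zero_iff_norm.2 (norm_shrink_of_le x.2)⟩⟩,
        continuous_uliftUp.comp ((shrink.continuous.comp continuous_subtype_val).subtype_mk _)⟩
    let j : C(Fin m → ℝ, disk.{u} m) :=
      ⟨fun x => ⟨⟨shrink x, mem_closedBall_zero_iff.2 (norm_shrink_le x)⟩⟩,
        continuous_uliftUp.comp (shrink.continuous.subtype_mk _)⟩
    refine ⟨push i s, ⟨push j g, ?_⟩, ?_⟩
    · rw [bd_push, hg, push_push, push_push]
      rfl
    · rw [push_push]
      exact fun h => hs ((push_skelMinusIncl_iff β _).1 h)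

end Skeleton

end ModTwo
end

noncomputable section

namespace ModTwo

/-! ### The square of the cellular boundary map -/

/-! ### Parity in a quotient with at most one nonzero class -/

section Parity

variable {M : Type*} [AddCommGroup M] [Module (ZMod 2) M] {Z B : Submodule (ZMod 2) M}

theorem add_mem_iff_right {a b : M} (ha : a ∈ B) : a + b ∈ B ↔ b ∈ B :=
  ⟨fun h => add_mem_cancel_left h ha, B.add_mem ha⟩

theorem mem_iff_of_add_mem {a b : M} (h : a + b ∈ B) : a ∈ B ↔ b ∈ B :=
  ⟨add_mem_cancel_left h, add_mem_cancel h⟩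

open Classical in
/-- If `Z / B` has at most one nonzero element, then a sum of elements of `Z` is in `B` if and only
if the number of summands outside of `B` is even. -/
theorem AtMostOneClass.sum_mem_iff (h : AtMostOneClass Z B) {ι : Type*} (s : Finset ι) (t : ι → M)
    (ht : ∀ i ∈ s, t i ∈ Z) : ∑ i ∈ s, t i ∈ B ↔ Even (s.filter fun i => t i ∉ B).card := by
  induction s using Finset.induction_on with
  | empty => simp
  | insert a s ha ih =>
    have ih' := ih fun i hi => ht i (Finset.mem_insert_of_mem hi)
    rw [Finset.sum_insert ha, Finset.filter_insert]
    by_cases hB : t a ∈ B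
    · rw [if_neg (not_not.2 hB), add_mem_iff_right hB, ih']
    · rw [if_pos hB, Finset.card_insert_of_notMem fun h => ha (Finset.mem_filter.1 h).1,
        Nat.even_add_one, ← ih']
      -- Two elements of `Z` outside `B` are congruent modulo `B`, so their sum lies in `B`.
      refine ⟨fun h1 h2 => hB (add_mem_cancel h1 h2), fun h1 => ?_⟩
      exact ((h _ (ht a (Finset.mem_insert_self a s)) _ (Z.sum_mem fun i hi =>
        ht i (Finset.mem_insert_of_mem hi))).resolve_left hB).resolve_left h1

end Parity

section Outside

variable {E : Type*} [NormedAddCommGroup E] {n : ℕ}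

theorem bd_eq_zero_of_bounding {A : Set E} {s : Chain (n + 1) A} {g : Chain (n + 2) E}
    (h : bd g = push (incl A) s) : bd s = 0 :=
  push_incl_injective A (by rw [← bd_push, ← h, bd_bd])

theorem bounding_mem_relCycles {A : Set E} {s : Chain n A} {g : Chain (n + 1) E}
    (h : bd g = push (incl A) s) : g ∈ relCycles n A := by
  rw [relCycles, Submodule.mem_comap, h]
  exact push_incl_mem A s

/-- The connecting homomorphism is well defined: a trivial relative class has a boundary that bounds
in `A`. -/
theorem exists_bd_eq_of_bounding {A : Set E} {s : Chain n A} {g : Chain (n + 1) E}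
    (h : bd g = push (incl A) s) (hg : g ∈ relBoundaries (n + 1) A) : ∃ v, bd v = s := by
  obtain ⟨w, v, hv, rfl⟩ := mem_relBoundaries.1 hg
  obtain ⟨v, rfl⟩ := exists_push_incl_eq hv
  refine ⟨v, ?_⟩
  rw [map_add, bd_bd, zero_add, bd_push, ← sub_eq_zero, ← map_sub] at h
  exact sub_eq_zero.1 (push_incl_injective A h)

end Outside

namespace CellAttach

variable {E : Type*} [NormedAddCommGroup E] [NormedSpace ℝ E] {Y : Type*} [TopologicalSpace Y]
  {ι : Type*} {n : ℕ}

/-- A relative cycle which is homologous to a sum of cells vanishes near one of the cells if and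
only if the corresponding summand does. -/
theorem mem_relBoundaries_iff (S : CellAttach E Y ι) {z : Chain (n + 1) Y}
    {f : ι →₀ Chain (n + 1) E} (hf : ∀ i, f i ∈ relCycles n (outside E))
    (h : z + f.sum (fun i c => push (S.Φ i) c) ∈ relBoundaries (n + 1) S.A) (i : ι) :
    z ∈ relBoundaries (n + 1) (S.cell i)ᶜ ↔ f i ∈ relBoundaries (n + 1) (outside E) := by
  classical
  have hsub : S.A ⊆ (S.cell i)ᶜ := fun y hy hi => S.cell_disjoint_base hi hy
  have hsum : f.sum (fun i c => push (S.Φ i) c) + push (S.Φ i) (f i) ∈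
      relBoundaries (n + 1) (S.cell i)ᶜ := by
    have hi : f.sum (fun i c => push (S.Φ i) c) =
        push (S.Φ i) (f i) + (f.erase i).sum (fun i c => push (S.Φ i) c) := by
      by_cases hi : i ∈ f.support
      · exact (Finsupp.add_sum_erase f i _ hi).symm
      · rw [Finsupp.erase_of_notMem_support hi, Finsupp.notMem_support_iff.1 hi, map_zero, zero_add]
    rw [hi, add_right_comm, ZModModule.add_self, zero_add]
    -- The characteristic maps of all other cells miss the open cell `i`.
    refine Submodule.sum_mem _ fun j hj => sub_le_relBoundaries ?_
    refine push_mem_sub (A := Set.univ) _ (fun x _ hx => ?_) (mem_sub_univ _)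
    rw [apply_mem_cell_iff] at hx
    rw [hx.1, Finsupp.mem_support_iff, Finsupp.erase_same] at hj
    exact hj rfl
  rw [mem_iff_of_add_mem (relBoundaries_mono hsub h), mem_iff_of_add_mem hsum]
  -- Excision for `Y` as the complement of the cell `i` with this one cell attached.
  refine ⟨(S.single i).mem_relBoundaries_of_push (hf i), push_mem_relBoundaries _ fun x hx => ?_⟩
  exact hsub (S.mem i x hx)

end CellAttach

section Cellular

open HomologyCode

variable {X : Type u} [TopologicalSpace X] [T2Space X] {C : Set X} [CWComplex C]

/-- The degree of an attaching map can be read off from the boundary of a nontrivial relative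
cycle. -/
theorem degreeMap_ne_zero_iff_of_notMem {n : ℕ} (γ : RelCWComplex.cell C (n + 1))
    (β : RelCWComplex.cell C n) {s : Chain (n + 1) (outside (Fin (n + 1) → ℝ))}
    {g : Chain (n + 2) (Fin (n + 1) → ℝ)} (h : bd g = push (incl _) s)
    (hg : g ∉ relBoundaries (n + 2) (outside (Fin (n + 1) → ℝ))) :
    degreeMap γ β ≠ 0 ↔
      push (attachOutside γ) s ∉ relBoundaries (n + 1) (skelCompl (n + 1) β) := by
  rw [degreeMap_ne_zero_iff_outside]
  refine ⟨?_, fun hs => ⟨s, ⟨g, h⟩, hs⟩⟩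
  rintro ⟨s', ⟨g', h'⟩, hs'⟩ hs
  have hbd {c : Chain (n + 1) (outside (Fin (n + 1) → ℝ))} (hc : ∃ v, bd v = c) :
      push (attachOutside γ) c ∈ relBoundaries (n + 1) (skelCompl (n + 1) β) := by
    obtain ⟨v, rfl⟩ := hc
    rw [← bd_push]
    exact bd_mem_relBoundaries _
  -- All nontrivial relative cycles of the ball are homologous, so a single one detects the degree.
  rcases atMostOneClass_outside (n + 1) g (bounding_mem_relCycles h) g'
    (bounding_mem_relCycles h') with h1 | h1 | h1
  · exact hg h1
  · exact hs' (hbd (exists_bd_eq_of_bounding h' h1))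
  · have := hbd (exists_bd_eq_of_bounding (s := s + s') (by rw [map_add, map_add, h, h']) h1)
    rw [map_add] at this
    exact hs' (add_mem_cancel_left this hs)

theorem exists_push_skelStep_eq {k n : ℕ} {c : Chain n (skel C (k + 1))}
    (hc : c ∈ sub n (cwAttach C k).A) : ∃ c', push (skelStep C k) c' = c :=
  exists_push_eq _ (fun σ hσ => ⟨⟨fun t => ⟨(σ t).1, hσ t⟩,
    (continuous_subtype_val.comp σ.continuous).subtype_mk _⟩, rfl⟩) hc

theorem skelCompl_eq {k : ℕ} (β : RelCWComplex.cell C k) :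
    skelCompl (k + 1) β = ((cwAttach C k).cell β)ᶜ := by
  rw [cwAttach_cell]
  rfl

/-- The square of the cellular boundary map vanishes. -/
theorem even_card_degreeMap_ne_zero {l : ℕ} (γ : RelCWComplex.cell C (l + 2))
    (α : RelCWComplex.cell C l) :
    Even {β : RelCWComplex.cell C (l + 1) | degreeMap γ β ≠ 0 ∧ degreeMap β α ≠ 0}.ncard := by
  classical
  by_cases hγ : ∃ β : RelCWComplex.cell C (l + 1), degreeMap γ β ≠ 0
  swap
  · push Not at hγ
    simp [hγ]
  obtain ⟨β₀, hβ₀⟩ := hγ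
  -- One nonzero degree yields a nontrivial reduced cycle on the sphere of `γ`, which then serves
  -- for every `β`.
  obtain ⟨s₀, ⟨g₀, hg₀⟩, hs₀⟩ := (degreeMap_ne_zero_iff_outside γ β₀).1 hβ₀
  have hg₀' : g₀ ∉ relBoundaries (l + 3) (outside (Fin (l + 2) → ℝ)) := by
    intro h
    obtain ⟨v, rfl⟩ := exists_bd_eq_of_bounding hg₀ h
    rw [← bd_push] at hs₀
    exact hs₀ (bd_mem_relBoundaries _)
  have hz : bd (push (attachOutside γ) s₀) = 0 := by
    rw [bd_push, bd_eq_zero_of_bounding hg₀, map_zero]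
  obtain ⟨f, hf, hsum⟩ := (cwAttach C (l + 1)).exists_sum_push (n := l + 1)
    (z := push (attachOutside γ) s₀) (by
      rw [relCycles, Submodule.mem_comap, hz]
      exact Submodule.zero_mem _)
  have hdeg (β : RelCWComplex.cell C (l + 1)) : degreeMap γ β ≠ 0 ↔
      f β ∉ relBoundaries (l + 2) (outside (Fin (l + 1) → ℝ)) := by
    rw [degreeMap_ne_zero_iff_of_notMem γ β hg₀ hg₀', skelCompl_eq,
      (cwAttach C (l + 1)).mem_relBoundaries_iff hf hsum]
  choose s hs using fun β => exists_push_incl_eq (hf β)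
  -- If `f β` is trivial, its boundary `s β` bounds outside the ball and contributes nothing.
  -- Otherwise `s β` detects the degree of `β` at `α`.
  have hbd (β : RelCWComplex.cell C (l + 1)) : push (attachOutside β) (s β) ∉
      relBoundaries (l + 1) (skelCompl (l + 1) α) ↔ degreeMap γ β ≠ 0 ∧ degreeMap β α ≠ 0 := by
    rw [hdeg]
    by_cases h : f β ∈ relBoundaries (l + 2) (outside (Fin (l + 1) → ℝ))
    · obtain ⟨v, hv⟩ := exists_bd_eq_of_bounding (hs β).symm h
      rw [← hv, ← bd_push]
      exact ⟨fun h' => absurd (bd_mem_relBoundaries _) h', fun h' => absurd h h'.1⟩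
    · rw [degreeMap_ne_zero_iff_of_notMem β α (hs β).symm h]
      exact ⟨fun h' => ⟨h, h'⟩, fun h' => h'.2⟩
  obtain ⟨w, v, hv, e⟩ := mem_relBoundaries.1 hsum
  obtain ⟨v, rfl⟩ := exists_push_skelStep_eq hv
  -- The boundary of the decomposition `e`. The cycle on the left drops out, and since the inclusion
  -- of skeleta is injective on chains, the equation holds in the `l`-skeleton.
  have hv' : ∑ β ∈ f.support, push (attachOutside β) (s β) = bd v := by
    rw [← sub_eq_zero]
    refine push_injOn (f := skelStep C (l + 1)) (A := Set.univ)
      (fun _ _ _ _ h => Subtype.ext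
        (congrArg (fun y : skel C (l + 2) => y.1) h)) (mem_sub_univ _) ?_
    have e' := congrArg bd e
    rw [map_add, map_add, bd_bd, hz, zero_add, zero_add, Finsupp.sum, map_sum] at e'
    rw [map_sub, ← bd_push, e', map_sum, sub_eq_zero]
    refine Finset.sum_congr rfl fun β _ => ?_
    rw [bd_push, ← hs β, push_push, push_push]
    rfl
  -- The summands lie in a group with at most one nonzero class modulo boundaries, and their sum is
  -- a boundary.
  have hmem := (((cwAttach C l).single α).atMostOneClass.sum_mem_iff f.support
    (fun β => push (attachOutside β) (s β)) fun β _ => ?_).1 ?_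
  · convert hmem using 1
    rw [← Set.ncard_coe_finset]
    congr 1
    ext β
    rw [Finset.coe_filter]
    have := hbd β
    rw [skelCompl_eq] at this
    refine (this.symm.trans ⟨fun h => ⟨?_, h⟩, fun h => h.2⟩)
    by_contra hβ
    exact (hdeg β).1 (this.1 h).1 (by
      rw [Finsupp.notMem_support_iff.1 hβ]
      exact Submodule.zero_mem _)
  · rw [relCycles, Submodule.mem_comap, bd_push, bd_eq_zero_of_bounding (hs β).symm, map_zero]
    exact Submodule.zero_mem _
  · rw [hv']
    exact bd_mem_relBoundaries _

end Cellular

end ModTwo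
end

noncomputable section

namespace ModTwo

/-! ### Products of Pauli matrices -/

open HomologyCode

section Pauli

/-- The nontrivial additive character of `ℤ/2`. -/
def sign (a : ZMod 2) : ℂ := if a = 0 then 1 else -1

theorem sign_zero : sign 0 = 1 := if_pos rfl

theorem sign_one : sign 1 = -1 := if_neg one_ne_zero

theorem eq_zero_or_one (a : ZMod 2) : a = 0 ∨ a = 1 := by
  revert a
  decide

theorem sign_add (a b : ZMod 2) : sign (a + b) = sign a * sign b := by
  rcases eq_zero_or_one a with rfl | rfl <;> rcases eq_zero_or_one b with rfl | rfl <;>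
    simp [sign_zero, sign_one, ZModModule.add_self]

theorem sign_sum {ι : Type*} (s : Finset ι) (f : ι → ZMod 2) :
    sign (∑ i ∈ s, f i) = ∏ i ∈ s, sign (f i) := by
  classical
  induction s using Finset.induction_on with
  | empty => simp [sign_zero]
  | insert a s ha ih => rw [Finset.sum_insert ha, Finset.prod_insert ha, sign_add, ih]

theorem sign_mul_eq_self_iff (a : ZMod 2) (x : ℂ) : sign a * x = x ↔ a = 0 ∨ x = 0 := by
  rcases eq_zero_or_one a with rfl | rfl
  · simp [sign_zero]
  · simp [sign_one, neg_eq_self]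

/-- `ZMod 2` unfolds to `Fin 2`, so chain coefficients index the basis of a qubit, and `σ_x` becomes
a translation. -/
theorem sigmaX_apply (v : Fin 2 → ℂ) (a : ZMod 2) : sigmaX v a = v (a + 1 : ZMod 2) := by
  rcases eq_zero_or_one a with rfl | rfl
  · change sigmaX v 0 = v 1
    simp [sigmaX, Matrix.toLin'_apply, Matrix.mulVec, dotProduct]
  · change sigmaX v 1 = v 0
    simp [sigmaX, Matrix.toLin'_apply, Matrix.mulVec, dotProduct]

theorem sigmaZ_apply (v : Fin 2 → ℂ) (a : ZMod 2) : sigmaZ v a = sign a * v a := by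
  rcases eq_zero_or_one a with rfl | rfl
  · rw [sign_zero]
    change sigmaZ v 0 = 1 * v 0
    simp [sigmaZ, Matrix.toLin'_apply, Matrix.mulVec, dotProduct]
  · rw [sign_one]
    change sigmaZ v 1 = -1 * v 1
    simp [sigmaZ, Matrix.toLin'_apply, Matrix.mulVec, dotProduct]

theorem sigmaZ_sigmaX (v : Fin 2 → ℂ) : sigmaZ (sigmaX v) = (-1 : ℂ) • sigmaX (sigmaZ v) := by
  have key (a : ZMod 2) (x : ℂ) : sign a * x = -1 * (sign (a + 1) * x) := by
    rw [sign_add, sign_one]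
    ring
  ext a
  refine ((sigmaZ_apply (sigmaX v) a).trans (congrArg _ (sigmaX_apply v a))).trans
    (Eq.trans ?_ (congrArg ((-1 : ℂ) • ·) ((sigmaX_apply (sigmaZ v) a).trans (sigmaZ_apply v _)).symm))
  exact key a _

end Pauli

section Operators

variable {I : Type*}

open Classical in
/-- The operator which acts as `A` on the qubits in `S` and as the identity on the others. -/
def act (A : (Fin 2 → ℂ) →ₗ[ℂ] (Fin 2 → ℂ)) (S : Set I) :
    Module.End ℂ (⨂[ℂ] _ : I, (Fin 2 → ℂ)) :=
  PiTensorProduct.map fun i => if i ∈ S then A else LinearMap.id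

open Classical in
theorem act_tprod (A : (Fin 2 → ℂ) →ₗ[ℂ] (Fin 2 → ℂ)) (S : Set I) (v : I → Fin 2 → ℂ) :
    act A S (PiTensorProduct.tprod ℂ v) =
      PiTensorProduct.tprod ℂ fun i => if i ∈ S then A (v i) else v i := by
  rw [act, PiTensorProduct.map_tprod]
  congr 1
  ext1 i
  split_ifs <;> rfl

theorem commute_act (A : (Fin 2 → ℂ) →ₗ[ℂ] (Fin 2 → ℂ)) (S S' : Set I) :
    Commute (act A S) (act A S') := by
  refine PiTensorProduct.ext (MultilinearMap.ext fun v => ?_)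
  change act A S (act A S' (PiTensorProduct.tprod ℂ v)) =
    act A S' (act A S (PiTensorProduct.tprod ℂ v))
  rw [act_tprod, act_tprod, act_tprod, act_tprod]
  congr 1
  ext1 i
  split_ifs <;> rfl

/-- Products of `σ_z` and of `σ_x` commute if they overlap in an even number of qubits. -/
theorem commute_act_sigmaZ_sigmaX {S S' : Set I} (hfin : (S ∩ S').Finite)
    (h : Even (S ∩ S').ncard) : Commute (act sigmaZ S) (act sigmaX S') := by
  classical
  refine PiTensorProduct.ext (MultilinearMap.ext fun v => ?_)
  change act sigmaZ S (act sigmaX S' (PiTensorProduct.tprod ℂ v)) =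
    act sigmaX S' (act sigmaZ S (PiTensorProduct.tprod ℂ v))
  rw [act_tprod, act_tprod, act_tprod, act_tprod]
  set w : I → Fin 2 → ℂ := fun i =>
    if i ∈ S' then sigmaX (if i ∈ S then sigmaZ (v i) else v i)
    else if i ∈ S then sigmaZ (v i) else v i with hw
  -- The two orders differ by a factor `-1` on each common qubit. Multilinearity collects these into
  -- one sign; only the overlap has to be finite for this, not the set of qubits.
  have hs := (PiTensorProduct.tprod ℂ).map_piecewise_smul (fun _ => (-1 : ℂ)) w hfin.toFinset
  rw [Finset.prod_const, ← Set.ncard_eq_toFinset_card _ hfin, h.neg_one_pow, one_smul] at hs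
  rw [← hs]
  congr 1
  ext1 i
  by_cases h1 : i ∈ S <;> by_cases h2 : i ∈ S' <;>
    simp [Finset.piecewise, hw, h1, h2, sigmaZ_sigmaX]

end Operators

/-! ### States as functions on chains -/

section Coordinates

variable {I : Type*} [Finite I]

/-- The computational basis of the state space, indexed by the chains modulo 2. -/
def qubitBasis (I : Type*) [Finite I] :
    Module.Basis (I →₀ ZMod 2) ℂ (⨂[ℂ] _ : I, (Fin 2 → ℂ)) :=
  (Basis.piTensorProduct (κ := fun _ : I => ZMod 2) fun _ => Pi.basisFun ℂ (Fin 2)).reindex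
    Finsupp.equivFunOnFinite.symm

/-- The wave function of a state. -/
def wave (I : Type*) [Finite I] : (⨂[ℂ] _ : I, (Fin 2 → ℂ)) ≃ₗ[ℂ] ((I →₀ ZMod 2) → ℂ) :=
  have : Finite (I →₀ ZMod 2) := Finite.of_equiv _ Finsupp.equivFunOnFinite.symm
  (qubitBasis I).repr ≪≫ₗ Finsupp.linearEquivFunOnFinite ℂ ℂ _

theorem wave_tprod [Fintype I] (v : I → Fin 2 → ℂ) (c : I →₀ ZMod 2) :
    wave I (PiTensorProduct.tprod ℂ v) c = ∏ i, v i (c i : ZMod 2) := by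
  change (qubitBasis I).repr _ c = _
  rw [qubitBasis, Module.Basis.repr_reindex_apply]
  exact Basis.piTensorProduct_repr_tprod_apply (κ := fun _ : I => ZMod 2) _ _ _

open Classical in
theorem wave_sigmaZ [Fintype I] (S : Set I) (ψ : ⨂[ℂ] _ : I, (Fin 2 → ℂ)) (c : I →₀ ZMod 2) :
    wave I (act sigmaZ S ψ) c = sign (∑ i, if i ∈ S then c i else 0) * wave I ψ c := by
  have h : LinearMap.proj c ∘ₗ (wave I).toLinearMap ∘ₗ act sigmaZ S =
      sign (∑ i, if i ∈ S then c i else 0) • (LinearMap.proj c ∘ₗ (wave I).toLinearMap) := by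
    refine PiTensorProduct.ext (MultilinearMap.ext fun v => ?_)
    change wave I (act sigmaZ S (PiTensorProduct.tprod ℂ v)) c =
      sign _ * wave I (PiTensorProduct.tprod ℂ v) c
    rw [act_tprod, wave_tprod, wave_tprod, sign_sum, ← Finset.prod_mul_distrib]
    refine Finset.prod_congr rfl fun i _ => ?_
    split_ifs
    · exact sigmaZ_apply _ _
    · rw [sign_zero, one_mul]
  exact LinearMap.congr_fun h ψ

open Classical in
theorem wave_sigmaX {S : Set I} {b : I →₀ ZMod 2} (hb : ∀ i, b i = if i ∈ S then 1 else 0)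
    (ψ : ⨂[ℂ] _ : I, (Fin 2 → ℂ)) (c : I →₀ ZMod 2) :
    wave I (act sigmaX S ψ) c = wave I ψ (c + b) := by
  have := Fintype.ofFinite I
  have h : LinearMap.proj c ∘ₗ (wave I).toLinearMap ∘ₗ act sigmaX S =
      LinearMap.proj (c + b) ∘ₗ (wave I).toLinearMap := by
    refine PiTensorProduct.ext (MultilinearMap.ext fun v => ?_)
    change wave I (act sigmaX S (PiTensorProduct.tprod ℂ v)) c =
      wave I (PiTensorProduct.tprod ℂ v) (c + b)
    rw [act_tprod, wave_tprod, wave_tprod]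
    refine Finset.prod_congr rfl fun i _ => ?_
    rw [Finsupp.add_apply, hb]
    split_ifs
    · exact sigmaX_apply _ _
    · rw [add_zero]
  exact LinearMap.congr_fun h ψ

end Coordinates

/-! ### Functions on a subquotient -/

section Quotient

variable {M : Type*} [AddCommGroup M] (Z B : AddSubgroup M)

open Classical in
/-- The extension by zero of a function on the quotient `Z / B`. -/
def extendQuotient : (Z ⧸ B.addSubgroupOf Z → ℂ) →ₗ[ℂ] (M → ℂ) where
  toFun h x := if hx : x ∈ Z then h (QuotientAddGroup.mk ⟨x, hx⟩) else 0
  map_add' h h' := by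
    ext x
    by_cases hx : x ∈ Z <;> simp [hx]
  map_smul' a h := by
    ext x
    by_cases hx : x ∈ Z <;> simp [hx]

variable {Z B}

theorem extendQuotient_of_mem (h : Z ⧸ B.addSubgroupOf Z → ℂ) {x : M} (hx : x ∈ Z) :
    extendQuotient Z B h x = h (QuotientAddGroup.mk ⟨x, hx⟩) := dif_pos hx

theorem extendQuotient_of_notMem (h : Z ⧸ B.addSubgroupOf Z → ℂ) {x : M} (hx : x ∉ Z) :
    extendQuotient Z B h x = 0 := dif_neg hx

theorem extendQuotient_injective : Function.Injective (extendQuotient Z B) := by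
  intro h h' e
  ext q
  obtain ⟨x, rfl⟩ := QuotientAddGroup.mk_surjective q
  rw [← extendQuotient_of_mem h x.2, ← extendQuotient_of_mem h' x.2, e]

/-- Because `B ≤ Z`, translation by `B` preserves both `Z` and its complement, so the two conditions
are compatible. -/
theorem mem_range_extendQuotient (hBZ : B ≤ Z) {f : M → ℂ} :
    f ∈ LinearMap.range (extendQuotient Z B) ↔
      (∀ x ∉ Z, f x = 0) ∧ ∀ b ∈ B, ∀ x, f (x + b) = f x := by
  constructor
  · rintro ⟨h, rfl⟩
    refine ⟨fun x hx => extendQuotient_of_notMem h hx, fun b hb x => ?_⟩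
    by_cases hx : x ∈ Z
    · rw [extendQuotient_of_mem h hx, extendQuotient_of_mem h (Z.add_mem hx (hBZ hb))]
      refine congrArg h (QuotientAddGroup.eq.2 ?_)
      rw [AddSubgroup.mem_addSubgroupOf]
      simpa using B.neg_mem hb
    · rw [extendQuotient_of_notMem h hx, extendQuotient_of_notMem h fun h' =>
        hx ((AddSubgroup.add_mem_cancel_right Z (hBZ hb)).1 h')]
  · rintro ⟨h0, hB⟩
    refine ⟨fun q => f q.out, ?_⟩
    ext x
    by_cases hx : x ∈ Z
    · rw [extendQuotient_of_mem _ hx]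
      have hq := QuotientAddGroup.eq.1 (Quotient.out_eq
        (QuotientAddGroup.mk (s := B.addSubgroupOf Z) ⟨x, hx⟩))
      rw [AddSubgroup.mem_addSubgroupOf] at hq
      rw [← hB _ hq]
      congr 1
      exact add_neg_cancel_left _ _
    · rw [extendQuotient_of_notMem _ hx, h0 x hx]

end Quotient

end ModTwo
end

noncomputable section

namespace ModTwo

/-! ### The homology code -/

open HomologyCode

section Code

variable {X : Type u} [TopologicalSpace X] [T2Space X] {C : Set X} [CWComplex C]

theorem incidence_ne_zero_iff {n : ℕ} (γ : RelCWComplex.cell C (n + 1))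
    (β : RelCWComplex.cell C n) : incidence γ β ≠ 0 ↔ degreeMap γ β ≠ 0 := by
  simp [incidence]

theorem even_card_incidence {l : ℕ} (γ : RelCWComplex.cell C (l + 2))
    (α : RelCWComplex.cell C l) :
    Even (coboundaryCells (l + 1) α ∩ boundaryCells (l + 1) γ).ncard := by
  convert even_card_degreeMap_ne_zero γ α using 2
  ext β
  change incidence β α ≠ 0 ∧ incidence γ β ≠ 0 ↔ _
  rw [incidence_ne_zero_iff, incidence_ne_zero_iff, and_comm]
  rfl

theorem opV_eq (k : ℕ) {m : ℕ} (α : RelCWComplex.cell C m) :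
    opV k α = act sigmaZ (coboundaryCells k α) := rfl

theorem opP_eq (k : ℕ) (γ : RelCWComplex.cell C (k + 1)) :
    opP k γ = act sigmaX (boundaryCells k γ) := rfl

theorem finite_boundaryCells {k : ℕ} (γ : RelCWComplex.cell C (k + 1)) :
    (boundaryCells k γ).Finite := finite_support_incidence k γ

theorem commute_opV_opP {k m : ℕ} (hm : m + 1 = k) (α : RelCWComplex.cell C m)
    (γ : RelCWComplex.cell C (k + 1)) : Commute (opV k α) (opP k γ) := by
  subst hm
  rw [opV_eq, opP_eq]
  exact commute_act_sigmaZ_sigmaX ((finite_boundaryCells γ).subset Set.inter_subset_right)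
    (even_card_incidence γ α)

theorem commute_stabilizers {k : ℕ} {A B : Module.End ℂ (Qubits C k)} (hA : A ∈ stabilizers C k)
    (hB : B ∈ stabilizers C k) : Commute A B := by
  rcases hA with ⟨m, hm, α, rfl⟩ | ⟨γ, rfl⟩ <;> rcases hB with ⟨m', hm', α', rfl⟩ | ⟨γ', rfl⟩
  · exact commute_act _ _ _
  · exact commute_opV_opP hm α γ'
  · exact (commute_opV_opP hm' α' γ).symm
  · exact commute_act _ _ _

theorem incidence_eq_ite {m n : ℕ} (γ : RelCWComplex.cell C m) (β : RelCWComplex.cell C n)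
    {p : Prop} [Decidable p] (hp : p ↔ incidence γ β ≠ 0) : incidence γ β = if p then 1 else 0 := by
  rcases eq_zero_or_one (incidence γ β) with h | h <;> simp [hp, h]

theorem boundary_single_apply {k n : ℕ} (γ : RelCWComplex.cell C k) (β : RelCWComplex.cell C n) :
    boundary C k n (Finsupp.single γ 1) β = incidence γ β := by
  rw [boundary, Finsupp.linearCombination_single, one_smul]
  rfl

open Classical in
theorem boundary_apply {k n : ℕ} [Fintype (RelCWComplex.cell C k)] (c : Chains C k)
    (α : RelCWComplex.cell C n) :
    boundary C k n c α = ∑ β, if β ∈ coboundaryCells k α then c β else 0 := by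
  rw [boundary, Finsupp.linearCombination_apply, Finsupp.sum_fintype _ _ (by simp),
    Finsupp.finsetSum_apply]
  refine Finset.sum_congr rfl fun β _ => ?_
  change c β * incidence β α = _
  rw [incidence_eq_ite β α (p := β ∈ coboundaryCells k α) Iff.rfl, mul_ite, mul_one, mul_zero]

/-- For `m + 1 ≠ k` the incidence numbers vanish by definition, so those members of the infimum
impose nothing. -/
theorem mem_cycles_iff {k : ℕ} (c : Chains C k) :
    c ∈ cycles C k ↔ ∀ m, m + 1 = k → ∀ α : RelCWComplex.cell C m, boundary C k m c α = 0 := by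
  rw [cycles, Submodule.mem_iInf]
  refine forall_congr' fun m => ?_
  rw [LinearMap.mem_ker]
  refine ⟨fun h _ α => by rw [h]; rfl, fun h => ?_⟩
  ext α
  by_cases hm : m + 1 = k
  · exact h hm α
  · have h0 (β : RelCWComplex.cell C k) : incidence β α = 0 :=
      if_neg fun h => hm h.1.symm
    rw [boundary, Finsupp.linearCombination_apply, Finsupp.sum, Finsupp.finsetSum_apply]
    refine Finset.sum_eq_zero fun β _ => ?_
    change c β * incidence β α = 0
    rw [h0, mul_zero]

theorem boundary_induction {k : ℕ} {p : Chains C k → Prop} (h0 : p 0)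
    (hadd : ∀ b b', p b → p b' → p (b + b'))
    (h : ∀ γ, p (boundary C (k + 1) k (Finsupp.single γ 1))) {b : Chains C k}
    (hb : b ∈ boundaries C k) : p b := by
  obtain ⟨d, rfl⟩ := hb
  induction d using Finsupp.induction_linear with
  | zero => rwa [map_zero]
  | add d d' hd hd' =>
    rw [map_add]
    exact hadd _ _ hd hd'
  | single γ a =>
    rcases eq_zero_or_one a with rfl | rfl
    · rwa [Finsupp.single_zero, map_zero]
    · exact h γ

theorem boundaries_le_cycles (k : ℕ) [Finite (RelCWComplex.cell C k)] :
    boundaries C k ≤ cycles C k := by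
  classical
  intro b hb
  refine boundary_induction (p := (· ∈ cycles C k)) (Submodule.zero_mem _)
    (fun _ _ => Submodule.add_mem _) (fun γ => ?_) hb
  rw [mem_cycles_iff]
  rintro m rfl α
  have := Fintype.ofFinite (RelCWComplex.cell C (m + 1))
  rw [boundary_apply]
  -- The coefficient of `α` in `∂∂γ` counts, modulo 2, the cells on both the coboundary of `α` and
  -- the boundary of `γ`.
  have e (β : RelCWComplex.cell C (m + 1)) :
      (if β ∈ coboundaryCells (m + 1) α then
        boundary C (m + 1 + 1) (m + 1) (Finsupp.single γ 1) β else 0) =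
      if β ∈ coboundaryCells (m + 1) α ∩ boundaryCells (m + 1) γ then 1 else 0 := by
    rw [boundary_single_apply, incidence_eq_ite γ β (p := β ∈ boundaryCells (m + 1) γ) Iff.rfl,
      ← ite_and]
    rfl
  rw [Finset.sum_congr rfl fun β _ => e β, Finset.sum_boole]
  have h := even_card_incidence γ α
  rw [← Set.ncard_coe_finset]
  convert (ZMod.natCast_eq_zero_iff_even).2 h using 4
  simp

/-- A state is in the code space if and only if its wave function is the extension by zero of a
function on the homology group. -/
theorem mem_codeSpace_iff {k : ℕ} [Finite (RelCWComplex.cell C k)] (ψ : Qubits C k) :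
    ψ ∈ codeSpace C k ↔ wave (RelCWComplex.cell C k) ψ ∈
      LinearMap.range (extendQuotient (cycles C k).toAddSubgroup
        (boundaries C k).toAddSubgroup) := by
  classical
  have := Fintype.ofFinite (RelCWComplex.cell C k)
  set f := wave (RelCWComplex.cell C k) ψ with hf
  -- In coordinates `V_α` is multiplication by the sign of `(∂c) α`, so it fixes the state exactly
  -- when `f` vanishes wherever this coefficient is nonzero.
  have hV {m : ℕ} (α : RelCWComplex.cell C m) :
      opV k α ψ = ψ ↔ ∀ c, boundary C k m c α = 0 ∨ f c = 0 := by
    rw [← (wave (RelCWComplex.cell C k)).injective.eq_iff, funext_iff]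
    refine forall_congr' fun c => ?_
    rw [opV_eq, wave_sigmaZ, ← boundary_apply, sign_mul_eq_self_iff]
  have hP (γ : RelCWComplex.cell C (k + 1)) :
      opP k γ ψ = ψ ↔ ∀ c, f (c + boundary C (k + 1) k (Finsupp.single γ 1)) = f c := by
    rw [← (wave (RelCWComplex.cell C k)).injective.eq_iff, funext_iff]
    refine forall_congr' fun c => ?_
    rw [opP_eq, wave_sigmaX (b := boundary C (k + 1) k (Finsupp.single γ 1)) fun β => ?_]
    rw [boundary_single_apply]
    exact incidence_eq_ite γ β Iff.rfl
  have hcode : ψ ∈ codeSpace C k ↔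
      (∀ m, m + 1 = k → ∀ α : RelCWComplex.cell C m, opV k α ψ = ψ) ∧
        ∀ γ : RelCWComplex.cell C (k + 1), opP k γ ψ = ψ := by
    simp only [codeSpace, Submodule.mem_iInf, Module.End.mem_eigenspace_iff, one_smul]
    constructor
    · exact fun h => ⟨fun m hm α => h _ (Or.inl ⟨m, hm, α, rfl⟩), fun γ => h _ (Or.inr ⟨γ, rfl⟩)⟩
    · rintro h _ (⟨m, hm, α, rfl⟩ | ⟨γ, rfl⟩)
      · exact h.1 m hm α
      · exact h.2 γ
  rw [hcode, mem_range_extendQuotient (boundaries_le_cycles k)]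
  refine and_congr ?_ ?_
  · simp only [hV]
    constructor
    · intro h c hc
      by_contra h0
      exact hc ((mem_cycles_iff c).2 fun m hm α => (h m hm α c).resolve_right h0)
    · intro h m hm α c
      by_contra! h'
      exact h'.2 (h c fun hc => h'.1 ((mem_cycles_iff c).1 hc m hm α))
  · simp only [hP]
    constructor
    · intro h b hb
      refine boundary_induction (p := fun b => ∀ x, f (x + b) = f x) (fun x => by rw [add_zero])
        (fun b b' h1 h2 x => by rw [← add_assoc, h2, h1]) h hb
    · exact fun h γ c => h _ ⟨_, rfl⟩ c

theorem nonempty_codeSpace_equiv (k : ℕ) [Finite (RelCWComplex.cell C k)] :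
    Nonempty (codeSpace C k ≃ₗ[ℂ] AddMonoidAlgebra ℂ (Homology C k)) := by
  -- With finitely many chains the homology group is finite, so all functions on it have finite
  -- support and form the group algebra as a vector space.
  have : Finite (Chains C k) := Finite.of_equiv _ Finsupp.equivFunOnFinite.symm
  have e : codeSpace C k = (LinearMap.range (extendQuotient (cycles C k).toAddSubgroup
      (boundaries C k).toAddSubgroup)).comap (wave (RelCWComplex.cell C k)).toLinearMap :=
    Submodule.ext mem_codeSpace_iff
  exact ⟨LinearEquiv.ofEq _ _ e ≪≫ₗ (wave (RelCWComplex.cell C k)).ofSubmodule' _ ≪≫ₗ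
    (LinearEquiv.ofInjective _ extendQuotient_injective).symm ≪≫ₗ
    (Finsupp.linearEquivFunOnFinite ℂ ℂ (Homology C k)).symm ≪≫ₗ
    (AddMonoidAlgebra.coeffLinearEquiv ℂ).symm⟩

end Code

end ModTwo

theorem mainTheorem1 {X : Type u} [TopologicalSpace X] [T2Space X] (T : Set X) [CWComplex T]
    (k : ℕ) :
    (∀ A ∈ HomologyCode.stabilizers T k, ∀ B ∈ HomologyCode.stabilizers T k, Commute A B) ∧
    (Finite (RelCWComplex.cell T k) →
      Nonempty (HomologyCode.codeSpace T k ≃ₗ[ℂ]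
        AddMonoidAlgebra ℂ (HomologyCode.Homology T k))) :=
  ⟨fun _ hA _ hB => ModTwo.commute_stabilizers hA hB,
    fun _ => ModTwo.nonempty_codeSpace_equiv k⟩
end
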